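/- Let $Q$ be a finite quiver with nodes $Q_0$ and arrows $Q_1$, and let $\sigma$ be an involution of $Q$: involutions of $Q_0$ and $Q_1$ such that an arrow $\alpha:i\to j$ is sent to $\sigma(\alpha):\sigma(j)\to\sigma(i)$, and every arrow of the form $i\to\sigma(i)$ is fixed. Fix a duality structure, i.e. signs $s:Q_0\to\{\pm1\}$, $\tau:Q_1\to\{\pm1\}$ with $s_{\sigma(i)}=s_i$ and $\tau_\alpha\tau_{\sigma(\alpha)}=s_is_j$ for $\alpha:i\to j$. Choose partitions $Q_0=Q_0^+\sqcup Q_0^\sigma\sqcup Q_0^-$ and $Q_1=Q_1^+\sqcup Q_1^\sigma\sqcup Q_1^-$, where the middle parts consist of the $\sigma$-fixed elements and $\sigma$ exchanges the $+$ and $-$ parts. Let $\Lambda_Q=\mathbb Z Q_0$, $\Lambda_Q^+=\mathbb Z_{\ge0}Q_0$, let $\Lambda_Q^{\sigma,+}$ be the set of $\sigma$-invariant elements of $\Lambda_Q^+$, and put $H(d)=d+\sigma(d)$, $$\chi(d,d')=\sum_{i\in Q_0}d_id_i'-\sum_{i\to j\in Q_1}d_id'_j,$$ $$\mathcal E(d)=\sum_{i\in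 Q_0^\sigma}\frac{d_i(d_i-s_i)}2+\sum_{i\in Q_0^+}d_{\sigma(i)}d_i-\sum_{\alpha:\sigma(i)\to i\in Q_1^\sigma}\frac{d_i(d_i+\tau_\alpha s_i)}2-\sum_{i\to j\in Q_1^+}d_{\sigma(i)}d_j .$$ A self-dual representation over a field $k$ is a finite-dimensional representation $M=((M_i)_{i\in Q_0},(m_\alpha)_{\alpha\in Q_1})$ of $Q$ with a non-degenerate bilinear form on $\bigoplus_iM_i$ such that $M_i\perp M_j$ unless $i=\sigma(j)$, the form is $s_i$-symmetric on $M_i+M_{\sigma(i)}$, and $\langle m_\alpha x,x'\rangle=\tau_\alpha\langle x,m_{\sigma(\alpha)}x'\rangle$ for $\alpha:i\to j$, $x\in M_i$, $x'\in M_{\sigma(j)}$. Isometries are isomorphisms of representations preserving the forms; $\mathrm{Aut}_S(M)$ is the group of self-isometries of $M$. Let $\theta\in\mathrm{Hom}(\Lambda_Q,\mathbb Z)$ be a $\sigma$-compatible stability, $\theta(\sigma(d))=-\theta(d)$ for all $d$, and let $\mu(d)=\theta(d)/\sum_id_i$ for $0\neq d\in\Lambda_Q^+$. A self-dual representation $M$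 is semistable if $\mu(U)\le\mu(M)$ for all non-zero isotropic subrepresentations $U\subset M$ (in particular $M=0$ is semistable). Let $d\in\Lambda_Q^{\sigma,+}$. For a finite field $\mathbb F_q$ of odd characteristic put $$A_d^{\sigma,\theta}(\mathbb F_q)=q^{\frac12\mathcal E(d)}\sum_{M}\frac1{\#\mathrm{Aut}_S(M)},$$ where $M$ runs over the isometry classes of semistable self-dual $\mathbb F_q$-representations of dimension vector $d$; there are finitely many such classes and each $\mathrm{Aut}_S(M)$ is finite. The sum is the number of $\mathbb F_q$-points of the stack of semistable self-dual representations of dimension vector $d$. Write $(y)_n=\prod_{i=1}^n(1-y^i)$, $(y)_e=\prod_{i\in Q_0}(y)_{e_i}$ for $e\in\Lambda_Q^+$ and $(y)^\sigma_e=\prod_{i\in Q_0^\sigma}(y^2)_{\lfloor e_i/2\rfloor}\prod_{i\in Q_0^+}(y)_{e_i}$ for $e\in\Lambda_Q^{\sigma,+}$. **Theorem.** (1) Assume that $d_i$ is even for every $i\in Q_0^\sigma$ with $s_i=-1$. Then for every finite field $\mathbb F_q$ of odd characteristic $$A_d^{\sigma,\theta}(\mathbb F_q)=q^{\frac12\mathcal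 E(d)}\sum_{(d^\bullet;d^\infty)}(-1)^n\,q^{-\sum_{1\le i<j\le n}\chi(d^j,d^i)-\sum_{i=1}^n\chi(d^\infty,d^i)-\mathcal E(\sum_{i=1}^nd^i)}\left(\prod_{i=1}^n\frac{q^{-\chi(d^i,d^i)}}{(q^{-1})_{d^i}}\right)\frac{q^{-\mathcal E(d^\infty)}}{(q^{-1})^\sigma_{d^\infty}} .$$ The (finite) sum runs over all $n\ge0$, all sequences $d^\bullet=(d^1,\dots,d^n)$ of non-zero elements of $\Lambda_Q^+$ and all $d^\infty\in\Lambda_Q^{\sigma,+}$ such that $\sum_{i=1}^nH(d^i)+d^\infty=d$ and $\mu(\sum_{i=1}^jd^i)>0$ for $j=1,\dots,n$; this includes $(\varnothing;d)$. (2) For every $d\in\Lambda_Q^{\sigma,+}$ there is a rational function $a_d^{\sigma,\theta}(t)\in\mathbb Z(t^{1/2})$ whose specialization at $t^{1/2}=\sqrt q$ is defined and equal to $A_d^{\sigma,\theta}(\mathbb F_q)$ for every odd prime power $q$. -/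

import Mathlib

open Polynomial

universe u

/-- A finite quiver with nodes `Q₀` and arrows `Q₁`, together with an involution: a pair of
involutions of nodes and arrows reversing arrows, such that every arrow of the form `i ⟶ σ i`
is fixed. -/
structure InvQuiver (Q₀ Q₁ : Type*) where
  /-- source `i` of an arrow `i ⟶ j` -/
  src : Q₁ → Q₀
  /-- target `j` of an arrow `i ⟶ j` -/
  tgt : Q₁ → Q₀
  /-- the involution on nodes -/
  σ₀ : Q₀ → Q₀
  /-- the involution on arrows -/
  σ₁ : Q₁ → Q₁
  σ₀_invol : ∀ i, σ₀ (σ₀ i) = i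
  σ₁_invol : ∀ a, σ₁ (σ₁ a) = a
  src_σ : ∀ a, src (σ₁ a) = σ₀ (tgt a)
  tgt_σ : ∀ a, tgt (σ₁ a) = σ₀ (src a)
  fixed_of_tgt_eq : ∀ a, tgt a = σ₀ (src a) → σ₁ a = a

/-- A duality structure `(s, τ)`: signs on nodes and arrows, `s` being `σ`-invariant and
`τ_α τ_{σ(α)} = s_i s_j` for each arrow `α : i ⟶ j`. -/
structure DualityStructure {Q₀ Q₁ : Type*} (Q : InvQuiver Q₀ Q₁) where
  s : Q₀ → ℤˣ
  τ : Q₁ → ℤˣ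
  s_σ : ∀ i, s (Q.σ₀ i) = s i
  τ_mul : ∀ a, τ a * τ (Q.σ₁ a) = s (Q.src a) * s (Q.tgt a)

/-- A choice of the positive parts `Q₀⁺`, `Q₁⁺` in partitions `Q₀ = Q₀⁺ ⊔ Q₀^σ ⊔ Q₀⁻` and
`Q₁ = Q₁⁺ ⊔ Q₁^σ ⊔ Q₁⁻`, where the middle parts are the fixed points of `σ` and `σ` swaps the
outer parts: no fixed point is positive, and of `x ≠ σ x` exactly one is positive. -/
structure PositivePart {Q₀ Q₁ : Type*} (Q : InvQuiver Q₀ Q₁) where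
  nodes : Finset Q₀
  arrows : Finset Q₁
  fixed_node : ∀ i, Q.σ₀ i = i → i ∉ nodes
  swap_node : ∀ i, Q.σ₀ i ≠ i → (i ∈ nodes ↔ Q.σ₀ i ∉ nodes)
  fixed_arrow : ∀ a, Q.σ₁ a = a → a ∉ arrows
  swap_arrow : ∀ a, Q.σ₁ a ≠ a → (a ∈ arrows ↔ Q.σ₁ a ∉ arrows)

section Combinatorics

variable {Q₀ Q₁ : Type*}

/-- A dimension vector regarded as an element of `Λ_Q = ℤ Q₀`. -/
def toLattice (d : Q₀ → ℕ) : Q₀ → ℤ := fun i => (d i : ℤ)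

/-- The slope `θ(d) / dim d`. -/
def slopeDim [Fintype Q₀] (θ : (Q₀ → ℤ) →ₗ[ℤ] ℤ) (d : Q₀ → ℕ) : ℚ :=
  (θ (toLattice d) : ℚ) / ((∑ i, d i : ℕ) : ℚ)

/-- `(y)_n = ∏_{i=1}^n (1 - y^i)`. -/
def qPoch (y : ℝ) (n : ℕ) : ℝ := ∏ i ∈ Finset.Icc 1 n, (1 - y ^ i)

/-- `(y)_d = ∏_i (y)_{d_i}`. -/
def qPochDim [Fintype Q₀] (y : ℝ) (d : Q₀ → ℕ) : ℝ := ∏ i, qPoch y (d i)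

namespace InvQuiver

/-- The involution of `Λ_Q` sending the basis vector of `i` to that of `σ i`. -/
def σΛ (Q : InvQuiver Q₀ Q₁) {R : Type*} (d : Q₀ → R) : Q₀ → R := fun i => d (Q.σ₀ i)

/-- The hyperbolic map `H(d) = d + σ(d)` on dimension vectors. -/
def hyp (Q : InvQuiver Q₀ Q₁) (d : Q₀ → ℕ) : Q₀ → ℕ := d + Q.σΛ d

/-- `σ`-compatible stabilities: `σ^* θ = -θ`. -/
def IsCompatible (Q : InvQuiver Q₀ Q₁) (θ : (Q₀ → ℤ) →ₗ[ℤ] ℤ) : Prop :=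
  ∀ d, θ (Q.σΛ d) = -θ d

/-- The Euler form. -/
def eulerForm [Fintype Q₀] [Fintype Q₁] (Q : InvQuiver Q₀ Q₁) (d e : Q₀ → ℕ) : ℤ :=
  ∑ i, (d i : ℤ) * e i - ∑ a, (d (Q.src a) : ℤ) * e (Q.tgt a)

/-- `χ(d^•) = ∑_{i < j} χ(d^j, d^i)`. -/
def eulerSeq [Fintype Q₀] [Fintype Q₁] (Q : InvQuiver Q₀ Q₁) : List (Q₀ → ℕ) → ℤ
  | [] => 0
  | d :: l => (l.map fun e => Q.eulerForm e d).sum + eulerSeq Q l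

/-- The Euler function `𝓔` of the category with duality. Both integer divisions are exact. -/
def sdEuler [Fintype Q₀] [DecidableEq Q₀] [Fintype Q₁] [DecidableEq Q₁] (Q : InvQuiver Q₀ Q₁)
    (D : DualityStructure Q) (P : PositivePart Q) (d : Q₀ → ℕ) : ℤ :=
  (∑ i with Q.σ₀ i = i, (d i : ℤ) * (d i - (D.s i : ℤ)) / 2)
  + (∑ i ∈ P.nodes, (d (Q.σ₀ i) : ℤ) * d i)
  - (∑ a with Q.σ₁ a = a,
      (d (Q.tgt a) : ℤ) * (d (Q.tgt a) + (D.τ a : ℤ) * (D.s (Q.tgt a) : ℤ)) / 2)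
  - (∑ a ∈ P.arrows, (d (Q.σ₀ (Q.src a)) : ℤ) * d (Q.tgt a))

/-- `(y)^σ_e = ∏_{i ∈ Q₀^σ} (y²)_{⌊e_i/2⌋} ∏_{i ∈ Q₀⁺} (y)_{e_i}`. -/
def qPochSd [Fintype Q₀] [DecidableEq Q₀] (Q : InvQuiver Q₀ Q₁) (P : PositivePart Q) (y : ℝ)
    (e : Q₀ → ℕ) : ℝ :=
  (∏ i with Q.σ₀ i = i, qPoch (y ^ 2) (e i / 2)) * ∏ i ∈ P.nodes, qPoch y (e i)

/-- The range of summation: pairs `(d^•; d^∞)` consisting of a finite (possibly empty) sequence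
of non-zero dimension vectors and a `σ`-invariant dimension vector, of `σ`-weight
`∑ H(d^i) + d^∞ = d`, such that all non-empty partial sums of `d^•` have positive slope. -/
def sumRange [Fintype Q₀] (Q : InvQuiver Q₀ Q₁) (θ : (Q₀ → ℤ) →ₗ[ℤ] ℤ) (d : Q₀ → ℕ) :
    Set (List (Q₀ → ℕ) × (Q₀ → ℕ)) :=
  {x | (∀ e ∈ x.1, e ≠ 0) ∧ Q.σΛ x.2 = x.2 ∧ (x.1.map Q.hyp).sum + x.2 = d ∧
    ∀ j, 1 ≤ j → j ≤ x.1.length → 0 < slopeDim θ (x.1.take j).sum}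

/-- The summand attached to `(d^•; d^∞)`. -/
noncomputable def summand [Fintype Q₀] [DecidableEq Q₀] [Fintype Q₁] [DecidableEq Q₁]
    (Q : InvQuiver Q₀ Q₁) (D : DualityStructure Q) (P : PositivePart Q)
    (q : ℝ) (x : List (Q₀ → ℕ) × (Q₀ → ℕ)) : ℝ :=
  (-1) ^ x.1.length
  * q ^ (-Q.eulerSeq x.1 - (x.1.map fun e => Q.eulerForm x.2 e).sum - Q.sdEuler D P x.1.sum)
  * (x.1.map fun e => q ^ (-Q.eulerForm e e) / qPochDim q⁻¹ e).prod
  * (q ^ (-Q.sdEuler D P x.2) / Q.qPochSd P q⁻¹ x.2)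

end InvQuiver

end Combinatorics

/-- A self-dual representation over `k`: finite dimensional spaces `V i`, structure maps, and a
non-degenerate bilinear form on the total space `⨁ V i` (the product, as there are finitely many
nodes). -/
structure SelfDualRep (k : Type u) [Field k] {Q₀ Q₁ : Type*} [Fintype Q₀] [DecidableEq Q₀]
    (Q : InvQuiver Q₀ Q₁) (D : DualityStructure Q) where
  V : Q₀ → Type u
  [addCommGroup : ∀ i, AddCommGroup (V i)]
  [module : ∀ i, Module k (V i)]
  [finDim : ∀ i, FiniteDimensional k (V i)]
  map : ∀ a, V (Q.src a) →ₗ[k] V (Q.tgt a)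
  form : LinearMap.BilinForm k (∀ i, V i)
  nondegenerate : form.Nondegenerate
  /-- `V i` and `V j` are orthogonal unless `i = σ j`. -/
  orthogonal : ∀ i j, i ≠ Q.σ₀ j → ∀ (x : V i) (y : V j),
    form (Pi.single i x) (Pi.single j y) = 0
  /-- The form is `s_i`-symmetric on `V i + V (σ i)`. -/
  symm : ∀ i,
    ∀ x ∈ LinearMap.range (LinearMap.single k V i) ⊔
      LinearMap.range (LinearMap.single k V (Q.σ₀ i)),
    ∀ y ∈ LinearMap.range (LinearMap.single k V i) ⊔
      LinearMap.range (LinearMap.single k V (Q.σ₀ i)),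
    form x y = ((D.s i : ℤ) : k) * form y x
  /-- `⟨m_α x, x'⟩ = τ_α ⟨x, m_{σ(α)} x'⟩` for `α : i ⟶ j`, `x ∈ V i` and `x' ∈ V (σ j)`, where
  `σ j` is the source of `σ(α)`. -/
  structure_symm : ∀ a (x : V (Q.src a)) (x' : V (Q.src (Q.σ₁ a))),
    form (Pi.single (Q.tgt a) (map a x)) (Pi.single (Q.src (Q.σ₁ a)) x')
      = ((D.τ a : ℤ) : k) *
        form (Pi.single (Q.src a) x) (Pi.single (Q.tgt (Q.σ₁ a)) (map (Q.σ₁ a) x'))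

attribute [instance] SelfDualRep.addCommGroup SelfDualRep.module SelfDualRep.finDim

namespace SelfDualRep

variable {k : Type u} [Field k] {Q₀ Q₁ : Type*} [Fintype Q₀] [DecidableEq Q₀]
  {Q : InvQuiver Q₀ Q₁} {D : DualityStructure Q}

/-- The dimension vector of a self-dual representation. -/
noncomputable def dimVec (M : SelfDualRep k Q D) : Q₀ → ℕ := fun i => Module.finrank k (M.V i)

/-- `U` is a subrepresentation of `M`. -/
def IsSubrep (M : SelfDualRep k Q D) (U : ∀ i, Submodule k (M.V i)) : Prop :=
  ∀ a, ∀ x ∈ U (Q.src a), M.map a x ∈ U (Q.tgt a)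

/-- `U ⊆ U^⊥`. -/
def IsIsotropic (M : SelfDualRep k Q D) (U : ∀ i, Submodule k (M.V i)) : Prop :=
  ∀ i j, ∀ x ∈ U i, ∀ y ∈ U j, M.form (Pi.single i x) (Pi.single j y) = 0

/-- `M` is (`σ`-)semistable: `μ(U) ≤ μ(M)` for all non-zero isotropic subrepresentations `U`.
The zero representation is semistable. -/
def IsSemistable (M : SelfDualRep k Q D) (θ : (Q₀ → ℤ) →ₗ[ℤ] ℤ) : Prop :=
  ∀ U : ∀ i, Submodule k (M.V i), M.IsSubrep U → M.IsIsotropic U → (∃ i, U i ≠ ⊥) →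
    slopeDim θ (fun i => Module.finrank k (U i)) ≤ slopeDim θ M.dimVec

/-- Isometries of self-dual representations. -/
@[ext]
structure Isometry (M N : SelfDualRep k Q D) where
  toEquiv : ∀ i, M.V i ≃ₗ[k] N.V i
  comm : ∀ a (x : M.V (Q.src a)), toEquiv (Q.tgt a) (M.map a x) = N.map a (toEquiv (Q.src a) x)
  form_eq : ∀ x y : ∀ i, M.V i,
    N.form (fun i => toEquiv i (x i)) (fun i => toEquiv i (y i)) = M.form x y

namespace Isometry

/-- The identity isometry. -/
def refl (M : SelfDualRep k Q D) : Isometry M M where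
  toEquiv _ := LinearEquiv.refl k _
  comm _ _ := rfl
  form_eq _ _ := rfl

/-- The inverse isometry. -/
def symm {M N : SelfDualRep k Q D} (f : Isometry M N) : Isometry N M where
  toEquiv i := (f.toEquiv i).symm
  comm a x := by
    rw [LinearEquiv.symm_apply_eq, f.comm, LinearEquiv.apply_symm_apply]
  form_eq x y := by
    rw [← f.form_eq]
    simp

/-- Composition of isometries. -/
def trans {M N L : SelfDualRep k Q D} (f : Isometry M N) (g : Isometry N L) : Isometry M L where
  toEquiv i := (f.toEquiv i).trans (g.toEquiv i)
  comm a x := by simp [f.comm, g.comm]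
  form_eq x y := by
    rw [← f.form_eq, ← g.form_eq]
    rfl

/-- Conjugation by an isometry identifies isometry groups. -/
def conj {M N : SelfDualRep k Q D} (f : Isometry M N) : Isometry M M ≃ Isometry N N where
  toFun g := f.symm.trans (g.trans f)
  invFun g := f.trans (g.trans f.symm)
  left_inv g := by
    ext i x
    simp [trans, symm]
  right_inv g := by
    ext i x
    simp [trans, symm]

end Isometry

/-- The order of the isometry group `Aut_S(M)`. -/
noncomputable def cardAut (M : SelfDualRep k Q D) : ℕ := Nat.card (Isometry M M)

end SelfDualRep

section Count

variable (k : Type u) [Field k] {Q₀ Q₁ : Type*} [Fintype Q₀] [DecidableEq Q₀]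
  {Q : InvQuiver Q₀ Q₁} (D : DualityStructure Q)

/-- Semistable self-dual `k`-representations of dimension vector `d`. -/
def SemistableRep (θ : (Q₀ → ℤ) →ₗ[ℤ] ℤ) (d : Q₀ → ℕ) :=
  {M : SelfDualRep k Q D // M.dimVec = d ∧ M.IsSemistable θ}

/-- The relation of being isometric. -/
instance isometrySetoid (θ : (Q₀ → ℤ) →ₗ[ℤ] ℤ) (d : Q₀ → ℕ) :
    Setoid (SemistableRep k D θ d) where
  r M N := Nonempty (SelfDualRep.Isometry M.1 N.1)
  iseqv :=
    { refl := fun M => ⟨.refl M.1⟩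
      symm := fun ⟨f⟩ => ⟨f.symm⟩
      trans := fun ⟨f⟩ ⟨g⟩ => ⟨f.trans g⟩ }

/-- Isometry classes of semistable self-dual representations of dimension vector `d`. -/
def SemistableClass (θ : (Q₀ → ℤ) →ₗ[ℤ] ℤ) (d : Q₀ → ℕ) :=
  Quotient (isometrySetoid k D θ d)

/-- The order of the isometry group of any representative of a class. -/
noncomputable def SemistableClass.cardAut {θ : (Q₀ → ℤ) →ₗ[ℤ] ℤ} {d : Q₀ → ℕ}
    (c : SemistableClass k D θ d) : ℕ :=
  Quotient.lift (s := isometrySetoid k D θ d) (fun M => M.1.cardAut)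
    (fun M N (h : Nonempty (SelfDualRep.Isometry M.1 N.1)) =>
      h.elim fun f => Nat.card_congr f.conj) c

/-- The number of `k`-points of the stack of semistable self-dual representations of dimension
vector `d`: the sum of `1 / #Aut_S(M)` over isometry classes. -/
noncomputable def stackCount (θ : (Q₀ → ℤ) →ₗ[ℤ] ℤ) (d : Q₀ → ℕ) : ℝ :=
  ∑ᶠ c : SemistableClass k D θ d, 1 / (c.cardAut k D : ℝ)

/-- The coefficient of `ξ_d` in `A_d^{σ,θ}`, namely `q^{𝓔(d)/2} ∑_M 1 / #Aut_S(M)` with `q = #k`. -/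
noncomputable def stackGenCoeff [Fintype k] [Fintype Q₁] [DecidableEq Q₁] (P : PositivePart Q)
    (θ : (Q₀ → ℤ) →ₗ[ℤ] ℤ) (d : Q₀ → ℕ) : ℝ :=
  √(Fintype.card k : ℝ) ^ Q.sdEuler D P d * stackCount k D θ d

end Count

/-!
The theorem is a weighted point count, and the proof evaluates it by Möbius inversion over isotropic
subrepresentations instead of a recursion along Harder-Narasimhan strata.

Let `q = #k`. Fixing the graded space `k^d`, the orbit-stabilizer formula turns the stacky sum into
`#X / #GL_d`, where `X` is the set of pairs of a non-degenerate form and compatible structure maps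
without a destabilizing isotropic subrepresentation (`stackCount_eq`). As `d` is `σ`-invariant and
`θ` is `σ`-compatible, the slope of the whole representation is zero, so that a subrepresentation
`U` destabilizes exactly when `θ(U) > 0`.

For a point of `X` consider the poset of all `U` with `θ(U) > 0` with a least element `0` adjoined,
and its Möbius function `μ(0, U)` (`posetMu`). The sum of `μ(0, U)` over all isotropic `U` is `1` on
semistable points, where only `U = 0` contributes, and `0` elsewhere: if `W` is an isotropic
subrepresentation with `θ(W)` maximal, then `θ(U ∩ W) ≥ θ(U)` for every isotropic `U`, because
`W + (U ∩ W^⊥)` and `W ∩ U^⊥` are isotropic as well and `U / (U ∩ W^⊥)` is dual to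
`W / (W ∩ U^⊥)`. Hence `U ↦ U ∩ W` contracts the poset (`sum_isotropic_posetMu`).

After exchanging the sums, it remains to count, for a graded subspace `U` of dimension vector `u`:

* the forms for which `U` is isotropic (`natCard_isotropic_forms`), which needs the number of
  non-degenerate symmetric and alternating forms over `k` (`ndCard_eq_ndValue`);
* the compatible structure maps, weighted by `μ(0, U)`. The Möbius function depends only on the
  restriction to `U`, and every representation on an isotropic `U` has the same number of compatible
  extensions (`sum_compat_posetMu`). The weighted number of representations on `U` satisfies the
  recursion of `μ`, whose solution is the alternating sum over sequences `d^•` with sum `u`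
  (`sum_posetMu_isDestab`).

The powers of `q` combine to the Euler forms (`exponent_eq`), where `d^∞ = d - H(u)`. If `d_i` is odd
at a fixed node with `s_i = -1` there are no non-degenerate forms and the count is zero. In all other
cases the formula is a finite sum of rational functions of `√q`, independent of `k`, with
denominators that do not vanish for `√q > 1`.
-/

set_option linter.unusedSectionVars false

/-! ### Möbius functions of finite posets -/

section Mobius

open Classical in
/-- The Möbius function `U ↦ μ(⊥, U)` of the subposet `{⊥} ∪ {U | P U}` of a finite poset,
extended by zero to the whole poset. -/
noncomputable def posetMu {α : Type*} [PartialOrder α] [OrderBot α] [Fintype α] (P : α → Prop)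
    (U : α) : ℤ :=
  if U = ⊥ then 1 else if P U then -∑ W : {W // W < U}, posetMu P W.1 else 0
termination_by (wellFounded_lt (α := α)).wrap U
decreasing_by exact W.2

open Classical in
theorem posetMu_eq {α : Type*} [PartialOrder α] [OrderBot α] [Fintype α] (P : α → Prop) (U : α) :
    posetMu P U =
      if U = ⊥ then 1 else if P U then -∑ W with W < U, posetMu P W else 0 := by
  rw [posetMu]
  congr 2
  rw [Finset.sum_subtype (p := fun W => W < U)]
  simp

variable {α : Type*} [Fintype α]

theorem posetMu_bot [PartialOrder α] [OrderBot α] (P : α → Prop) : posetMu P ⊥ = 1 := by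
  rw [posetMu_eq, if_pos rfl]

theorem posetMu_of_not [PartialOrder α] [OrderBot α] {P : α → Prop} {U : α} (hU : U ≠ ⊥)
    (h : ¬ P U) : posetMu P U = 0 := by
  rw [posetMu_eq, if_neg hU, if_neg h]

open Classical in
theorem posetMu_of_pos [PartialOrder α] [OrderBot α] {P : α → Prop} {U : α} (hU : U ≠ ⊥)
    (h : P U) : posetMu P U = -∑ W with W < U, posetMu P W := by
  rw [posetMu_eq, if_neg hU, if_pos h]

open Classical in
theorem posetMu_sum_le [PartialOrder α] [OrderBot α] {P : α → Prop} {U : α} (hU : U ≠ ⊥)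
    (h : P U) : ∑ W with W ≤ U, posetMu P W = 0 := by
  have : (Finset.univ.filter fun W => W ≤ U) = insert U (Finset.univ.filter fun W => W < U) := by
    ext W
    simp [le_iff_eq_or_lt]
  rw [this, Finset.sum_insert (by simp), posetMu_of_pos hU h]
  ring

theorem posetMu_congr [PartialOrder α] [OrderBot α] {P P' : α → Prop} (U : α)
    (h : ∀ W ≤ U, P W ↔ P' W) : posetMu P U = posetMu P' U := by
  classical
  induction U using WellFoundedLT.induction with
  | _ U ih =>
    rw [posetMu_eq, posetMu_eq P', Finset.sum_congr rfl (fun W hW => ih W (by simpa using hW)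
      fun X hX => h X (hX.trans (by simpa using hW : W < U).le))]
    simp only [h U le_rfl]

variable [SemilatticeInf α] [OrderBot α] {P : α → Prop} {S : α → Prop}

/-- If meeting with `W` preserves the lower set `{U | S U ∧ P U}` then the Möbius function is
supported below `W`. -/
theorem posetMu_eq_zero_of_not_le (hP : ¬ P ⊥) (hS : ∀ U V, U ≤ V → S V → S U) {W : α}
    (h : ∀ U, S U → P U → P (U ⊓ W)) (U : α) (hU : S U) (hUW : ¬ U ≤ W) : posetMu P U = 0 := by
  classical
  induction U using WellFoundedLT.induction with
  | _ U ih =>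
    have hb : U ≠ ⊥ := fun e => hUW (e ▸ bot_le)
    by_cases hPU : P U
    · have hinf := h U hU hPU
      have h0 : U ⊓ W ≠ ⊥ := fun e => hP (e ▸ hinf)
      rw [posetMu_of_pos hb hPU, ← Finset.sum_filter_add_sum_filter_not _ (fun X => X ≤ W),
        Finset.sum_eq_zero (s := Finset.filter (fun X => ¬ X ≤ W) _)]
      · rw [Finset.filter_filter, Finset.filter_congr (q := fun X => X ≤ U ⊓ W),
          posetMu_sum_le h0 hinf]
        · simp
        · intro X _
          rw [le_inf_iff]
          refine ⟨fun hX => ⟨hX.1.le, hX.2⟩, fun hX => ⟨lt_of_le_of_ne hX.1 ?_, hX.2⟩⟩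
          rintro rfl
          exact hUW hX.2
      · intro X hX
        simp only [Finset.mem_filter, Finset.mem_univ, true_and] at hX
        exact ih X hX.1 (hS X U hX.1.le hU) hX.2
    · exact posetMu_of_not hb hPU

open Classical in
/-- If meeting with `W` retracts the poset `{U | S U ∧ P U}`, then this poset is conically
contractible and its reduced Euler characteristic vanishes. -/
theorem posetMu_sum_eq_zero (hP : ¬ P ⊥) (hS : ∀ U V, U ≤ V → S V → S U) {W : α} (hW : S W)
    (hPW : P W) (h : ∀ U, S U → P U → P (U ⊓ W)) : ∑ U with S U, posetMu P U = 0 := by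
  rw [← Finset.sum_filter_add_sum_filter_not _ (fun X => X ≤ W),
    Finset.sum_eq_zero (s := Finset.filter (fun X => ¬ X ≤ W) _), add_zero, Finset.filter_filter,
    Finset.filter_congr (q := fun X => X ≤ W), posetMu_sum_le (fun e => hP (e ▸ hPW)) hPW]
  · exact fun X _ => ⟨fun hX => hX.2, fun hX => ⟨hS X W hX hW, hX⟩⟩
  · intro X hX
    simp only [Finset.mem_filter, Finset.mem_univ, true_and] at hX
    exact posetMu_eq_zero_of_not_le hP hS h X hX.1 hX.2

open Classical in
theorem posetMu_sum_eq_one (h0 : S ⊥) (h : ∀ U, S U → ¬ P U) :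
    ∑ U with S U, posetMu P U = 1 := by
  rw [Finset.sum_eq_single_of_mem ⊥ (by simpa using h0), posetMu_bot]
  intro U hU hb
  exact posetMu_of_not hb (h U (by simpa using hU))

end Mobius

/-! ### Counting linear maps and subspaces over a finite field -/

section GLCount

/-- The number of injective linear maps from an `m`-dimensional space to an `n`-dimensional
space over a field with `q` elements. -/
def injCard (q : ℝ) (m n : ℕ) : ℝ := ∏ j ∈ Finset.range m, (q ^ n - q ^ j)

/-- The order of the general linear group of an `n`-dimensional space over a field with `q`
elements. -/
def glCard (q : ℝ) (n : ℕ) : ℝ := injCard q n n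

theorem injCard_eq_zero (q : ℝ) {m n : ℕ} (h : n < m) : injCard q m n = 0 :=
  Finset.prod_eq_zero (Finset.mem_range.2 h) (sub_self _)

theorem glCard_add (q : ℝ) (a b : ℕ) :
    glCard q (a + b) = injCard q a (a + b) * (q ^ (a * b) * glCard q b) := by
  simp only [glCard, injCard, Finset.prod_range_add]
  congr 1
  rw [pow_mul, ← Finset.card_range b, ← Finset.prod_const, Finset.card_range,
    ← Finset.prod_mul_distrib]
  refine Finset.prod_congr rfl fun _ _ => ?_
  ring

theorem glCard_pos {q : ℝ} (hq : 1 < q) (n : ℕ) : 0 < glCard q n :=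
  Finset.prod_pos fun _ hj => sub_pos.2 (pow_lt_pow_right₀ hq (Finset.mem_range.1 hj))

theorem glCard_ne_zero {q : ℝ} (hq : 1 < q) (n : ℕ) : glCard q n ≠ 0 := (glCard_pos hq n).ne'

theorem qPoch_eq_prod_range (y : ℝ) (n : ℕ) : qPoch y n = ∏ i ∈ Finset.range n, (1 - y ^ (i + 1)) := by
  induction n with
  | zero => simp [qPoch]
  | succ n ih => rw [Finset.prod_range_succ, ← ih, qPoch, Finset.prod_Icc_succ_top (by omega), qPoch]

theorem glCard_eq_qPoch {q : ℝ} (hq : q ≠ 0) (n : ℕ) :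
    glCard q n = q ^ (n * n) * qPoch q⁻¹ n := by
  have h (j : ℕ) (hj : j ∈ Finset.range n) :
      q ^ n - q ^ (n - 1 - j) = q ^ n * (1 - q⁻¹ ^ (j + 1)) := by
    have hj : j < n := by simpa using hj
    have hn : q ^ n = q ^ (n - 1 - j) * q ^ (j + 1) := by
      rw [← pow_add]
      congr 1
      omega
    rw [hn, inv_pow]
    field_simp
  rw [glCard, injCard, ← Finset.prod_range_reflect, Finset.prod_congr rfl h,
    Finset.prod_mul_distrib, Finset.prod_const, Finset.card_range, ← pow_mul, qPoch_eq_prod_range]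

variable {k : Type*} [Field k] [Finite k]
  {V : Type*} [AddCommGroup V] [Module k V] [FiniteDimensional k V]
  {W : Type*} [AddCommGroup W] [Module k W] [FiniteDimensional k W]

instance finite_linearMap : Finite (V →ₗ[k] W) :=
  Module.finite_of_finite k

instance finite_linearEquiv : Finite (V ≃ₗ[k] W) :=
  Finite.of_injective (fun e => e.toLinearMap) LinearEquiv.toLinearMap_injective

variable (k V) in
theorem finite_submodule : Finite (Submodule k V) :=
  have := Module.finite_of_finite k (M := V)
  inferInstance

theorem natCard_eq_mul_of_fiber {X Y : Type*} [Finite X] [Finite Y] (f : X → Y) {N : ℕ}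
    (h : ∀ y, Nat.card {x // f x = y} = N) : Nat.card X = Nat.card Y * N := by
  have := Fintype.ofFinite Y
  rw [← Nat.card_congr (Equiv.sigmaFiberEquiv f), Nat.card_sigma, Finset.sum_congr rfl fun y _ => h y,
    Finset.sum_const, Finset.card_univ, Nat.card_eq_fintype_card, smul_eq_mul]

theorem natCard_cast_eq_mul_of_fiber {X Y : Type*} [Finite X] [Finite Y] (f : X → Y) {N : ℝ}
    (h : ∀ y, (Nat.card {x // f x = y} : ℝ) = N) : (Nat.card X : ℝ) = Nat.card Y * N := by
  have := Fintype.ofFinite Y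
  rw [← Nat.card_congr (Equiv.sigmaFiberEquiv f), Nat.card_sigma, Nat.cast_sum,
    Finset.sum_congr rfl fun y _ => h y,
    Finset.sum_const, Finset.card_univ, Nat.card_eq_fintype_card, nsmul_eq_mul]

variable (k) in
theorem one_lt_natCard : (1 : ℝ) < Nat.card k := by exact_mod_cast Finite.one_lt_card

variable (k V W) in
theorem card_injective_linearMap :
    (Nat.card {f : V →ₗ[k] W // Function.Injective f} : ℝ) =
      injCard (Nat.card k) (Module.finrank k V) (Module.finrank k W) := by
  have := Fintype.ofFinite k
  have := Module.finite_of_finite k (M := W)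
  let b := Module.finBasis k V
  have e : {f : V →ₗ[k] W // Function.Injective f} ≃
      {s : Fin (Module.finrank k V) → W // LinearIndependent k s} := by
    refine Equiv.subtypeEquiv (b.constr k).symm.toEquiv fun f => ?_
    have : ((b.constr k).symm.toEquiv f) = f ∘ b := by
      ext i
      simp [Module.Basis.constr]
    rw [this]
    refine ⟨fun hf => b.linearIndependent.map' f (LinearMap.ker_eq_bot.2 hf), fun h => ?_⟩
    have hf : ⇑f = Finsupp.linearCombination k (f ∘ b) ∘ b.repr := by
      ext x
      conv_lhs => rw [← b.linearCombination_repr x]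
      exact Finsupp.apply_linearCombination k f b _
    rw [hf]
    exact Function.Injective.comp h b.repr.injective
  rw [Nat.card_congr e]
  rcases le_or_gt (Module.finrank k V) (Module.finrank k W) with h | h
  · rw [card_linearIndependent h, injCard, Finset.prod_range, Nat.cast_prod, Nat.card_eq_fintype_card]
    refine Finset.prod_congr rfl fun i _ => ?_
    rw [Nat.cast_sub (Nat.pow_le_pow_right Fintype.card_pos (by omega))]
    push_cast
    rfl
  · rw [injCard_eq_zero _ h]
    have : IsEmpty {s : Fin (Module.finrank k V) → W // LinearIndependent k s} :=
      ⟨fun s => by simpa using (s.2.fintype_card_le_finrank.trans_lt h)⟩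
    simp

variable (k V) in
theorem card_linearEquiv :
    (Nat.card (V ≃ₗ[k] V) : ℝ) = glCard (Nat.card k) (Module.finrank k V) := by
  rw [glCard, ← card_injective_linearMap]
  congr 1
  refine Nat.card_congr ⟨fun f => ⟨f, f.injective⟩, fun f => LinearEquiv.ofInjectiveEndo f.1 f.2,
    fun f => ?_, fun f => ?_⟩
  · ext; simp
  · ext; simp

theorem card_linearEquiv_of_finrank_eq (h : Module.finrank k V = Module.finrank k W) :
    (Nat.card (V ≃ₗ[k] W) : ℝ) = glCard (Nat.card k) (Module.finrank k V) := by
  rw [← card_linearEquiv]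
  congr 1
  let e := LinearEquiv.ofFinrankEq V W h
  exact Nat.card_congr ⟨fun f => f.trans e.symm, fun f => f.trans e, fun f => by ext; simp,
    fun f => by ext; simp⟩

variable (k V) in
theorem card_submodule_mul (w : ℕ) :
    (Nat.card {U : Submodule k V // Module.finrank k U = w} : ℝ) * glCard (Nat.card k) w =
      injCard (Nat.card k) w (Module.finrank k V) := by
  have h1 := card_injective_linearMap k (Fin w → k) V
  rw [Module.finrank_fin_fun] at h1
  have := finite_submodule k V
  rw [← h1, eq_comm]
  refine natCard_cast_eq_mul_of_fiber (fun f => ⟨LinearMap.range f.1, by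
    rw [LinearMap.finrank_range_of_inj f.2, Module.finrank_fin_fun]⟩) ?_
  rintro ⟨U, hU⟩
  have h2 := card_linearEquiv_of_finrank_eq (k := k) (V := Fin w → k) (W := U)
    (by rw [hU, Module.finrank_fin_fun])
  rw [Module.finrank_fin_fun] at h2
  rw [← h2]
  congr 1
  refine Nat.card_congr ⟨fun f => (LinearEquiv.ofInjective f.1.1 f.1.2).trans
      (LinearEquiv.ofEq _ _ (congrArg Subtype.val f.2)),
    fun e => ⟨⟨U.subtype ∘ₗ e.toLinearMap, U.subtype_injective.comp e.injective⟩, ?_⟩,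
    fun f => ?_, fun e => ?_⟩
  · ext1
    dsimp only
    rw [LinearMap.range_comp, LinearEquiv.range, Submodule.map_top, Submodule.range_subtype]
  · ext; simp
  · ext; simp

/-- Gaussian binomial coefficients in terms of orders of general linear groups. -/
theorem card_submodule_mul_glCard {w r : ℕ} (h : Module.finrank k V = w + r) :
    (Nat.card {U : Submodule k V // Module.finrank k U = w} : ℝ) * glCard (Nat.card k) w
      * ((Nat.card k : ℝ) ^ (w * r) * glCard (Nat.card k) r) = glCard (Nat.card k) (w + r) := by
  rw [card_submodule_mul, h, ← glCard_add]

theorem natCard_linearMap :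
    Nat.card (V →ₗ[k] W) = Nat.card k ^ (Module.finrank k V * Module.finrank k W) := by
  rw [Module.natCard_eq_pow_finrank (K := k), Module.finrank_linearMap]

theorem natCard_bilin :
    Nat.card (V →ₗ[k] W →ₗ[k] k) = Nat.card k ^ (Module.finrank k V * Module.finrank k W) := by
  rw [natCard_linearMap, Module.finrank_linearMap, Module.finrank_self, mul_one]

theorem exists_compl_finrank (U : Submodule k V) :
    ∃ C : Submodule k V, IsCompl U C ∧
      Module.finrank k C = Module.finrank k V - Module.finrank k U := by
  obtain ⟨C, hC⟩ := U.exists_isCompl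
  exact ⟨C, hC, by rw [← Submodule.finrank_add_eq_of_isCompl hC]; omega⟩

/-- The number of extensions of a linear map from a subspace. -/
theorem natCard_extensions (U : Submodule k V) (g : U →ₗ[k] W) :
    Nat.card {y : V →ₗ[k] W // y.domRestrict U = g} =
      Nat.card k ^ ((Module.finrank k V - Module.finrank k U) * Module.finrank k W) := by
  obtain ⟨C, hC, hd⟩ := exists_compl_finrank U
  rw [← hd, ← natCard_linearMap]
  refine Nat.card_congr ⟨fun y => y.1.domRestrict C, fun φ => ⟨LinearMap.ofIsCompl hC g φ, ?_⟩,
    fun y => ?_, fun φ => ?_⟩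
  · ext x; simp
  · apply Subtype.ext
    refine LinearMap.ofIsCompl_eq hC (fun x => ?_) (fun x => ?_)
    · exact (LinearMap.congr_fun y.2 x).symm
    · rfl
  · ext x; simp

/-- The number of extensions of a linear map from a subspace `U₀` which map a larger subspace
`U` into a given one. -/
theorem natCard_extensions_mapsTo {U₀ U : Submodule k V} (h : U₀ ≤ U) (U' : Submodule k W)
    (g : U₀ →ₗ[k] W) (hg : ∀ x, g x ∈ U') :
    Nat.card {y : V →ₗ[k] W // y.domRestrict U₀ = g ∧ ∀ x ∈ U, y x ∈ U'} =
      Nat.card k ^ ((Module.finrank k U - Module.finrank k U₀) * Module.finrank k U' +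
        (Module.finrank k V - Module.finrank k U) * Module.finrank k W) := by
  let A := {z : U →ₗ[k] U' // z.domRestrict (U₀.comap U.subtype) =
    (g.codRestrict U' hg) ∘ₗ (Submodule.comapSubtypeEquivOfLe h).toLinearMap}
  have hf (y : {y : V →ₗ[k] W // y.domRestrict U₀ = g ∧ ∀ x ∈ U, y x ∈ U'}) :
      (y.1.domRestrict U).codRestrict U' (fun x => y.2.2 x x.2) ∈ {z : U →ₗ[k] U' |
        z.domRestrict (U₀.comap U.subtype) =
          (g.codRestrict U' hg) ∘ₗ (Submodule.comapSubtypeEquivOfLe h).toLinearMap} := by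
    ext x
    exact LinearMap.congr_fun y.2.1 ⟨x.1.1, x.2⟩
  rw [natCard_eq_mul_of_fiber (Y := A) (fun y => ⟨_, hf y⟩)
    (N := Nat.card k ^ ((Module.finrank k V - Module.finrank k U) * Module.finrank k W)) ?_,
    natCard_extensions, pow_add, (Submodule.comapSubtypeEquivOfLe h).finrank_eq]
  intro z
  rw [← natCard_extensions U (U'.subtype ∘ₗ z.1)]
  refine Nat.card_congr ⟨fun y => ⟨y.1.1, ?_⟩, fun y => ⟨⟨y.1, ?_, fun x hx => ?_⟩, ?_⟩,
    fun y => rfl, fun y => rfl⟩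
  · exact LinearMap.ext fun x => congrArg Subtype.val (LinearMap.congr_fun (congrArg Subtype.val y.2) x)
  · ext x
    have h1 := LinearMap.congr_fun y.2 ⟨x.1, h x.2⟩
    have h2 := LinearMap.congr_fun z.2 ⟨⟨x.1, h x.2⟩, x.2⟩
    exact h1.trans (congrArg Subtype.val h2)
  · have h1 := LinearMap.congr_fun y.2 ⟨x, hx⟩
    exact h1.symm ▸ (z.1 ⟨x, hx⟩).2
  · ext x
    exact LinearMap.congr_fun y.2 x

end GLCount

/-! ### Counting symmetric and alternating bilinear forms -/

section SymForms

/-- The dimension `n (n + ε) / 2` of the space of `ε`-symmetric bilinear forms on an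
`n`-dimensional space. -/
def symDim (ε : ℤˣ) (n : ℕ) : ℕ := n.choose 2 + if ε = 1 then n else 0

theorem symDim_succ (ε : ℤˣ) (n : ℕ) :
    symDim ε (n + 1) = (if ε = 1 then 1 else 0) + n + symDim ε n := by
  have : (n + 1).choose 2 = n + n.choose 2 := by
    rw [Nat.choose_succ_succ' n 1, Nat.choose_one_right]
  rw [symDim, symDim, this]
  split_ifs <;> omega

theorem symDim_add (ε : ℤˣ) (m n : ℕ) : symDim ε (m + n) = symDim ε m + m * n + symDim ε n := by
  induction m with
  | zero => simp [symDim]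
  | succ m ih =>
    rw [show m + 1 + n = (m + n) + 1 by ring, symDim_succ, ih, symDim_succ]
    ring

theorem symDim_cast (ε : ℤˣ) (n : ℕ) : (n : ℤ) * (n + (ε : ℤ)) / 2 = symDim ε n := by
  refine Int.ediv_eq_of_eq_mul_right two_ne_zero ?_
  induction n with
  | zero => simp [symDim]
  | succ n ih =>
    rw [symDim_succ]
    push_cast at ih ⊢
    rcases Int.units_eq_one_or ε with rfl | rfl
    · simp at ih ⊢; linarith
    · simp at ih ⊢; linarith

theorem symDim_cast_neg (ε : ℤˣ) (n : ℕ) : (n : ℤ) * (n - (ε : ℤ)) / 2 = symDim (-ε) n := by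
  rw [← symDim_cast, Units.val_neg, sub_eq_add_neg]

variable {k : Type*} [Field k]
  {V : Type*} [AddCommGroup V] [Module k V]
  {W : Type*} [AddCommGroup W] [Module k W]
  {U : Type*} [AddCommGroup U] [Module k U]
  {C : Type*} [AddCommGroup C] [Module k C]

theorem signCast_mul_cancel (ε : ℤˣ) (a : k) : ((ε : ℤ) : k) * (((ε : ℤ) : k) * a) = a := by
  rcases Int.units_eq_one_or ε with rfl | rfl <;> simp

theorem signCast_ne_zero (ε : ℤˣ) : ((ε : ℤ) : k) ≠ 0 := by
  rcases Int.units_eq_one_or ε with rfl | rfl <;> simp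

variable (k V) in
/-- The space of `ε`-symmetric bilinear forms. -/
def symForms (ε : ℤˣ) : Submodule k (V →ₗ[k] V →ₗ[k] k) where
  carrier := {b | ∀ x y, b x y = ((ε : ℤ) : k) * b y x}
  add_mem' hb hc x y := by simp [hb x y, hc x y, mul_add]
  zero_mem' x y := by simp
  smul_mem' c b hb x y := by simp [hb x y, mul_left_comm]

/-- Transport of `ε`-symmetric forms along a linear equivalence. -/
def symFormsCongr (ε : ℤˣ) (e : V ≃ₗ[k] W) : symForms k V ε ≃ symForms k W ε where
  toFun b := ⟨b.1.compl₁₂ e.symm.toLinearMap e.symm.toLinearMap, fun x y => b.2 _ _⟩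
  invFun b := ⟨b.1.compl₁₂ e.toLinearMap e.toLinearMap, fun x y => b.2 _ _⟩
  left_inv b := by ext; simp
  right_inv b := by ext; simp

theorem symFormsCongr_apply (ε : ℤˣ) (e : V ≃ₗ[k] W) (b : symForms k V ε) (x y : W) :
    (symFormsCongr ε e b).1 x y = b.1 (e.symm x) (e.symm y) := rfl

/-- An `ε`-symmetric form on `U × C` in terms of its blocks. -/
def symFormsProd (ε : ℤˣ) :
    symForms k (U × C) ε ≃ symForms k U ε × (U →ₗ[k] C →ₗ[k] k) × symForms k C ε where
  toFun b := (⟨b.1.compl₁₂ (LinearMap.inl k U C) (LinearMap.inl k U C), fun x y => b.2 _ _⟩,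
    b.1.compl₁₂ (LinearMap.inl k U C) (LinearMap.inr k U C),
    ⟨b.1.compl₁₂ (LinearMap.inr k U C) (LinearMap.inr k U C), fun x y => b.2 _ _⟩)
  invFun p := ⟨p.1.1.compl₁₂ (LinearMap.fst k U C) (LinearMap.fst k U C)
    + p.2.1.compl₁₂ (LinearMap.fst k U C) (LinearMap.snd k U C)
    + ((ε : ℤ) : k) • p.2.1.flip.compl₁₂ (LinearMap.snd k U C) (LinearMap.fst k U C)
    + p.2.2.1.compl₁₂ (LinearMap.snd k U C) (LinearMap.snd k U C), fun x y => by
      have h1 := p.1.2 x.1 y.1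
      have h2 := p.2.2.2 x.2 y.2
      simp only [LinearMap.add_apply, LinearMap.compl₁₂_apply, LinearMap.fst_apply,
        LinearMap.snd_apply, LinearMap.smul_apply, LinearMap.flip_apply, smul_eq_mul, mul_add,
        signCast_mul_cancel, ← h1, ← h2]
      ring⟩
  left_inv b := by
    have hz (x : U × C) : b.1 x (0, 0) = 0 := map_zero _
    ext x y
    · simp [hz]
    · simp [hz]
    · have := b.2 (0, x) (y, 0)
      simp [hz] at this ⊢
      exact this.symm
    · simp
  right_inv p := by
    ext <;> simp

theorem symFormsProd_symm_apply (ε : ℤˣ) (α : symForms k U ε) (A : U →ₗ[k] C →ₗ[k] k)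
    (γ : symForms k C ε) (x y : U × C) :
    ((symFormsProd ε).symm (α, A, γ)).1 x y =
      α.1 x.1 y.1 + A x.1 y.2 + ((ε : ℤ) : k) * A y.1 x.2 + γ.1 x.2 y.2 := rfl

theorem symFormsProd_fst_apply (ε : ℤˣ) (b : symForms k (U × C) ε) (x y : U) :
    ((symFormsProd ε) b).1.1 x y = b.1 (x, 0) (y, 0) := rfl

/-- `ε`-symmetric scalars are the `ε`-symmetric forms on a line. -/
def symFormsSelf (ε : ℤˣ) : symForms k k ε ≃ {a : k // a = ((ε : ℤ) : k) * a} where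
  toFun b := ⟨b.1 1 1, b.2 1 1⟩
  invFun a := ⟨a.1 • LinearMap.mul k k, fun x y => by
    simp only [LinearMap.smul_apply, LinearMap.mul_apply', smul_eq_mul]
    rw [← mul_assoc _ a.1, ← a.2, mul_comm x]⟩
  left_inv b := by ext; simp
  right_inv a := by ext; simp

theorem signCast_fixed_iff (h2 : (2 : k) ≠ 0) (ε : ℤˣ) (a : k) :
    a = ((ε : ℤ) : k) * a ↔ (ε = 1 ∨ a = 0) := by
  rcases Int.units_eq_one_or ε with rfl | rfl
  · simp
  · have : (-1 : ℤˣ) ≠ 1 := by decide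
    simp only [Units.val_neg, Units.val_one, Int.cast_neg, Int.cast_one, neg_mul, one_mul, this,
      false_or]
    constructor
    · intro h
      have : 2 * a = 0 := by linear_combination h
      simpa [h2] using this
    · rintro rfl
      simp

variable [Finite k] [FiniteDimensional k V] [FiniteDimensional k W] [FiniteDimensional k U]
  [FiniteDimensional k C]

theorem natCard_symForms_self (h2 : (2 : k) ≠ 0) (ε : ℤˣ) :
    Nat.card (symForms k k ε) = Nat.card k ^ (if ε = 1 then 1 else 0) := by
  rw [Nat.card_congr (symFormsSelf ε)]
  simp only [signCast_fixed_iff h2]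
  split_ifs with h
  · simp [h]
  · simp [h]

variable (k) in
theorem natCard_symForms_fin (h2 : (2 : k) ≠ 0) (ε : ℤˣ) (n : ℕ) :
    Nat.card (symForms k (Fin n → k) ε) = Nat.card k ^ symDim ε n := by
  induction n with
  | zero =>
    have : Subsingleton (symForms k (Fin 0 → k) ε) := ⟨fun a b => by
      ext x y
      exact absurd x.2 (by omega)⟩
    simp [symDim]
  | succ n ih =>
    rw [Nat.card_congr (symFormsCongr ε (Fin.consLinearEquiv k fun _ => k).symm),
      Nat.card_congr (symFormsProd ε), Nat.card_prod, Nat.card_prod, ih, natCard_bilin,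
      natCard_symForms_self h2, symDim_succ, Module.finrank_self, Module.finrank_fin_fun]
    ring

variable (V) in
theorem natCard_symForms (h2 : (2 : k) ≠ 0) (ε : ℤˣ) :
    Nat.card (symForms k V ε) = Nat.card k ^ symDim ε (Module.finrank k V) := by
  rw [Nat.card_congr (symFormsCongr ε (LinearEquiv.ofFinrankEq V (Fin (Module.finrank k V) → k)
    (by simp))), natCard_symForms_fin k h2]

variable (k V) in
/-- Non-degenerate `ε`-symmetric bilinear forms. -/
abbrev NDForms (ε : ℤˣ) : Type _ :=
  {b : symForms k V ε // ∀ x, (∀ y, b.1 x y = 0) → x = 0}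

variable (k) in
/-- The number of non-degenerate `ε`-symmetric forms on an `n`-dimensional space. -/
noncomputable def ndCard (ε : ℤˣ) (n : ℕ) : ℕ := Nat.card (NDForms k (Fin n → k) ε)

theorem natCard_ndForms_congr (ε : ℤˣ) (e : V ≃ₗ[k] W) :
    Nat.card (NDForms k V ε) = Nat.card (NDForms k W ε) := by
  refine Nat.card_congr (Equiv.subtypeEquiv (symFormsCongr ε e) fun b => ?_)
  simp only [symFormsCongr_apply]
  constructor
  · intro h x hx
    simpa using h (e.symm x) fun y => by simpa using hx (e y)
  · intro h x hx
    simpa using h (e x) fun y => by simpa using hx (e.symm y)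

variable (V) in
theorem natCard_ndForms (ε : ℤˣ) :
    Nat.card (NDForms k V ε) = ndCard k ε (Module.finrank k V) :=
  natCard_ndForms_congr ε (LinearEquiv.ofFinrankEq V (Fin (Module.finrank k V) → k) (by simp))

/-- The form with isotropic first summand and blocks `A`, `γ` is non-degenerate if and only if `A`
is injective and `γ` is non-degenerate on the right kernel of `A`. -/
theorem symFormsProd_nondegenerate_iff (ε : ℤˣ) (A : U →ₗ[k] C →ₗ[k] k) (γ : symForms k C ε) :
    (∀ x, (∀ y, ((symFormsProd ε).symm (0, A, γ)).1 x y = 0) → x = 0) ↔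
      Function.Injective A ∧ ∀ c ∈ LinearMap.ker A.flip,
        (∀ c' ∈ LinearMap.ker A.flip, γ.1 c c' = 0) → c = 0 := by
  simp only [symFormsProd_symm_apply, LinearMap.mem_ker]
  have hz (u u' : U) : (0 : symForms k U ε).1 u u' = 0 := rfl
  simp only [hz, zero_add]
  constructor
  · intro h
    refine ⟨(injective_iff_map_eq_zero A).2 fun u hu => ?_, fun c hc hγ => ?_⟩
    · have := h (u, 0) fun y => by simp [hu]
      simpa using this
    · have h1 : γ.1 c ∈ (LinearMap.range A).dualCoannihilator.dualAnnihilator := by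
        rw [Submodule.mem_dualAnnihilator]
        intro c' hc'
        refine hγ c' ?_
        ext u
        rw [Submodule.mem_dualCoannihilator] at hc'
        exact hc' (A u) ⟨u, rfl⟩
      rw [Subspace.dualCoannihilator_dualAnnihilator_eq] at h1
      obtain ⟨u, hu⟩ := h1
      have := h (-u, c) fun y => by
        have h3 := LinearMap.congr_fun hc y.1
        simp only [LinearMap.flip_apply, LinearMap.zero_apply] at h3
        simp [hu, h3]
      exact (Prod.ext_iff.1 this).2
  · rintro ⟨hA, hγ⟩ ⟨u, c⟩ h
    have hc : A.flip c = 0 := by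
      ext u'
      have := h (u', 0)
      simpa [signCast_ne_zero (k := k)] using this
    have hc0 : c = 0 := hγ c hc fun c' hc' => by
      have h1 := h (0, c')
      have h2 := LinearMap.congr_fun hc' u
      simp only [LinearMap.flip_apply, LinearMap.zero_apply] at h2
      simpa [h2] using h1
    subst hc0
    have : u = 0 := (injective_iff_map_eq_zero A).1 hA u (by
      ext c'
      simpa using h (0, c'))
    simp [this]

/-- The number of `ε`-symmetric forms whose restriction to a subspace `K` is non-degenerate. -/
theorem natCard_symForms_nondegenerate_on (h2 : (2 : k) ≠ 0) (ε : ℤˣ) (K : Submodule k C) {p : ℕ}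
    (hp : Module.finrank k C = Module.finrank k K + p) :
    Nat.card {γ : symForms k C ε // ∀ c ∈ K, (∀ c' ∈ K, γ.1 c c' = 0) → c = 0} =
      ndCard k ε (Module.finrank k K) * Nat.card k ^ (Module.finrank k K * p + symDim ε p) := by
  obtain ⟨K', hK, hd⟩ := exists_compl_finrank K
  replace hd : Module.finrank k K' = p := by omega
  have e : {γ : symForms k C ε // ∀ c ∈ K, (∀ c' ∈ K, γ.1 c c' = 0) → c = 0} ≃
      NDForms k K ε × (K →ₗ[k] K' →ₗ[k] k) × symForms k K' ε := by
    refine Equiv.trans ?_ (Equiv.subtypeProdEquivProd (p := fun b : symForms k K ε =>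
      ∀ x, (∀ y, b.1 x y = 0) → x = 0) (q := fun _ => True) |>.trans
        (Equiv.prodCongr (Equiv.refl _) (Equiv.subtypeUnivEquiv fun _ => trivial)))
    refine Equiv.subtypeEquiv ((symFormsCongr ε (Submodule.prodEquivOfIsCompl K K' hK).symm).trans
      (symFormsProd ε)) fun γ => ?_
    simp only [Equiv.trans_apply, symFormsProd_fst_apply, symFormsCongr_apply, and_true]
    simp
  rw [Nat.card_congr e, Nat.card_prod, Nat.card_prod, natCard_ndForms, natCard_bilin,
    natCard_symForms _ h2, hd, pow_add]

theorem finrank_ker_flip_add (A : U →ₗ[k] C →ₗ[k] k) :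
    Module.finrank k (LinearMap.ker A.flip) + Module.finrank k (LinearMap.range A) =
      Module.finrank k C := by
  have h : LinearMap.ker A.flip = (LinearMap.range A).dualCoannihilator := by
    ext c
    rw [Submodule.mem_dualCoannihilator, LinearMap.mem_ker]
    constructor
    · rintro h _ ⟨u, rfl⟩
      exact LinearMap.congr_fun h u
    · intro h
      ext u
      exact h _ ⟨u, rfl⟩
  rw [h, add_comm, Subspace.finrank_add_finrank_dualCoannihilator_eq]

/-- The left and right radicals of a pairing have the same codimension. -/
theorem finrank_ker_add (A : U →ₗ[k] C →ₗ[k] k) :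
    Module.finrank k (LinearMap.ker A) + Module.finrank k C =
      Module.finrank k (LinearMap.ker A.flip) + Module.finrank k U := by
  have h1 := finrank_ker_flip_add A
  have h2 := LinearMap.finrank_range_add_finrank_ker A
  omega

/-- Non-degenerate forms on `U × C` for which `U` is isotropic. -/
theorem card_ndForms_prod_isotropic (h2 : (2 : k) ≠ 0) (ε : ℤˣ) {e : ℕ}
    (he : Module.finrank k C = e + Module.finrank k U) :
    (Nat.card {b : NDForms k (U × C) ε // ∀ u u', b.1.1 (u, 0) (u', 0) = 0} : ℝ) =
      injCard (Nat.card k) (Module.finrank k U) (Module.finrank k C) *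
        (ndCard k ε e * (Nat.card k : ℝ) ^ (e * Module.finrank k U +
          symDim ε (Module.finrank k U))) := by
  have e1 : {b : NDForms k (U × C) ε // ∀ u u', b.1.1 (u, 0) (u', 0) = 0} ≃
      Σ A : {A : U →ₗ[k] C →ₗ[k] k // Function.Injective A}, {γ : symForms k C ε //
        ∀ c ∈ LinearMap.ker A.1.flip, (∀ c' ∈ LinearMap.ker A.1.flip, γ.1 c c' = 0) → c = 0} :=
    { toFun := fun b => by
        have hb : (symFormsProd ε).symm (0, ((symFormsProd ε) b.1.1).2.1,
            ((symFormsProd ε) b.1.1).2.2) = b.1.1 := by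
          rw [Equiv.symm_apply_eq]
          refine Prod.ext ?_ rfl
          ext u u'
          exact (b.2 u u').symm
        have := (symFormsProd_nondegenerate_iff ε _ _).1 (hb ▸ b.1.2)
        exact ⟨⟨_, this.1⟩, ⟨_, this.2⟩⟩
      invFun := fun p => ⟨⟨(symFormsProd ε).symm (0, p.1.1, p.2.1),
        (symFormsProd_nondegenerate_iff ε _ _).2 ⟨p.1.2, p.2.2⟩⟩, fun u u' => by
          simp [symFormsProd_symm_apply]⟩
      left_inv := fun b => by
        refine Subtype.ext (Subtype.ext ?_)
        change (symFormsProd ε).symm (0, ((symFormsProd ε) b.1.1).2.1,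
            ((symFormsProd ε) b.1.1).2.2) = b.1.1
        rw [Equiv.symm_apply_eq]
        refine Prod.ext ?_ rfl
        ext u u'
        exact (b.2 u u').symm
      right_inv := fun p => by
        rcases p with ⟨⟨A, hA⟩, ⟨γ, hγ⟩⟩
        have h := (symFormsProd ε).apply_symm_apply ((0 : symForms k U ε), A, γ)
        have h3 : ((symFormsProd ε) ((symFormsProd ε).symm ((0 : symForms k U ε), A, γ))).2.1 = A := by
          rw [h]
        have h4 : ((symFormsProd ε) ((symFormsProd ε).symm ((0 : symForms k U ε), A, γ))).2.2 = γ := by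
          rw [h]
        refine Sigma.ext (Subtype.ext h3) ?_
        dsimp only
        congr! 1
        rw [h3] }
  have hker (A : {A : U →ₗ[k] C →ₗ[k] k // Function.Injective A}) :
      Module.finrank k (LinearMap.ker A.1.flip) = e := by
    have := finrank_ker_flip_add A.1
    rw [LinearMap.finrank_range_of_inj A.2] at this
    omega
  have := Fintype.ofFinite {A : U →ₗ[k] C →ₗ[k] k // Function.Injective A}
  have hC : injCard (Nat.card k) (Module.finrank k U) (Module.finrank k C) =
      Nat.card {A : U →ₗ[k] C →ₗ[k] k // Function.Injective A} := by
    rw [card_injective_linearMap, Module.finrank_linearMap, Module.finrank_self, mul_one]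
  rw [Nat.card_congr e1, Nat.card_sigma, Finset.sum_congr rfl fun A _ =>
    natCard_symForms_nondegenerate_on h2 ε (LinearMap.ker A.1.flip) (p := Module.finrank k U)
      (by rw [hker, he]), hC]
  simp only [hker, Finset.sum_const, Finset.card_univ, Nat.card_eq_fintype_card, smul_eq_mul]
  push_cast
  rfl

end SymForms

/-! ### The number of non-degenerate forms -/

section NDCount

variable {k : Type*} [Field k] [Finite k]
  {V : Type*} [AddCommGroup V] [Module k V] [FiniteDimensional k V]
  {C : Type*} [AddCommGroup C] [Module k C] [FiniteDimensional k C]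

/-- Non-degenerate forms for which a given subspace is isotropic. -/
theorem card_ndForms_isotropic (h2 : (2 : k) ≠ 0) (ε : ℤˣ) (U : Submodule k V) {e : ℕ}
    (he : Module.finrank k V = e + Module.finrank k U + Module.finrank k U) :
    (Nat.card {b : NDForms k V ε // ∀ x ∈ U, ∀ y ∈ U, b.1.1 x y = 0} : ℝ) =
      injCard (Nat.card k) (Module.finrank k U) (e + Module.finrank k U) *
        (ndCard k ε e * (Nat.card k : ℝ) ^ (e * Module.finrank k U +
          symDim ε (Module.finrank k U))) := by
  obtain ⟨C, hC, hd⟩ := exists_compl_finrank U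
  replace hd : Module.finrank k C = e + Module.finrank k U := by omega
  rw [← hd, ← card_ndForms_prod_isotropic (U := U) (C := C) h2 ε hd]
  congr 1
  let φ := (Submodule.prodEquivOfIsCompl U C hC).symm
  have hnd (b : symForms k V ε) : (∀ x, (∀ y, b.1 x y = 0) → x = 0) ↔
      ∀ x, (∀ y, (symFormsCongr ε φ b).1 x y = 0) → x = 0 := by
    simp only [symFormsCongr_apply]
    constructor
    · intro h x hx
      simpa using h (φ.symm x) fun y => by simpa using hx (φ y)
    · intro h x hx
      simpa using h (φ x) fun y => by simpa using hx (φ.symm y)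
  refine Nat.card_congr (Equiv.subtypeEquiv (Equiv.subtypeEquiv (symFormsCongr ε φ) hnd) fun b => ?_)
  simp only [Equiv.subtypeEquiv_apply, symFormsCongr_apply]
  simp [φ]

/-- Completing the square: the shear that splits off a non-isotropic first coordinate. -/
def symFormsShear : (symForms k k 1 × (k →ₗ[k] C →ₗ[k] k) × symForms k C 1) ≃
    (symForms k k 1 × (k →ₗ[k] C →ₗ[k] k) × symForms k C 1) where
  toFun p := (p.1, p.2.1, ⟨p.2.2.1 - (p.1.1 1 1)⁻¹ • (LinearMap.mul k k).compl₁₂ (p.2.1 1) (p.2.1 1),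
    fun x y => by
      have := p.2.2.2 x y
      simp at this ⊢
      rw [this]
      ring⟩)
  invFun p := (p.1, p.2.1, ⟨p.2.2.1 + (p.1.1 1 1)⁻¹ • (LinearMap.mul k k).compl₁₂ (p.2.1 1) (p.2.1 1),
    fun x y => by
      have := p.2.2.2 x y
      simp at this ⊢
      rw [this]
      ring⟩)
  left_inv p := by
    exact Prod.ext rfl (Prod.ext rfl (Subtype.ext (LinearMap.ext₂ fun x y => by simp)))
  right_inv p := by
    exact Prod.ext rfl (Prod.ext rfl (Subtype.ext (LinearMap.ext₂ fun x y => by simp)))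

theorem card_symForms_self_ne_zero :
    (Nat.card {α : symForms k k 1 // α.1 1 1 ≠ 0} : ℝ) = Nat.card k - 1 := by
  have e : {α : symForms k k 1 // α.1 1 1 ≠ 0} ≃ {a : k // a ≠ 0} :=
    Equiv.subtypeEquiv ((symFormsSelf (k := k) 1).trans (Equiv.subtypeUnivEquiv fun a => by simp))
      fun α => Iff.rfl
  have := Fintype.ofFinite k
  classical
  rw [Nat.card_congr e, Nat.card_eq_fintype_card, Nat.card_eq_fintype_card,
    Fintype.card_subtype_compl, Fintype.card_subtype_eq, Nat.cast_sub Fintype.card_pos]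
  simp

theorem natCard_split {X : Type*} [Finite X] (p : X → Prop) :
    Nat.card X = Nat.card {x // p x} + Nat.card {x // ¬ p x} := by
  classical
  rw [← Nat.card_congr (Equiv.sumCompl p), Nat.card_sum]

/-- Non-degenerate symmetric forms for which a given line is not isotropic split off that line. -/
theorem card_ndForms_not_isotropic :
    (Nat.card {b : NDForms k (k × C) 1 // b.1.1 (1, 0) (1, 0) ≠ 0} : ℝ) =
      (Nat.card k - 1) * Nat.card k ^ Module.finrank k C * ndCard k 1 (Module.finrank k C) := by
  have key (α : symForms k k 1) (A : k →ₗ[k] C →ₗ[k] k) (γ : symForms k C 1) (hα : α.1 1 1 ≠ 0) :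
      (∀ x, (∀ y, ((symFormsProd 1).symm (α, A, γ)).1 x y = 0) → x = 0) ↔
      ∀ x, (∀ y, (symFormsShear (α, A, γ)).2.2.1 x y = 0) → x = 0 := by
    have hs (x y : C) : (symFormsShear (α, A, γ)).2.2.1 x y =
        γ.1 x y - (α.1 1 1)⁻¹ * (A 1 x * A 1 y) := rfl
    have hα' (x y : k) : α.1 x y = x * y * α.1 1 1 := by
      have : α.1 x y = α.1 (x • 1) (y • 1) := by simp
      rw [this, map_smul, map_smul, LinearMap.smul_apply, smul_eq_mul, smul_eq_mul]
      ring
    have hA (x : k) (c : C) : A x c = x * A 1 c := by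
      have : A x c = A (x • 1) c := by simp
      rw [this, map_smul, LinearMap.smul_apply, smul_eq_mul]
    have hb (x y : k × C) : ((symFormsProd 1).symm (α, A, γ)).1 x y =
        α.1 1 1 * (x.1 + (α.1 1 1)⁻¹ * A 1 x.2) * (y.1 + (α.1 1 1)⁻¹ * A 1 y.2) +
          (symFormsShear (α, A, γ)).2.2.1 x.2 y.2 := by
      rw [symFormsProd_symm_apply, hs, hα', hA x.1, hA y.1, Units.val_one, Int.cast_one, one_mul]
      field_simp
      ring
    simp only [hb]
    generalize (symFormsShear (α, A, γ)).2.2.1 = γ'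
    clear hs hα' hb
    generalize α.1 1 1 = a at hα ⊢
    constructor
    · intro h c hc
      have := h (-(a⁻¹ * A 1 c), c) fun y => by simp [hc]
      exact (Prod.ext_iff.1 this).2
    · rintro h ⟨x, c⟩ hxc
      have hx : x + a⁻¹ * A 1 c = 0 := by simpa [hα] using hxc (1, 0)
      have hc : c = 0 := h c fun y => by simpa [hx] using hxc (0, y)
      subst hc
      simpa using hx
  let e0 := (symFormsProd (k := k) (U := k) (C := C) 1).trans symFormsShear
  have e : {b : NDForms k (k × C) 1 // b.1.1 (1, 0) (1, 0) ≠ 0} ≃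
      {α : symForms k k 1 // α.1 1 1 ≠ 0} × (k →ₗ[k] C →ₗ[k] k) × NDForms k C 1 := by
    refine (Equiv.subtypeSubtypeEquivSubtypeInter
      (fun b : symForms k (k × C) 1 => ∀ x, (∀ y, b.1 x y = 0) → x = 0)
      (fun b => b.1 (1, 0) (1, 0) ≠ 0)).trans ?_
    refine Equiv.trans ?_ (Equiv.subtypeProdEquivProd (p := fun α : symForms k k 1 => α.1 1 1 ≠ 0)
      (q := fun Aγ : (k →ₗ[k] C →ₗ[k] k) × symForms k C 1 =>
        True ∧ ∀ x, (∀ y, Aγ.2.1 x y = 0) → x = 0) |>.trans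
        (Equiv.prodCongr (Equiv.refl _) ((Equiv.subtypeProdEquivProd
          (p := fun _ : k →ₗ[k] C →ₗ[k] k => True)
          (q := fun γ : symForms k C 1 => ∀ x, (∀ y, γ.1 x y = 0) → x = 0)).trans
          (Equiv.prodCongr (Equiv.subtypeUnivEquiv fun _ => trivial) (Equiv.refl _)))))
    refine Equiv.subtypeEquiv e0 fun b => ?_
    obtain ⟨⟨α, A, γ⟩, rfl⟩ := (symFormsProd (k := k) (U := k) (C := C) 1).symm.surjective b
    have h1 : (e0 ((symFormsProd 1).symm (α, A, γ))) = symFormsShear (α, A, γ) := by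
      simp [e0]
    have h3 : ((symFormsProd 1).symm (α, A, γ)).1 (1, 0) (1, 0) = α.1 1 1 := by
      simp [symFormsProd_symm_apply]
    rw [h1, h3, true_and]
    constructor
    · rintro ⟨h, hα⟩
      exact ⟨hα, (key α A γ hα).1 h⟩
    · rintro ⟨hα, h⟩
      exact ⟨(key α A γ hα).2 h, hα⟩
  rw [Nat.card_congr e, Nat.card_prod, Nat.card_prod, natCard_bilin, natCard_ndForms]
  push_cast
  rw [card_symForms_self_ne_zero, Module.finrank_self, one_mul, mul_assoc]

theorem card_ndForms_not_isotropic_neg (h2 : (2 : k) ≠ 0) :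
    Nat.card {b : NDForms k (k × C) (-1) // b.1.1 (1, 0) (1, 0) ≠ 0} = 0 := by
  have : IsEmpty {b : NDForms k (k × C) (-1) // b.1.1 (1, 0) (1, 0) ≠ 0} := by
    refine ⟨fun b => b.2 ?_⟩
    have := (signCast_fixed_iff h2 (-1) _).1 (b.1.1.2 (1, 0) (1, 0))
    exact this.resolve_left (by decide)
  simp

variable (k) in
theorem ndCard_zero (ε : ℤˣ) : ndCard k ε 0 = 1 := by
  have : Unique (NDForms k (Fin 0 → k) ε) :=
    { default := ⟨0, fun x _ => Subsingleton.elim _ _⟩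
      uniq := fun b => by
        ext x
        exact absurd x.2 (by omega) }
  exact Nat.card_unique

theorem isotropic_line_iff {ε : ℤˣ} (b : symForms k (k × C) ε) :
    (∀ u u' : k, b.1 (u, 0) (u', 0) = 0) ↔ b.1 (1, 0) (1, 0) = 0 := by
  refine ⟨fun h => h 1 1, fun h u u' => ?_⟩
  have h1 (v : k) : ((v, 0) : k × C) = v • (1, 0) := by simp
  rw [h1 u, h1 u', map_smul, map_smul, LinearMap.smul_apply, h]
  simp

/-- Non-degenerate forms are counted by distinguishing whether the first basis vector is
isotropic. -/
theorem ndCard_eq_split (ε : ℤˣ) (n : ℕ) :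
    ndCard k ε (n + 1) =
      Nat.card {b : NDForms k (k × (Fin n → k)) ε // ∀ u u' : k, b.1.1 (u, 0) (u', 0) = 0} +
      Nat.card {b : NDForms k (k × (Fin n → k)) ε // b.1.1 (1, 0) (1, 0) ≠ 0} := by
  have : ndCard k ε (n + 1) = Nat.card (NDForms k (k × (Fin n → k)) ε) := by
    rw [natCard_ndForms]
    simp [add_comm]
  rw [this, natCard_split fun b => b.1.1 (1, 0) (1, 0) = 0]
  simp only [isotropic_line_iff]

theorem injCard_one (q : ℝ) (n : ℕ) : injCard q 1 n = q ^ n - 1 := by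
  simp [injCard]

variable (k) in
theorem ndCard_one_sym : (ndCard k 1 1 : ℝ) = Nat.card k - 1 := by
  have : IsEmpty {b : NDForms k (k × (Fin 0 → k)) 1 // ∀ u u' : k, b.1.1 (u, 0) (u', 0) = 0} := by
    refine ⟨fun b => ?_⟩
    have := b.1.2 (1, 0) fun y => by
      rw [show y = (y.1, 0) from Prod.ext rfl (Subsingleton.elim _ _)]
      exact b.2 1 y.1
    simpa using congrArg Prod.fst this
  rw [ndCard_eq_split, Nat.cast_add, card_ndForms_not_isotropic, Nat.card_of_isEmpty]
  simp [ndCard_zero]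

theorem ndCard_one_alt (h2 : (2 : k) ≠ 0) : ndCard k (-1) 1 = 0 := by
  have : IsEmpty {b : NDForms k (k × (Fin 0 → k)) (-1) // ∀ u u' : k, b.1.1 (u, 0) (u', 0) = 0} := by
    refine ⟨fun b => ?_⟩
    have := b.1.2 (1, 0) fun y => by
      rw [show y = (y.1, 0) from Prod.ext rfl (Subsingleton.elim _ _)]
      exact b.2 1 y.1
    simpa using congrArg Prod.fst this
  rw [ndCard_eq_split, card_ndForms_not_isotropic_neg h2, Nat.card_of_isEmpty]

theorem card_isotropic_line (h2 : (2 : k) ≠ 0) (ε : ℤˣ) (n : ℕ) :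
    (Nat.card {b : NDForms k (k × (Fin (n + 1) → k)) ε //
      ∀ u u' : k, b.1.1 (u, 0) (u', 0) = 0} : ℝ) = ((Nat.card k : ℝ) ^ (n + 1) - 1) *
        (ndCard k ε n * (Nat.card k : ℝ) ^ (n + symDim ε 1)) := by
  rw [card_ndForms_prod_isotropic h2 ε (e := n) (by simp)]
  simp [injCard_one]

theorem ndCard_sym_rec (h2 : (2 : k) ≠ 0) (n : ℕ) :
    (ndCard k 1 (n + 2) : ℝ) = ((Nat.card k : ℝ) ^ (n + 1) - 1) * Nat.card k ^ (n + 1) * ndCard k 1 n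
      + (Nat.card k - 1) * Nat.card k ^ (n + 1) * ndCard k 1 (n + 1) := by
  rw [ndCard_eq_split, Nat.cast_add, card_ndForms_not_isotropic, card_isotropic_line h2,
    Module.finrank_fin_fun]
  simp [symDim]
  ring

theorem ndCard_alt_rec (h2 : (2 : k) ≠ 0) (n : ℕ) :
    (ndCard k (-1) (n + 2) : ℝ) =
      ((Nat.card k : ℝ) ^ (n + 1) - 1) * Nat.card k ^ n * ndCard k (-1) n := by
  rw [ndCard_eq_split, Nat.cast_add, card_ndForms_not_isotropic_neg h2, card_isotropic_line h2]
  have : symDim (-1) 1 = 0 := by decide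
  rw [this]
  push_cast
  ring

/-- The closed formula for the number of non-degenerate `ε`-symmetric forms. It is meaningful for
`ε = 1` and for even `n` only. -/
noncomputable def ndValue (q : ℝ) (ε : ℤˣ) (n : ℕ) : ℝ :=
  glCard q n / (q ^ symDim (-ε) n * qPoch (q⁻¹ ^ 2) (n / 2))

theorem glCard_succ (q : ℝ) (n : ℕ) : glCard q (n + 1) = (q ^ (n + 1) - 1) * q ^ n * glCard q n := by
  rw [add_comm, glCard_add, injCard_one]
  ring

theorem qPoch_succ (y : ℝ) (n : ℕ) : qPoch y (n + 1) = qPoch y n * (1 - y ^ (n + 1)) := by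
  rw [qPoch_eq_prod_range, qPoch_eq_prod_range, Finset.prod_range_succ]

theorem qPoch_ne_zero {y : ℝ} (h0 : 0 ≤ y) (h1 : y < 1) (n : ℕ) : qPoch y n ≠ 0 := by
  rw [qPoch_eq_prod_range]
  exact Finset.prod_ne_zero_iff.2 fun i _ =>
    (sub_pos.2 (pow_lt_one₀ h0 h1 (Nat.succ_ne_zero i))).ne'

theorem ndValue_sym_odd {q : ℝ} (hq : 1 < q) (m : ℕ) :
    ndValue q 1 (2 * m + 1) = (q ^ (2 * m + 1) - 1) * ndValue q 1 (2 * m) := by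
  have h0 : q ≠ 0 := by positivity
  have hp : qPoch (q⁻¹ ^ 2) m ≠ 0 := qPoch_ne_zero (by positivity)
    (pow_lt_one₀ (by positivity) (inv_lt_one_of_one_lt₀ hq) two_ne_zero) m
  have h1 : (2 * m + 1) / 2 = m := by omega
  have h2 : 2 * m / 2 = m := by omega
  have h3 : symDim (-1) (2 * m + 1) = 2 * m + symDim (-1) (2 * m) := by
    rw [symDim_succ]; simp
  rw [ndValue, ndValue, h1, h2, h3, glCard_succ, pow_add q (2 * m) (symDim _ _)]
  generalize qPoch (q⁻¹ ^ 2) m = Q at hp ⊢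
  field_simp

theorem ndValue_sym_even {q : ℝ} (hq : 1 < q) (m : ℕ) :
    ndValue q 1 (2 * m + 2) = q ^ (2 * m + 2) * ndValue q 1 (2 * m + 1) := by
  have h0 : q ≠ 0 := by positivity
  have hi : q⁻¹ ^ 2 < 1 := pow_lt_one₀ (by positivity) (inv_lt_one_of_one_lt₀ hq) two_ne_zero
  have hp : qPoch (q⁻¹ ^ 2) m ≠ 0 := qPoch_ne_zero (by positivity) hi m
  have h1 : (2 * m + 1) / 2 = m := by omega
  have h2 : (2 * m + 1 + 1) / 2 = m + 1 := by omega
  have h3 : symDim (-1) (2 * m + 1 + 1) = 2 * m + 1 + symDim (-1) (2 * m + 1) := by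
    rw [symDim_succ]; simp
  have h4 : q ^ (2 * m + 1 + 1) - 1 = q ^ (2 * m + 2) * (1 - (q⁻¹ ^ 2) ^ (m + 1)) := by
    rw [← pow_mul, inv_pow, show 2 * (m + 1) = 2 * m + 2 by ring]
    field_simp
  have h5 : 1 - (q⁻¹ ^ 2) ^ (m + 1) ≠ 0 :=
    (sub_pos.2 (pow_lt_one₀ (by positivity) hi (Nat.succ_ne_zero m))).ne'
  rw [show 2 * m + 2 = 2 * m + 1 + 1 by ring, ndValue, ndValue, h1, h2, h3, glCard_succ, h4,
    qPoch_succ, pow_add q (2 * m + 1) (symDim _ _)]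
  generalize qPoch (q⁻¹ ^ 2) m = Q at hp ⊢
  generalize 1 - (q⁻¹ ^ 2) ^ (m + 1) = R at h5 ⊢
  field_simp

theorem ndValue_alt {q : ℝ} (hq : 1 < q) (m : ℕ) :
    ndValue q (-1) (2 * m + 2) = (q ^ (2 * m + 1) - 1) * q ^ (2 * m) * ndValue q (-1) (2 * m) := by
  have h0 : q ≠ 0 := by positivity
  have hi : q⁻¹ ^ 2 < 1 := pow_lt_one₀ (by positivity) (inv_lt_one_of_one_lt₀ hq) two_ne_zero
  have hp : qPoch (q⁻¹ ^ 2) m ≠ 0 := qPoch_ne_zero (by positivity) hi m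
  have h1 : (2 * m) / 2 = m := by omega
  have h2 : (2 * m + 1 + 1) / 2 = m + 1 := by omega
  have h3 : symDim (- -1) (2 * m + 1 + 1) = 2 * m + 2 * m + 1 + 2 + symDim (- -1) (2 * m) := by
    rw [symDim_succ, symDim_succ]; simp; ring
  have h4 : q ^ (2 * m + 1 + 1) - 1 = q ^ (2 * m) * q ^ 2 * (1 - (q⁻¹ ^ 2) ^ (m + 1)) := by
    rw [← pow_mul, ← pow_add, inv_pow, show 2 * (m + 1) = 2 * m + 2 by ring]
    field_simp
  have h5 : 1 - (q⁻¹ ^ 2) ^ (m + 1) ≠ 0 :=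
    (sub_pos.2 (pow_lt_one₀ (by positivity) hi (Nat.succ_ne_zero m))).ne'
  rw [show 2 * m + 2 = 2 * m + 1 + 1 by ring, ndValue, ndValue, h1, h2, h3, glCard_succ,
    glCard_succ, h4, qPoch_succ, pow_add q _ (symDim _ _)]
  generalize qPoch (q⁻¹ ^ 2) m = Q at hp ⊢
  generalize 1 - (q⁻¹ ^ 2) ^ (m + 1) = R at h5 ⊢
  simp only [pow_add]
  field_simp

theorem ndCard_sym (h2 : (2 : k) ≠ 0) (n : ℕ) : (ndCard k 1 n : ℝ) = ndValue (Nat.card k) 1 n := by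
  have hq := one_lt_natCard k
  have h (m : ℕ) : (ndCard k 1 (2 * m) : ℝ) = ndValue (Nat.card k) 1 (2 * m) ∧
      (ndCard k 1 (2 * m + 1) : ℝ) = ndValue (Nat.card k) 1 (2 * m + 1) := by
    induction m with
    | zero =>
      have h0 : ndValue (Nat.card k) 1 0 = 1 := by simp [ndValue, glCard, injCard, symDim, qPoch]
      refine ⟨by simp [h0, ndCard_zero], ?_⟩
      rw [ndValue_sym_odd hq]
      simp [ndCard_one_sym, h0]
    | succ m ih =>
      have he : (ndCard k 1 (2 * (m + 1)) : ℝ) = ndValue (Nat.card k) 1 (2 * (m + 1)) := by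
        rw [show 2 * (m + 1) = 2 * m + 2 by ring, ndCard_sym_rec h2, ih.1, ih.2,
          ndValue_sym_even hq, ndValue_sym_odd hq]
        ring
      refine ⟨he, ?_⟩
      have h3 := ndCard_sym_rec h2 (2 * m + 1)
      rw [show 2 * m + 1 + 2 = 2 * (m + 1) + 1 by ring, show 2 * m + 1 + 1 = 2 * (m + 1) by ring] at h3
      rw [h3, ih.2, he, ndValue_sym_odd hq (m + 1), show 2 * (m + 1) = 2 * m + 2 by ring,
        ndValue_sym_even hq]
      ring
  rcases Nat.even_or_odd' n with ⟨m, rfl | rfl⟩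
  · exact (h m).1
  · exact (h m).2

theorem ndCard_alt_even (h2 : (2 : k) ≠ 0) (m : ℕ) :
    (ndCard k (-1) (2 * m) : ℝ) = ndValue (Nat.card k) (-1) (2 * m) := by
  induction m with
  | zero => simp [ndValue, glCard, injCard, symDim, qPoch, ndCard_zero]
  | succ m ih =>
    rw [show 2 * (m + 1) = 2 * m + 2 by ring, ndCard_alt_rec h2, ih, ndValue_alt (one_lt_natCard k)]

/-- There are no non-degenerate alternating forms in odd dimension. -/
theorem ndCard_alt_odd (h2 : (2 : k) ≠ 0) (m : ℕ) : (ndCard k (-1) (2 * m + 1) : ℝ) = 0 := by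
  induction m with
  | zero => simp [ndCard_one_alt h2]
  | succ m ih =>
    rw [show 2 * (m + 1) + 1 = (2 * m + 1) + 2 by ring, ndCard_alt_rec h2, ih, mul_zero]

theorem ndCard_eq_ndValue (h2 : (2 : k) ≠ 0) {ε : ℤˣ} {n : ℕ} (h : ε = -1 → Even n) :
    (ndCard k ε n : ℝ) = ndValue (Nat.card k) ε n := by
  rcases Int.units_eq_one_or ε with rfl | rfl
  · exact ndCard_sym h2 n
  · obtain ⟨m, rfl⟩ := (h rfl).two_dvd
    exact ndCard_alt_even h2 m

theorem ndCard_eq_zero (h2 : (2 : k) ≠ 0) {n : ℕ} (h : ¬ Even n) : ndCard k (-1) n = 0 := by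
  obtain ⟨m, rfl⟩ := Nat.not_even_iff_odd.1 h
  exact_mod_cast ndCard_alt_odd h2 m

end NDCount

/-! ### Forms vanishing on subspaces -/

section LocalCounts

variable {k : Type*} [Field k] [Finite k]
  {V : Type*} [AddCommGroup V] [Module k V] [FiniteDimensional k V]
  {W : Type*} [AddCommGroup W] [Module k W] [FiniteDimensional k W]
  {C : Type*} [AddCommGroup C] [Module k C] [FiniteDimensional k C]

theorem natCard_symForms_vanishing (h2 : (2 : k) ≠ 0) (ε : ℤˣ) (U : Submodule k V) :
    Nat.card {b : symForms k V ε // ∀ x ∈ U, ∀ y, b.1 x y = 0} =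
      Nat.card k ^ symDim ε (Module.finrank k V - Module.finrank k U) := by
  obtain ⟨C, hC, hd⟩ := exists_compl_finrank U
  rw [← hd, ← natCard_symForms C h2]
  let e := (symFormsCongr ε (Submodule.prodEquivOfIsCompl U C hC).symm).trans (symFormsProd ε)
  have e1 : {b : symForms k V ε // ∀ x ∈ U, ∀ y, b.1 x y = 0} ≃
      {p : symForms k U ε × (U →ₗ[k] C →ₗ[k] k) × symForms k C ε // p.1 = 0 ∧ p.2.1 = 0} := by
    refine Equiv.subtypeEquiv e fun b => ?_
    constructor
    · intro h
      refine ⟨?_, ?_⟩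
      · ext u u'
        exact h _ (by simp) _
      · ext u c
        exact h _ (by simp) _
    · rintro ⟨h1, h3⟩ x hx y
      obtain ⟨⟨u, c⟩, rfl⟩ := (Submodule.prodEquivOfIsCompl U C hC).surjective y
      have h4 : b.1 x u = 0 := by
        have := LinearMap.congr_fun (LinearMap.congr_fun (congrArg Subtype.val h1) ⟨x, hx⟩) u
        simpa [e, symFormsProd, symFormsCongr] using this
      have h5 : b.1 x c = 0 := by
        have := LinearMap.congr_fun (LinearMap.congr_fun h3 ⟨x, hx⟩) c
        simpa [e, symFormsProd, symFormsCongr] using this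
      rw [Submodule.coe_prodEquivOfIsCompl', map_add, h4, h5, add_zero]
  rw [Nat.card_congr e1]
  refine Nat.card_congr ⟨fun p => p.1.2.2, fun γ => ⟨(0, 0, γ), rfl, rfl⟩, fun p => ?_, fun γ => rfl⟩
  exact Subtype.ext (Prod.ext p.2.1.symm (Prod.ext p.2.2.symm rfl))

theorem finrank_dualAnnihilator (U : Submodule k W) :
    Module.finrank k U.dualAnnihilator = Module.finrank k W - Module.finrank k U := by
  have := Subspace.finrank_add_finrank_dualAnnihilator_eq U
  omega

theorem natCard_bilin_vanishing (U : Submodule k V) (U' : Submodule k W) :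
    Nat.card {b : V →ₗ[k] W →ₗ[k] k // (∀ x ∈ U, ∀ y, b x y = 0) ∧ ∀ x, ∀ y ∈ U', b x y = 0} =
      Nat.card k ^ ((Module.finrank k V - Module.finrank k U) *
        (Module.finrank k W - Module.finrank k U')) := by
  have h := natCard_extensions_mapsTo (k := k) (W := W →ₗ[k] k) (le_top (a := U))
    U'.dualAnnihilator 0 (by simp)
  rw [finrank_dualAnnihilator, finrank_top, Nat.sub_self, zero_mul, add_zero] at h
  rw [← h]
  refine Nat.card_congr (Equiv.subtypeEquivRight fun b => ?_)
  simp only [Submodule.mem_top, true_implies, Submodule.mem_dualAnnihilator]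
  refine and_congr ⟨fun h => ?_, fun h x hx y => ?_⟩ Iff.rfl
  · ext x y
    exact h x x.2 y
  · exact LinearMap.congr_fun (LinearMap.congr_fun h ⟨x, hx⟩) y

/-- The number of lifts of a linear map along a quotient map. -/
theorem natCard_lifts (R : Submodule k W) (χ : C →ₗ[k] W ⧸ R) :
    Nat.card {ψ : C →ₗ[k] W // R.mkQ ∘ₗ ψ = χ} =
      Nat.card k ^ (Module.finrank k C * Module.finrank k R) := by
  obtain ⟨s, hs⟩ := LinearMap.exists_rightInverse_of_surjective R.mkQ R.range_mkQ
  have hs' (x) : R.mkQ (s x) = x := LinearMap.congr_fun hs x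
  rw [← natCard_linearMap]
  refine Nat.card_congr ⟨fun ψ => (ψ.1 - s ∘ₗ χ).codRestrict R fun c => ?_,
    fun φ => ⟨R.subtype ∘ₗ φ + s ∘ₗ χ, ?_⟩, fun ψ => ?_, fun φ => ?_⟩
  · refine (Submodule.Quotient.mk_eq_zero R).1 ?_
    change R.mkQ (ψ.1 c - s (χ c)) = 0
    rw [map_sub, hs', sub_eq_zero]
    exact LinearMap.congr_fun ψ.2 c
  · ext c
    simp only [LinearMap.comp_apply, LinearMap.add_apply, map_add, hs']
    simp
  · ext c
    simp
  · ext c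
    simp

/-- The number of injective extensions of an injective linear map from a subspace. -/
theorem card_injective_extensions (U : Submodule k V) (φ : U →ₗ[k] W) (hφ : Function.Injective φ) :
    (Nat.card {y : V →ₗ[k] W // y.domRestrict U = φ ∧ Function.Injective y} : ℝ) =
      injCard (Nat.card k) (Module.finrank k V - Module.finrank k U)
        (Module.finrank k W - Module.finrank k U) *
      (Nat.card k : ℝ) ^ ((Module.finrank k V - Module.finrank k U) * Module.finrank k U) := by
  obtain ⟨C, hC, hd⟩ := exists_compl_finrank U
  let R := LinearMap.range φ
  have hR : Module.finrank k R = Module.finrank k U := LinearMap.finrank_range_of_inj hφ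
  have hQ : Module.finrank k (W ⧸ R) = Module.finrank k W - Module.finrank k U := by
    rw [Submodule.finrank_quotient, hR]
  have e : {y : V →ₗ[k] W // y.domRestrict U = φ ∧ Function.Injective y} ≃
      {ψ : C →ₗ[k] W // Function.Injective (R.mkQ ∘ₗ ψ)} :=
    { toFun := fun y => ⟨y.1.domRestrict C, by
        rw [injective_iff_map_eq_zero]
        intro c hc
        have : y.1 c ∈ R := by
          rw [← Submodule.ker_mkQ R]; exact hc
        obtain ⟨u, hu⟩ := this
        have h1 : (u : V) = c := y.2.2 ((LinearMap.congr_fun y.2.1 u).trans hu)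
        have h3 : (c : V) ∈ U ⊓ C := ⟨h1 ▸ u.2, c.2⟩
        rw [hC.inf_eq_bot] at h3
        simpa using h3⟩
      invFun := fun ψ => ⟨LinearMap.ofIsCompl hC φ ψ.1, by ext; simp, by
        rw [injective_iff_map_eq_zero]
        intro x hx
        obtain ⟨⟨u, c⟩, rfl⟩ := (Submodule.prodEquivOfIsCompl U C hC).surjective x
        rw [Submodule.coe_prodEquivOfIsCompl', map_add, LinearMap.ofIsCompl_apply_left,
          LinearMap.ofIsCompl_apply_right] at hx
        have hc : c = 0 := (injective_iff_map_eq_zero _).1 ψ.2 c (by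
          rw [LinearMap.comp_apply, ← LinearMap.mem_ker, Submodule.ker_mkQ]
          exact ⟨-u, by rw [map_neg]; exact neg_eq_of_add_eq_zero_right hx⟩)
        subst hc
        have hu : u = 0 := (injective_iff_map_eq_zero _).1 hφ u (by simpa using hx)
        simp [hu]⟩
      left_inv := fun y => Subtype.ext (LinearMap.ofIsCompl_eq hC
        (fun x => (LinearMap.congr_fun y.2.1 x).symm) fun x => rfl)
      right_inv := fun ψ => by ext; simp }
  rw [Nat.card_congr e, natCard_cast_eq_mul_of_fiber
    (Y := {χ : C →ₗ[k] W ⧸ R // Function.Injective χ}) (fun ψ => ⟨R.mkQ ∘ₗ ψ.1, ψ.2⟩) ?_,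
    card_injective_linearMap, hd, hQ]
  intro χ
  have h := natCard_lifts R χ.1
  rw [hd, hR] at h
  rw [← Nat.cast_pow, ← h]
  congr 1
  refine Nat.card_congr ⟨fun ψ => ⟨ψ.1.1, congrArg Subtype.val ψ.2⟩,
    fun ψ => ⟨⟨ψ.1, by rw [ψ.2]; exact χ.2⟩, Subtype.ext ψ.2⟩, fun _ => rfl, fun _ => rfl⟩

/-- Perfect pairings between two spaces for which given subspaces are orthogonal. -/
theorem card_perfect_isotropic (U : Submodule k V) (U' : Submodule k W)
    (hd : Module.finrank k V = Module.finrank k W) :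
    (Nat.card {b : V →ₗ[k] W →ₗ[k] k // b.Nondegenerate ∧ ∀ x ∈ U, ∀ y ∈ U', b x y = 0} : ℝ) =
      injCard (Nat.card k) (Module.finrank k U) (Module.finrank k W - Module.finrank k U') *
        (glCard (Nat.card k) (Module.finrank k V - Module.finrank k U) *
        (Nat.card k : ℝ) ^ ((Module.finrank k V - Module.finrank k U) * Module.finrank k U)) := by
  have hnd (b : V →ₗ[k] W →ₗ[k] k) : b.Nondegenerate ↔ Function.Injective b := by
    rw [LinearMap.Nondegenerate, LinearMap.separatingLeft_iff_ker_eq_bot, ← LinearMap.ker_eq_bot]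
    refine ⟨fun h => h.1, fun h => ⟨h, ?_⟩⟩
    have hr : LinearMap.range b = ⊤ := by
      refine Submodule.eq_top_of_finrank_eq ?_
      rw [LinearMap.finrank_range_of_inj (LinearMap.ker_eq_bot.1 h), hd]
      exact (Subspace.dual_finrank_eq (K := k) (V := W)).symm
    intro y hy
    rw [← Module.forall_dual_apply_eq_zero_iff k]
    intro f
    obtain ⟨x, rfl⟩ : f ∈ LinearMap.range b := hr ▸ Submodule.mem_top
    exact hy x
  have h1 := card_injective_linearMap k U U'.dualAnnihilator
  rw [finrank_dualAnnihilator] at h1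
  have hres (b : {b : V →ₗ[k] W →ₗ[k] k // b.Nondegenerate ∧ ∀ x ∈ U, ∀ y ∈ U', b x y = 0}) (x : U) :
      b.1.domRestrict U x ∈ U'.dualAnnihilator :=
    (Submodule.mem_dualAnnihilator _).2 fun y hy => b.2.2 x x.2 y hy
  rw [← h1]
  have := Module.finite_of_finite k (M := U)
  have : Finite U'.dualAnnihilator :=
    have := Module.finite_of_finite k (M := Module.Dual k W)
    inferInstance
  have : Finite (U →ₗ[k] U'.dualAnnihilator) := DFunLike.finite _
  refine natCard_cast_eq_mul_of_fiber
    (Y := {f : U →ₗ[k] U'.dualAnnihilator // Function.Injective f})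
    (fun b => ⟨(b.1.domRestrict U).codRestrict _ (hres b), fun x y hxy =>
      Subtype.ext ((hnd _).1 b.2.1 (congrArg Subtype.val hxy))⟩) ?_
  · intro φ
    have h3 := card_injective_extensions U (U'.dualAnnihilator.subtype ∘ₗ φ.1)
      (Subtype.val_injective.comp φ.2)
    have h4 : Module.finrank k (W →ₗ[k] k) = Module.finrank k V := by
      rw [hd]; exact Subspace.dual_finrank_eq
    rw [h4] at h3
    rw [glCard, ← h3]
    congr 1
    refine Nat.card_congr ⟨fun b => ⟨b.1.1, ?_, (hnd _).1 b.1.2.1⟩,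
      fun y => ⟨⟨y.1, (hnd _).2 y.2.2, fun x hx z hz => ?_⟩, ?_⟩, fun _ => rfl, fun _ => rfl⟩
    · ext1 x
      exact congrArg Subtype.val (LinearMap.congr_fun (congrArg Subtype.val b.2) x)
    · have h5 : y.1 x = φ.1 ⟨x, hx⟩ := LinearMap.congr_fun y.2.1 ⟨x, hx⟩
      rw [h5]
      exact (Submodule.mem_dualAnnihilator _).1 (φ.1 ⟨x, hx⟩).2 z hz
    · apply Subtype.ext
      ext1 x
      exact Subtype.ext (LinearMap.congr_fun y.2.1 x)

/-- Orthogonal subspaces for a non-degenerate pairing. -/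
theorem finrank_add_le_of_orthogonal {b : V →ₗ[k] W →ₗ[k] k} (hb : b.SeparatingLeft)
    {U : Submodule k V} {U' : Submodule k W} (h : ∀ x ∈ U, ∀ y ∈ U', b x y = 0) :
    Module.finrank k U + Module.finrank k U' ≤ Module.finrank k W := by
  rw [LinearMap.separatingLeft_iff_ker_eq_bot, LinearMap.ker_eq_bot] at hb
  let f : U →ₗ[k] U'.dualAnnihilator := (b.domRestrict U).codRestrict _ fun x =>
    (Submodule.mem_dualAnnihilator _).2 fun y hy => h x x.2 y hy
  have hf : Function.Injective f := fun x y hxy => Subtype.ext (hb (congrArg Subtype.val hxy))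
  have h1 := LinearMap.finrank_le_finrank_of_injective hf
  have h3 := Subspace.finrank_add_finrank_dualAnnihilator_eq U'
  omega

end LocalCounts

/-! ### Symmetric forms on graded spaces with an involution of the index set -/

section GradedForms

variable {k : Type*} [Field k] {I : Type*} [DecidableEq I]
  {W : I → Type*} [∀ i, AddCommGroup (W i)] [∀ i, Module k (W i)]

variable (k W) in
/-- Bilinear forms on `⨁ W i`, given by their blocks, for which `W i` and `W j` are orthogonal
unless `i = σ j` and which are `ε i`-symmetric on `W i + W (σ i)`. -/
def gradedForms (σ : I → I) (ε : I → ℤˣ) : Submodule k (∀ i j, W i →ₗ[k] W j →ₗ[k] k) where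
  carrier := {β | (∀ i j, j ≠ σ i → β i j = 0) ∧
    ∀ i j x y, β i j x y = ((ε i : ℤ) : k) * β j i y x}
  add_mem' := fun {a b} ha hb => ⟨fun i j h => by simp [ha.1 i j h, hb.1 i j h],
    fun i j x y => by simp [ha.2 i j x y, hb.2 i j x y, mul_add]⟩
  zero_mem' := ⟨fun i j h => rfl, fun i j x y => by simp⟩
  smul_mem' := fun c b hb => ⟨fun i j h => by simp [hb.1 i j h],
    fun i j x y => by simp [hb.2 i j x y, mul_left_comm]⟩

/-- Translation of symmetric graded forms. -/
def gradedFormsShift {σ : I → I} {ε : I → ℤˣ} (β₁ : gradedForms k W σ ε) :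
    gradedForms k W σ ε ≃ gradedForms k W σ ε where
  toFun β := ⟨fun i j => β.1 i j - β₁.1 i j,
    fun i j h => LinearMap.ext₂ fun x y => by simp [β.2.1 i j h, β₁.2.1 i j h],
    fun i j x y => by simp [β.2.2 i j x y, β₁.2.2 i j x y, mul_sub]⟩
  invFun β := ⟨fun i j => β.1 i j + β₁.1 i j,
    fun i j h => by simp [β.2.1 i j h, β₁.2.1 i j h],
    fun i j x y => by simp [β.2.2 i j x y, β₁.2.2 i j x y, mul_add]⟩
  left_inv β := Subtype.ext (funext₂ fun i j => LinearMap.ext₂ fun x y => by simp)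
  right_inv β := Subtype.ext (funext₂ fun i j => LinearMap.ext₂ fun x y => by simp)

/-- An involution of an index set with invariant signs and a choice `P` of representatives of the
two-element orbits. -/
structure SignedInvolution (σ : I → I) (ε : I → ℤˣ) (P : Finset I) : Prop where
  invol : ∀ i, σ (σ i) = i
  sign : ∀ i, ε (σ i) = ε i
  fixed : ∀ i, σ i = i → i ∉ P
  swap : ∀ i, σ i ≠ i → (i ∈ P ↔ σ i ∉ P)

variable {σ : I → I} {ε : I → ℤˣ} {P : Finset I}

/-- The blocks of a symmetric graded form indexed by representatives of the orbits. -/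
def gradedFormsBlocks (β : gradedForms k W σ ε) :
    (∀ i : {i // i ∈ P}, W i →ₗ[k] W (σ i) →ₗ[k] k) ×
      (∀ i : {i // σ i = i}, symForms k (W i) (ε i)) :=
  (fun i => β.1 i (σ i), fun i => ⟨β.1 i i, fun x y => β.2.2 i i x y⟩)

theorem SignedInvolution.swap_mem (h : SignedInvolution σ ε P) {i : I} (hi : i ∉ P)
    (hne : σ i ≠ i) : σ i ∈ P := by
  by_contra hc
  exact hi ((h.swap i hne).2 hc)

theorem SignedInvolution.not_mem (h : SignedInvolution σ ε P) {i : I} (hi : i ∈ P) : σ i ∉ P :=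
  (h.swap i fun e => h.fixed i e hi).1 hi

theorem gradedFormsBlocks_injective (h : SignedInvolution σ ε P) :
    Function.Injective (gradedFormsBlocks (k := k) (W := W) (σ := σ) (ε := ε) (P := P)) := by
  intro β β' hb
  have h1 (i) (hi : i ∈ P) : β.1 i (σ i) = β'.1 i (σ i) :=
    congrFun (congrArg Prod.fst hb) ⟨i, hi⟩
  have h2 (i) (hi : σ i = i) : β.1 i i = β'.1 i i :=
    congrArg Subtype.val (congrFun (congrArg Prod.snd hb) ⟨i, hi⟩)
  apply Subtype.ext
  funext i j
  by_cases hij : j = σ i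
  · by_cases hi : i ∈ P
    · subst hij
      exact h1 i hi
    · by_cases hf : σ i = i
      · rw [hf] at hij
        subst hij
        exact h2 j hf
      · have hj : j ∈ P := hij ▸ h.swap_mem hi hf
        have hij' : i = σ j := by rw [hij, h.invol]
        subst hij'
        refine LinearMap.ext₂ fun x y => ?_
        rw [β.2.2, β'.2.2, h1 j hj]
  · rw [β.2.1 i j hij, β'.2.1 i j hij]

theorem gradedFormsBlocks_surjective (h : SignedInvolution σ ε P) :
    Function.Surjective (gradedFormsBlocks (k := k) (W := W) (σ := σ) (ε := ε) (P := P)) := by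
  rintro ⟨p, s⟩
  let β : ∀ i j, W i →ₗ[k] W j →ₗ[k] k := fun i j =>
    if h1 : i ∈ P ∧ j = σ i then h1.2 ▸ p ⟨i, h1.1⟩
    else if h2 : j ∈ P ∧ i = σ j then
      ((ε i : ℤ) : k) • (h2.2 ▸ p ⟨j, h2.1⟩ : W j →ₗ[k] W i →ₗ[k] k).flip
    else if h3 : σ i = i ∧ j = i then h3.2 ▸ (s ⟨i, h3.1⟩).1 else 0
  have e1 (i) (hi : i ∈ P) : β i (σ i) = p ⟨i, hi⟩ := dif_pos ⟨hi, rfl⟩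
  have e2 (i) (hi : i ∈ P) : β (σ i) i = ((ε (σ i) : ℤ) : k) • (p ⟨i, hi⟩).flip :=
    (dif_neg fun hc => h.not_mem hi hc.1).trans (dif_pos ⟨hi, rfl⟩)
  have e3 (i) (hi : σ i = i) : β i i = (s ⟨i, hi⟩).1 :=
    (dif_neg fun hc => h.fixed i hi hc.1).trans
      ((dif_neg fun hc => h.fixed i hi hc.1).trans (dif_pos ⟨hi, rfl⟩))
  have e4 (i j) (hij : j ≠ σ i) : β i j = 0 :=
    (dif_neg fun hc => hij hc.2).trans ((dif_neg fun hc => hij (by rw [hc.2, h.invol])).trans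
      (dif_neg fun hc => hij (by rw [hc.1, hc.2])))
  refine ⟨⟨β, e4, fun i j x y => ?_⟩, Prod.ext (funext fun i => e1 i i.2)
    (funext fun i => Subtype.ext (e3 i i.2))⟩
  by_cases hij : j = σ i
  · by_cases hi : i ∈ P
    · subst hij
      rw [e1 i hi, e2 i hi, h.sign]
      simp [signCast_mul_cancel]
    · by_cases hf : σ i = i
      · rw [hf] at hij
        subst hij
        rw [e3 j hf]
        exact (s ⟨j, hf⟩).2 x y
      · have hj : j ∈ P := hij ▸ h.swap_mem hi hf
        have hij' : i = σ j := by rw [hij, h.invol]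
        subst hij'
        rw [e1 j hj, e2 j hj]
        rfl
  · have hji : i ≠ σ j := fun e => hij (by rw [e, h.invol])
    rw [e4 i j hij, e4 j i hji]
    simp

/-- Symmetric graded forms subject to conditions on their blocks are counted one orbit at a
time. -/
theorem natCard_gradedForms [Fintype I] (h : SignedInvolution σ ε P)
    (Cond : ∀ i j, (W i →ₗ[k] W j →ₗ[k] k) → Prop)
    (hC : ∀ i j b, Cond i j b → Cond j i (((ε i : ℤ) : k) • b.flip)) :
    Nat.card {β : gradedForms k W σ ε // ∀ i, Cond i (σ i) (β.1 i (σ i))} =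
      (∏ i ∈ P, Nat.card {b : W i →ₗ[k] W (σ i) →ₗ[k] k // Cond i (σ i) b}) *
        ∏ i with σ i = i, Nat.card {b : symForms k (W i) (ε i) // Cond i i b.1} := by
  let e := Equiv.ofBijective _ ⟨gradedFormsBlocks_injective (k := k) (W := W) h,
    gradedFormsBlocks_surjective h⟩
  have e1 : {β : gradedForms k W σ ε // ∀ i, Cond i (σ i) (β.1 i (σ i))} ≃
      (∀ i : {i // i ∈ P}, {b : W i →ₗ[k] W (σ i) →ₗ[k] k // Cond i (σ i) b}) ×
        (∀ i : {i // σ i = i}, {b : symForms k (W i) (ε i) // Cond i i b.1}) := by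
    refine Equiv.trans ?_ (Equiv.prodCongr (Equiv.subtypePiEquivPi
      (p := fun (i : {i // i ∈ P}) b => Cond i.1 (σ i.1) b)) (Equiv.subtypePiEquivPi
        (p := fun (i : {i // σ i = i}) (b : symForms k (W i.1) (ε i.1)) => Cond i.1 i.1 b.1)))
    refine Equiv.trans ?_ Equiv.subtypeProdEquivProd
    refine Equiv.subtypeEquiv e fun β => ⟨fun hβ => ⟨fun i => hβ i, fun i => ?_⟩, fun hβ i => ?_⟩
    · have := hβ i
      rw [i.2] at this
      exact this
    · by_cases hi : i ∈ P
      · exact hβ.1 ⟨i, hi⟩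
      · by_cases hf : σ i = i
        · rw [hf]
          exact hβ.2 ⟨i, hf⟩
        · have h1 : Cond (σ i) (σ (σ i)) (β.1 (σ i) (σ (σ i))) := hβ.1 ⟨σ i, h.swap_mem hi hf⟩
          rw [h.invol] at h1
          have h2 := hC _ _ _ h1
          convert h2
          refine LinearMap.ext₂ fun x y => ?_
          rw [β.2.2, ← h.sign]
          rfl
  rw [Nat.card_congr e1, Nat.card_prod, Nat.card_pi, Nat.card_pi]
  congr 1
  · exact (Finset.prod_subtype P (fun _ => Iff.rfl) fun i =>
      Nat.card {b : W i →ₗ[k] W (σ i) →ₗ[k] k // Cond i (σ i) b}).symm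
  · exact (Finset.prod_subtype _ (fun _ => by simp) fun i =>
      Nat.card {b : symForms k (W i) (ε i) // Cond i i b.1}).symm

variable [Fintype I] [Finite k] [∀ i, FiniteDimensional k (W i)]

instance : Finite (∀ i j, W i →ₗ[k] W j →ₗ[k] k) := Pi.finite

instance : Finite (gradedForms k W σ ε) := Subtype.finite

/-- The dimension of the space of symmetric graded forms on a graded space of dimension `f`. -/
def gradedDim (σ : I → I) (ε : I → ℤˣ) (P : Finset I) (f : I → ℕ) : ℕ :=
  (∑ i ∈ P, f i * f (σ i)) + ∑ i with σ i = i, symDim (ε i) (f i)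

theorem natCard_gradedForms_vanishing (h2 : (2 : k) ≠ 0) (h : SignedInvolution σ ε P)
    (U : ∀ i, Submodule k (W i)) :
    Nat.card {β : gradedForms k W σ ε // ∀ i, ∀ x ∈ U i, ∀ y, β.1 i (σ i) x y = 0} =
      Nat.card k ^ gradedDim σ ε P fun i => Module.finrank k (W i) - Module.finrank k (U i) := by
  have h1 := natCard_gradedForms (k := k) (W := W) h
    (fun i j b => (∀ x ∈ U i, ∀ y, b x y = 0) ∧ ∀ x, ∀ y ∈ U j, b x y = 0)
    (fun i j b hb => ⟨fun x hx y => by simp [hb.2 y x hx], fun x y hy => by simp [hb.1 y hy x]⟩)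
  have h3 : {β : gradedForms k W σ ε // ∀ i, ∀ x ∈ U i, ∀ y, β.1 i (σ i) x y = 0} ≃
      {β : gradedForms k W σ ε // ∀ i, (∀ x ∈ U i, ∀ y, β.1 i (σ i) x y = 0) ∧
        ∀ x, ∀ y ∈ U (σ i), β.1 i (σ i) x y = 0} := by
    refine Equiv.subtypeEquivRight fun β => ⟨fun hβ i => ⟨hβ i, fun x y hy => ?_⟩,
      fun hβ i => (hβ i).1⟩
    rw [β.2.2]
    have h4 := hβ (σ i) y hy
    rw [h.invol] at h4
    rw [h4, mul_zero]
  rw [Nat.card_congr h3, h1, gradedDim, pow_add, ← Finset.prod_pow_eq_pow_sum,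
    ← Finset.prod_pow_eq_pow_sum]
  congr 1
  · exact Finset.prod_congr rfl fun i _ => natCard_bilin_vanishing (U i) (U (σ i))
  · refine Finset.prod_congr rfl fun i _ => ?_
    rw [← natCard_symForms_vanishing h2]
    refine Nat.card_congr (Equiv.subtypeEquivRight fun b => ⟨fun hb => hb.1, fun hb => ⟨hb, ?_⟩⟩)
    intro x y hy
    rw [b.2, hb y hy, mul_zero]

/-- A symmetric graded form is non-degenerate if all its blocks on `W i × W (σ i)` are. -/
def GradedNondeg (σ : I → I) (β : ∀ i j, W i →ₗ[k] W j →ₗ[k] k) : Prop :=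
  ∀ i, (β i (σ i)).Nondegenerate

/-- `U` is isotropic for a symmetric graded form. -/
def GradedIsotropic (β : ∀ i j, W i →ₗ[k] W j →ₗ[k] k) (U : ∀ i, Submodule k (W i)) : Prop :=
  ∀ i j, ∀ x ∈ U i, ∀ y ∈ U j, β i j x y = 0

theorem gradedIsotropic_iff (β : gradedForms k W σ ε) (U : ∀ i, Submodule k (W i)) :
    GradedIsotropic β.1 U ↔ ∀ i, ∀ x ∈ U i, ∀ y ∈ U (σ i), β.1 i (σ i) x y = 0 := by
  refine ⟨fun h i => h i (σ i), fun h i j x hx y hy => ?_⟩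
  by_cases hij : j = σ i
  · subst hij
    exact h i x hx y hy
  · rw [β.2.1 i j hij]
    rfl

theorem nondegenerate_smul_flip {i j : I} {b : W i →ₗ[k] W j →ₗ[k] k} (s : ℤˣ)
    (hb : b.Nondegenerate) : (((s : ℤ) : k) • b.flip).Nondegenerate := by
  refine ⟨fun x hx => hb.2 x fun y => ?_, fun x hx => hb.1 x fun y => ?_⟩
  · simpa [signCast_ne_zero (k := k)] using hx y
  · simpa [signCast_ne_zero (k := k)] using hx y

/-- Isotropic subspaces of a non-degenerate graded form satisfy `u + σ(u) ≤ d`. -/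
theorem GradedIsotropic.finrank_add_le {β : gradedForms k W σ ε} {U : ∀ i, Submodule k (W i)}
    (hU : GradedIsotropic β.1 U) (hβ : GradedNondeg σ β.1) (i : I) :
    Module.finrank k (U i) + Module.finrank k (U (σ i)) ≤ Module.finrank k (W (σ i)) :=
  finrank_add_le_of_orthogonal (hβ i).1 fun x hx y hy => hU i (σ i) x hx y hy

/-- The number of non-degenerate symmetric graded forms for which `U` is isotropic. -/
theorem natCard_gradedForms_isotropic (h2 : (2 : k) ≠ 0) (h : SignedInvolution σ ε P)
    (U : ∀ i, Submodule k (W i)) (e : I → ℕ)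
    (he : ∀ i, Module.finrank k (W i) =
      e i + Module.finrank k (U i) + Module.finrank k (U (σ i))) (heσ : ∀ i, e (σ i) = e i) :
    (Nat.card {β : gradedForms k W σ ε // GradedNondeg σ β.1 ∧ GradedIsotropic β.1 U} : ℝ) =
      (∏ i ∈ P, injCard (Nat.card k) (Module.finrank k (U i)) (e i + Module.finrank k (U i)) *
        (glCard (Nat.card k) (e i + Module.finrank k (U (σ i))) * (Nat.card k : ℝ) ^
          ((e i + Module.finrank k (U (σ i))) * Module.finrank k (U i)))) *
      ∏ i with σ i = i, injCard (Nat.card k) (Module.finrank k (U i)) (e i + Module.finrank k (U i)) *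
        (ndCard k (ε i) (e i) * (Nat.card k : ℝ) ^ (e i * Module.finrank k (U i) +
          symDim (ε i) (Module.finrank k (U i)))) := by
  have h1 := natCard_gradedForms (k := k) (W := W) h
    (fun i j b => b.Nondegenerate ∧ ∀ x ∈ U i, ∀ y ∈ U j, b x y = 0)
    (fun i j b hb => ⟨nondegenerate_smul_flip _ hb.1, fun x hx y hy => by simp [hb.2 y hy x hx]⟩)
  have h3 : {β : gradedForms k W σ ε // GradedNondeg σ β.1 ∧ GradedIsotropic β.1 U} ≃
      {β : gradedForms k W σ ε // ∀ i, (β.1 i (σ i)).Nondegenerate ∧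
        ∀ x ∈ U i, ∀ y ∈ U (σ i), β.1 i (σ i) x y = 0} :=
    Equiv.subtypeEquivRight fun β => by
      rw [gradedIsotropic_iff, forall_and]
      rfl
  rw [Nat.card_congr h3, h1]
  push_cast
  congr 1
  · refine Finset.prod_congr rfl fun i _ => ?_
    have hσ := he (σ i)
    rw [h.invol, heσ] at hσ
    have hi := he i
    rw [card_perfect_isotropic (U i) (U (σ i)) (by omega)]
    congr 2
    · omega
    · congr 1; omega
    · congr 2; omega
  · refine Finset.prod_congr rfl fun i hi => ?_
    have hf : σ i = i := by simpa using hi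
    have hi := he i
    rw [hf] at hi
    rw [← card_ndForms_isotropic h2 (ε i) (U i) hi]
    congr 1
    refine Nat.card_congr ((Equiv.subtypeEquivRight fun b => ?_).trans
      (Equiv.subtypeSubtypeEquivSubtypeInter (fun b : symForms k (W i) (ε i) =>
        ∀ x, (∀ y, b.1 x y = 0) → x = 0) (fun b => ∀ x ∈ U i, ∀ y ∈ U i, b.1 x y = 0)).symm)
    refine and_congr_left' ⟨fun hb => hb.1, fun hb => ⟨hb, fun y hy => hb y fun x => ?_⟩⟩
    rw [b.2, hy, mul_zero]

end GradedForms

/-! ### Signed counts of flags of subrepresentations -/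

section Reps

variable {k : Type*} [Field k] {Q₀ Q₁ : Type*} [Fintype Q₀] [DecidableEq Q₀] [Fintype Q₁]
  (Q : InvQuiver Q₀ Q₁) (θ : (Q₀ → ℤ) →ₗ[ℤ] ℤ)
  {V : Q₀ → Type*} [∀ i, AddCommGroup (V i)] [∀ i, Module k (V i)]

variable (k V) in
/-- Representations of the quiver on a fixed graded space. -/
abbrev QRep : Type _ := ∀ a, V (Q.src a) →ₗ[k] V (Q.tgt a)

variable {Q} in
/-- `U` is a subrepresentation. -/
def IsSub (m : QRep k Q V) (U : ∀ i, Submodule k (V i)) : Prop :=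
  ∀ a, ∀ x ∈ U (Q.src a), m a x ∈ U (Q.tgt a)

/-- The dimension vector of a graded subspace. -/
noncomputable def dimSub (U : ∀ i, Submodule k (V i)) : Q₀ → ℕ := fun i => Module.finrank k (U i)

variable {Q} in
/-- `U` is a subrepresentation on which the stability is positive. -/
def IsDestab (m : QRep k Q V) (U : ∀ i, Submodule k (V i)) : Prop :=
  IsSub m U ∧ 0 < θ (toLattice (dimSub U))

variable [Finite k] [∀ i, FiniteDimensional k (V i)]

noncomputable instance fintypeGradedSubmodule : Fintype (∀ i, Submodule k (V i)) :=
  have := fun i => finite_submodule k (V i)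
  Fintype.ofFinite _

noncomputable instance fintypeQRep : Fintype (QRep k Q V) := Fintype.ofFinite _

variable {Q}

theorem dimSub_mono {U W : ∀ i, Submodule k (V i)} (h : U ≤ W) : dimSub U ≤ dimSub W :=
  fun i => Submodule.finrank_mono (h i)

theorem eq_of_le_of_dimSub_eq {U W : ∀ i, Submodule k (V i)} (h : U ≤ W)
    (hd : dimSub U = dimSub W) : U = W :=
  funext fun i => Submodule.eq_of_le_of_finrank_eq (h i) (congrFun hd i)

theorem dimSub_bot : dimSub (⊥ : ∀ i, Submodule k (V i)) = 0 := by
  funext i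
  simp [dimSub]

theorem toLattice_zero : toLattice (0 : Q₀ → ℕ) = 0 := by
  funext i
  simp [toLattice]

theorem not_isDestab_bot (m : QRep k Q V) : ¬ IsDestab θ m ⊥ := fun h => by
  have := h.2
  rw [dimSub_bot, toLattice_zero, map_zero] at this
  exact lt_irrefl _ this

theorem IsSub.congr {m m' : QRep k Q V} {U : ∀ i, Submodule k (V i)}
    (h : ∀ a, ∀ x ∈ U (Q.src a), m a x = m' a x) (hm : IsSub m U) : IsSub m' U :=
  fun a x hx => h a x hx ▸ hm a x hx

/-- The signed count of flags with top `U` depends only on the restriction to `U`. -/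
theorem posetMu_isDestab_congr {m m' : QRep k Q V} {U : ∀ i, Submodule k (V i)}
    (h : ∀ a, ∀ x ∈ U (Q.src a), m a x = m' a x) :
    posetMu (IsDestab θ m) U = posetMu (IsDestab θ m') U := by
  refine posetMu_congr U fun W hW => and_congr_left fun _ => ⟨fun hm => hm.congr ?_, fun hm => hm.congr ?_⟩
  · exact fun a x hx => h a x (hW _ hx)
  · exact fun a x hx => (h a x (hW _ hx)).symm

theorem isSub_of_posetMu_ne_zero {m : QRep k Q V} {U : ∀ i, Submodule k (V i)}
    (h : posetMu (IsDestab θ m) U ≠ 0) : IsSub m U := by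
  by_cases hU : U = ⊥
  · subst hU
    intro a x hx
    have hx : x = 0 := by simpa using hx
    rw [hx, map_zero]
    exact zero_mem _
  · by_contra hc
    exact h (posetMu_of_not hU fun hd => hc hd.1)

/-- The restriction of a representation to a graded subspace. -/
def resTo (U : ∀ i, Submodule k (V i)) (m : QRep k Q V) (a : Q₁) :
    U (Q.src a) →ₗ[k] V (Q.tgt a) := (m a).domRestrict (U (Q.src a))

theorem resTo_eq_iff {U : ∀ i, Submodule k (V i)} {m m' : QRep k Q V} :
    resTo U m = resTo U m' ↔ ∀ a, ∀ x ∈ U (Q.src a), m a x = m' a x := by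
  rw [funext_iff]
  refine forall_congr' fun a => ⟨fun h x hx => LinearMap.congr_fun h ⟨x, hx⟩, fun h => ?_⟩
  ext x
  exact h x x.2

theorem natCard_resTo_eq (U : ∀ i, Submodule k (V i)) (m : QRep k Q V) :
    Nat.card {y : QRep k Q V // resTo U y = resTo U m} = Nat.card k ^ ∑ a,
      (Module.finrank k (V (Q.src a)) - dimSub U (Q.src a)) * Module.finrank k (V (Q.tgt a)) := by
  rw [← Finset.prod_pow_eq_pow_sum]
  refine Eq.trans ?_ (Finset.prod_congr rfl fun a _ =>
    natCard_extensions (U (Q.src a)) (resTo U m a))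
  rw [← Nat.card_pi]
  refine Nat.card_congr ((Equiv.subtypeEquivRight fun y => ?_).trans (Equiv.subtypePiEquivPi
    (p := fun a (y : V (Q.src a) →ₗ[k] V (Q.tgt a)) => y.domRestrict (U (Q.src a)) = resTo U m a)))
  rw [funext_iff]
  rfl

theorem natCard_isSub_resTo_eq {W U : ∀ i, Submodule k (V i)} (hWU : W ≤ U) {m : QRep k Q V}
    (hm : IsSub m W) :
    Nat.card {y : QRep k Q V // IsSub y U ∧ resTo W y = resTo W m} = Nat.card k ^ ∑ a,
      ((dimSub U (Q.src a) - dimSub W (Q.src a)) * dimSub U (Q.tgt a) +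
      (Module.finrank k (V (Q.src a)) - dimSub U (Q.src a)) * Module.finrank k (V (Q.tgt a))) := by
  rw [← Finset.prod_pow_eq_pow_sum]
  refine Eq.trans ?_ (Finset.prod_congr rfl fun a _ =>
    natCard_extensions_mapsTo (hWU (Q.src a)) (U (Q.tgt a)) (resTo W m a)
      fun x => hWU _ (hm a x x.2))
  rw [← Nat.card_pi]
  refine Nat.card_congr ((Equiv.subtypeEquivRight fun y => ?_).trans (Equiv.subtypePiEquivPi
    (p := fun a (y : V (Q.src a) →ₗ[k] V (Q.tgt a)) => y.domRestrict (W (Q.src a)) = resTo W m a ∧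
      ∀ x ∈ U (Q.src a), y x ∈ U (Q.tgt a))))
  rw [funext_iff, forall_and, and_comm]
  rfl

open Classical in
/-- Comparison of the sums of a function over a set and over the whole space, when the function
factors through a map whose fibres have constant size. -/
theorem sum_eq_of_fibers {X R : Type*} [Fintype X] (L : X → Prop) (res : X → R) (F : X → ℝ)
    (hF : ∀ x y, res x = res y → F x = F y) {K N : ℝ} (hN : N ≠ 0)
    (hfull : ∀ x, (Nat.card {y // res y = res x} : ℝ) = N)
    (hL : ∀ y, F y ≠ 0 → (Nat.card {m // L m ∧ res m = res y} : ℝ) = K) :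
    ∑ m with L m, F m = K / N * ∑ y, F y := by
  have h1 : (∑ m with L m, F m) * N = ∑ m with L m, ∑ y with res y = res m, F y := by
    rw [Finset.sum_mul]
    refine Finset.sum_congr rfl fun m _ => ?_
    rw [Finset.sum_congr rfl fun y hy => hF y m (by simpa using hy), Finset.sum_const,
      nsmul_eq_mul, ← hfull m, Nat.card_eq_fintype_card, Fintype.card_subtype, mul_comm]
  have h2 : ∑ m with L m, ∑ y with res y = res m, F y = ∑ y, K * F y := by
    simp only [Finset.sum_filter (s := Finset.univ) (fun y => res y = _)]
    rw [Finset.sum_comm]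
    refine Finset.sum_congr rfl fun y _ => ?_
    by_cases hy : F y = 0
    · simp [hy]
    · rw [← hL y hy, Nat.card_eq_fintype_card, Fintype.card_subtype, ← Finset.sum_filter,
        Finset.filter_filter, Finset.sum_const, nsmul_eq_mul]
      simp only [eq_comm]
  rw [h2, ← Finset.mul_sum] at h1
  field_simp
  linarith

/-- The order of the group `∏ GL(d_i)`. -/
def glDim (q : ℝ) (d : Q₀ → ℕ) : ℝ := ∏ i, glCard q (d i)

theorem glDim_ne_zero {q : ℝ} (hq : 1 < q) (d : Q₀ → ℕ) : glDim q d ≠ 0 :=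
  Finset.prod_ne_zero_iff.2 fun i _ => glCard_ne_zero hq (d i)

/-- The number of graded subspaces of `U` of a given dimension vector. -/
theorem card_gradedSubmodule_mul (U : ∀ i, Submodule k (V i)) {w : Q₀ → ℕ} (hw : w ≤ dimSub U) :
    (Nat.card {W : ∀ i, Submodule k (V i) // W ≤ U ∧ dimSub W = w} : ℝ) * glDim (Nat.card k) w *
      ((Nat.card k : ℝ) ^ (∑ i, w i * (dimSub U i - w i)) * glDim (Nat.card k) (dimSub U - w)) =
      glDim (Nat.card k) (dimSub U) := by
  have e (i) : {W : Submodule k (V i) // W ≤ U i ∧ Module.finrank k W = w i} ≃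
      {W : Submodule k (U i) // Module.finrank k W = w i} :=
    { toFun := fun W => ⟨W.1.comap (U i).subtype, by
        rw [(Submodule.comapSubtypeEquivOfLe W.2.1).finrank_eq, W.2.2]⟩
      invFun := fun W => ⟨W.1.map (U i).subtype, Submodule.map_subtype_le _ _, by
        rw [Submodule.finrank_map_subtype_eq, W.2]⟩
      left_inv := fun W => Subtype.ext (by
        simpa [Submodule.map_comap_subtype] using W.2.1)
      right_inv := fun W => Subtype.ext (Submodule.comap_map_eq_of_injective
        (Submodule.subtype_injective _) _) }
  have e1 : {W : ∀ i, Submodule k (V i) // W ≤ U ∧ dimSub W = w} ≃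
      ∀ i, {W : Submodule k (U i) // Module.finrank k W = w i} :=
    (Equiv.subtypeEquivRight fun W => by
      rw [Pi.le_def, funext_iff, ← forall_and]
      rfl).trans ((Equiv.subtypePiEquivPi (p := fun i (W : Submodule k (V i)) => W ≤ U i ∧
        Module.finrank k W = w i)).trans (Equiv.piCongrRight e))
  rw [Nat.card_congr e1, Nat.card_pi, Nat.cast_prod, ← Finset.prod_pow_eq_pow_sum, glDim, glDim,
    glDim, ← Finset.prod_mul_distrib, ← Finset.prod_mul_distrib, ← Finset.prod_mul_distrib]
  refine Finset.prod_congr rfl fun i _ => ?_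
  have hi : dimSub U i = w i + (dimSub U i - w i) := (Nat.add_sub_cancel' (hw i)).symm
  rw [Pi.sub_apply, card_submodule_mul_glCard hi, ← hi]

open Classical in
/-- Sums over graded subspaces of functions of the dimension vector. -/
theorem sum_gradedSubmodule (S : (∀ i, Submodule k (V i)) → Prop) (D : Finset (Q₀ → ℕ))
    (hS : ∀ W, S W → dimSub W ∈ D) (f : (Q₀ → ℕ) → ℝ) :
    ∑ W with S W, f (dimSub W) = ∑ w ∈ D, Nat.card {W // S W ∧ dimSub W = w} * f w := by
  rw [← Finset.sum_fiberwise_of_maps_to (g := dimSub) (t := D) (fun W hW => hS W (by simpa using hW))]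
  refine Finset.sum_congr rfl fun w _ => ?_
  rw [Finset.sum_congr rfl fun W hW => by rw [(Finset.mem_filter.1 hW).2], Finset.sum_const,
    nsmul_eq_mul, Nat.card_eq_fintype_card, Fintype.card_subtype, Finset.filter_filter]

end Reps

/-! ### Sums over sequences of dimension vectors -/

section Chains

variable {Q₀ Q₁ : Type*} [Fintype Q₀] [DecidableEq Q₀] [Fintype Q₁]
  (Q : InvQuiver Q₀ Q₁) (θ : (Q₀ → ℤ) →ₗ[ℤ] ℤ) (q : ℝ)

theorem slopeDim_pos_iff (d : Q₀ → ℕ) : 0 < slopeDim θ d ↔ 0 < θ (toLattice d) := by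
  by_cases hd : d = 0
  · subst hd
    rw [toLattice_zero, map_zero]
    simp [slopeDim]
  · have : 0 < ∑ i, d i := by
      obtain ⟨i, hi⟩ := Function.ne_iff.1 hd
      exact lt_of_lt_of_le (Nat.pos_of_ne_zero hi) (Finset.single_le_sum (by simp) (Finset.mem_univ i))
    rw [slopeDim, div_pos_iff_of_pos_right (by exact_mod_cast this), Int.cast_pos]

/-- Sequences of non-zero dimension vectors with sum `u` all of whose non-empty partial sums have
positive slope. -/
def chainLists (u : Q₀ → ℕ) : Set (List (Q₀ → ℕ)) :=
  {l | (∀ e ∈ l, e ≠ 0) ∧ l.sum = u ∧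
    ∀ j, 1 ≤ j → j ≤ l.length → 0 < slopeDim θ (l.take j).sum}

/-- The contribution of a single dimension vector: the weighted number of points of the stack of
representations. -/
noncomputable def repWeight (e : Q₀ → ℕ) : ℝ := q ^ (-Q.eulerForm e e) / qPochDim q⁻¹ e

/-- The contribution of a sequence of dimension vectors. -/
noncomputable def chainTerm (l : List (Q₀ → ℕ)) : ℝ :=
  (-1) ^ l.length * q ^ (-Q.eulerSeq l) * (l.map (repWeight Q q)).prod

/-- The sum of the contributions of all sequences in `chainLists θ u`. -/
noncomputable def chainSum (u : Q₀ → ℕ) : ℝ := ∑ᶠ l ∈ chainLists θ u, chainTerm Q q l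

theorem chainLists_zero : chainLists θ (0 : Q₀ → ℕ) = {[]} := by
  ext l
  simp only [chainLists, Set.mem_ofPred_eq, Set.mem_singleton_iff]
  constructor
  · rintro ⟨h1, h2, -⟩
    cases l with
    | nil => rfl
    | cons e l =>
      exfalso
      refine h1 e (by simp) (le_antisymm ?_ bot_le)
      rw [← h2, List.sum_cons]
      exact le_self_add
  · rintro rfl
    refine ⟨by simp, rfl, fun j h1 h2 => ?_⟩
    simp at h2
    omega

theorem chainLists_of_not_pos {u : Q₀ → ℕ} (hu : u ≠ 0) (h : ¬ 0 < θ (toLattice u)) :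
    chainLists θ u = ∅ := by
  ext l
  simp only [Set.mem_empty_iff_false, iff_false]
  rintro ⟨-, h2, h3⟩
  have hl : l ≠ [] := by
    rintro rfl
    exact hu h2.symm
  have := h3 l.length (List.length_pos_iff.2 hl) le_rfl
  rw [List.take_length, h2, slopeDim_pos_iff] at this
  exact h this

theorem chainLists_of_pos {u : Q₀ → ℕ} (hu : u ≠ 0) (h : 0 < θ (toLattice u)) :
    chainLists θ u = ⋃ w ∈ (Finset.Iio u : Set (Q₀ → ℕ)),
      (fun l => l ++ [u - w]) '' chainLists θ w := by
  ext l
  simp only [Set.mem_iUnion, Set.mem_image, Finset.coe_Iio, Set.mem_Iio, exists_prop]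
  constructor
  · rintro ⟨h1, h2, h3⟩
    rcases List.eq_nil_or_concat' l with rfl | ⟨l, e, rfl⟩
    · exact absurd h2.symm hu
    · have he : e ≠ 0 := h1 e (by simp)
      have hs : l.sum + e = u := by simpa using h2
      have hle : l.sum ≤ u := hs ▸ le_self_add
      refine ⟨l.sum, lt_of_le_of_ne hle fun hc => he ?_, l, ⟨fun x hx => h1 x (by simp [hx]), rfl,
        fun j hj1 hj2 => ?_⟩, ?_⟩
      · rw [hc] at hs
        simpa using hs
      · have := h3 j hj1 (by simp; omega)
        rwa [List.take_append_of_le_length hj2] at this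
      · rw [← hs, add_tsub_cancel_left]
  · rintro ⟨w, hw, l, ⟨h1, h2, h3⟩, rfl⟩
    have hs : (l ++ [u - w]).sum = u := by
      rw [List.sum_append, h2, List.sum_singleton, add_tsub_cancel_of_le hw.le]
    refine ⟨fun e he => ?_, hs, fun j hj1 hj2 => ?_⟩
    · rcases List.mem_append.1 he with he | he
      · exact h1 e he
      · rw [List.mem_singleton.1 he]
        intro hc
        exact absurd (tsub_eq_zero_iff_le.1 hc) (not_le_of_gt hw)
    · rcases Nat.lt_or_ge l.length j with hj | hj
      · rw [List.take_of_length_le (by simp; omega), hs, slopeDim_pos_iff]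
        exact h
      · rw [List.take_append_of_le_length hj]
        exact h3 j hj1 hj

theorem chainLists_finite (u : Q₀ → ℕ) : (chainLists θ u).Finite := by
  induction u using WellFoundedLT.induction with
  | _ u ih =>
    by_cases hu : u = 0
    · rw [hu, chainLists_zero]
      exact Set.finite_singleton _
    · by_cases h : 0 < θ (toLattice u)
      · rw [chainLists_of_pos θ hu h]
        exact (Finset.finite_toSet _).biUnion fun w hw => (ih w (by simpa using hw)).image _
      · rw [chainLists_of_not_pos θ hu h]
        exact Set.finite_empty

theorem eulerForm_add_right (d e e' : Q₀ → ℕ) :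
    Q.eulerForm d (e + e') = Q.eulerForm d e + Q.eulerForm d e' := by
  simp only [InvQuiver.eulerForm, Pi.add_apply, Nat.cast_add, mul_add, Finset.sum_add_distrib]
  ring

theorem sum_map_eulerForm (e : Q₀ → ℕ) (l : List (Q₀ → ℕ)) :
    (l.map fun d => Q.eulerForm e d).sum = Q.eulerForm e l.sum := by
  induction l with
  | nil => simp [InvQuiver.eulerForm]
  | cons d l ih => rw [List.map_cons, List.sum_cons, List.sum_cons, ih, eulerForm_add_right]

theorem eulerSeq_concat (l : List (Q₀ → ℕ)) (e : Q₀ → ℕ) :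
    Q.eulerSeq (l ++ [e]) = Q.eulerSeq l + Q.eulerForm e l.sum := by
  induction l with
  | nil => simp [InvQuiver.eulerSeq, InvQuiver.eulerForm]
  | cons d l ih =>
    rw [List.cons_append, InvQuiver.eulerSeq, ih, InvQuiver.eulerSeq, List.map_append,
      List.sum_append, List.map_singleton, List.sum_singleton, List.sum_cons, eulerForm_add_right]
    ring

variable {q}

theorem chainTerm_concat (hq : q ≠ 0) (l : List (Q₀ → ℕ)) (e : Q₀ → ℕ) :
    chainTerm Q q (l ++ [e]) =
      -(q ^ (-Q.eulerForm e l.sum) * repWeight Q q e) * chainTerm Q q l := by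
  simp only [chainTerm, eulerSeq_concat, List.length_append, List.length_singleton,
    List.map_append, List.map_singleton, List.prod_append, List.prod_singleton, pow_succ, neg_add,
    zpow_add₀ hq]
  ring

variable (q) in
theorem chainSum_zero : chainSum Q θ q 0 = 1 := by
  rw [chainSum, chainLists_zero, finsum_mem_singleton]
  simp [chainTerm, InvQuiver.eulerSeq]

variable (q) in
theorem chainSum_of_not_pos {u : Q₀ → ℕ} (hu : u ≠ 0) (h : ¬ 0 < θ (toLattice u)) :
    chainSum Q θ q u = 0 := by
  rw [chainSum, chainLists_of_not_pos θ hu h, finsum_mem_empty]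

/-- The recursion that splits off the last member of a sequence. -/
theorem chainSum_of_pos (hq : q ≠ 0) {u : Q₀ → ℕ} (hu : u ≠ 0) (h : 0 < θ (toLattice u)) :
    chainSum Q θ q u = -∑ w ∈ Finset.Iio u,
      q ^ (-Q.eulerForm (u - w) w) * repWeight Q q (u - w) * chainSum Q θ q w := by
  rw [chainSum, chainLists_of_pos θ hu h, finsum_mem_biUnion, finsum_mem_coe_finset,
    ← Finset.sum_neg_distrib]
  · refine Finset.sum_congr rfl fun w _ => ?_
    rw [finsum_mem_image (fun l _ l' _ hl => List.append_cancel_right hl), chainSum,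
      ← neg_mul, mul_finsum_mem]
    refine finsum_mem_congr rfl fun l hl => ?_
    rw [chainTerm_concat Q hq, hl.2.1]
  · intro w _ w' _ hne
    rw [Function.onFun, Set.disjoint_left]
    rintro _ ⟨l, hl, rfl⟩ ⟨l', hl', he⟩
    have h1 := (List.append_inj' he rfl).1
    exact hne (by rw [← hl.2.1, ← hl'.2.1, h1])
  · exact Finset.finite_toSet _
  · exact fun w _ => (chainLists_finite θ w).image _

theorem glDim_eq (hq : q ≠ 0) (d : Q₀ → ℕ) :
    glDim q d = q ^ (∑ i, d i * d i) * qPochDim q⁻¹ d := by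
  rw [glDim, qPochDim, ← Finset.prod_pow_eq_pow_sum, ← Finset.prod_mul_distrib]
  exact Finset.prod_congr rfl fun i _ => glCard_eq_qPoch hq (d i)

/-- The weight of a dimension vector as the number of representations divided by the order of the
group. -/
theorem repWeight_eq (hq : 1 < q) (e : Q₀ → ℕ) :
    repWeight Q q e = q ^ (∑ a, e (Q.src a) * e (Q.tgt a)) / glDim q e := by
  have h0 : q ≠ 0 := by positivity
  have h1 : -Q.eulerForm e e = ((∑ a, e (Q.src a) * e (Q.tgt a) : ℕ) : ℤ)
      - ((∑ i, e i * e i : ℕ) : ℤ) := by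
    rw [InvQuiver.eulerForm]
    push_cast
    ring
  rw [repWeight, h1, zpow_sub₀ h0, zpow_natCast, zpow_natCast, glDim_eq h0, div_div]

end Chains

section ChainCount

variable {k : Type*} [Field k] [Finite k] {Q₀ Q₁ : Type*} [Fintype Q₀] [DecidableEq Q₀] [Fintype Q₁]
  {Q : InvQuiver Q₀ Q₁} (θ : (Q₀ → ℤ) →ₗ[ℤ] ℤ)
  {V : Q₀ → Type*} [∀ i, AddCommGroup (V i)] [∀ i, Module k (V i)] [∀ i, FiniteDimensional k (V i)]

/-- The dimension of the space of families of linear maps with given restrictions to subspaces of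
dimension vector `u`. -/
def resDim (Q : InvQuiver Q₀ Q₁) (v u : Q₀ → ℕ) : ℕ :=
  ∑ a, (v (Q.src a) - u (Q.src a)) * v (Q.tgt a)

open Classical in
/-- The signed count of flags with top `W`, summed over the representations which preserve `U` and
over all representations. -/
theorem sum_isSub_posetMu {W U : ∀ i, Submodule k (V i)} (hWU : W ≤ U) :
    ∑ y : QRep k Q V with IsSub y U, (posetMu (IsDestab θ y) W : ℝ) =
      (Nat.card k : ℝ) ^ (resDim Q (dimSub U) (dimSub W) +
        resDim Q (fun i => Module.finrank k (V i)) (dimSub U)) /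
      (Nat.card k : ℝ) ^ resDim Q (fun i => Module.finrank k (V i)) (dimSub W) *
        ∑ y : QRep k Q V, (posetMu (IsDestab θ y) W : ℝ) := by
  have hq := one_lt_natCard k
  refine sum_eq_of_fibers (fun y => IsSub y U) (resTo W)
    (fun y => (posetMu (IsDestab θ y) W : ℝ)) (fun x y hxy => ?_) (by positivity) (fun x => ?_)
    (fun y hy => ?_)
  · rw [posetMu_isDestab_congr θ (resTo_eq_iff.1 hxy)]
  · rw [natCard_resTo_eq]
    push_cast
    rfl
  · rw [natCard_isSub_resTo_eq hWU (isSub_of_posetMu_ne_zero θ (by exact_mod_cast hy)),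
      Finset.sum_add_distrib]
    push_cast
    rfl

/-- The total signed count of flags of subrepresentations with top `U` and positive slopes, over
all representations on a graded space. -/
theorem sum_posetMu_isDestab (U : ∀ i, Submodule k (V i)) :
    ∑ y : QRep k Q V, (posetMu (IsDestab θ y) U : ℝ) =
      (Nat.card k : ℝ) ^ resDim Q (fun i => Module.finrank k (V i)) (dimSub U) *
        (glDim (Nat.card k) (dimSub U) * chainSum Q θ (Nat.card k) (dimSub U)) := by
  classical
  have hq := one_lt_natCard k
  have hq0 : (Nat.card k : ℝ) ≠ 0 := by positivity
  induction U using WellFoundedLT.induction with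
  | _ U ih =>
    by_cases hU : U = ⊥
    · subst hU
      simp only [posetMu_bot, dimSub_bot, chainSum_zero]
      have h1 := natCard_resTo_eq (⊥ : ∀ i, Submodule k (V i)) (0 : QRep k Q V)
      have h2 : Nat.card {y : QRep k Q V // resTo ⊥ y = resTo ⊥ 0} = Nat.card (QRep k Q V) :=
        Nat.card_congr (Equiv.subtypeUnivEquiv fun y => resTo_eq_iff.2 fun a x hx => by
          have hx : x = 0 := by simpa using hx
          rw [hx, map_zero, map_zero])
      rw [h2, dimSub_bot] at h1
      rw [Int.cast_one, Finset.sum_const, nsmul_eq_mul, Finset.card_univ, ← Nat.card_eq_fintype_card,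
        h1]
      simp [glDim, glCard, injCard, resDim]
    · have hd : dimSub U ≠ 0 := fun h =>
        hU (eq_of_le_of_dimSub_eq (bot_le (a := U)) (by rw [dimSub_bot, h])).symm
      by_cases hp : 0 < θ (toLattice (dimSub U))
      · have h1 (y : QRep k Q V) : (posetMu (IsDestab θ y) U : ℝ) =
            if IsSub y U then -∑ W with W < U, (posetMu (IsDestab θ y) W : ℝ) else 0 := by
          split_ifs with hs
          · rw [posetMu_of_pos hU ⟨hs, hp⟩]
            push_cast
            rfl
          · rw [posetMu_of_not hU fun h => hs h.1, Int.cast_zero]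
        simp only [h1]
        rw [← Finset.sum_filter, Finset.sum_neg_distrib, Finset.sum_comm,
          chainSum_of_pos Q θ hq0 hd hp]
        have h2 (W) (hW : W ∈ Finset.univ.filter fun W => W < U) :
            ∑ y : QRep k Q V with IsSub y U, (posetMu (IsDestab θ y) W : ℝ) =
            (Nat.card k : ℝ) ^ (resDim Q (dimSub U) (dimSub W) +
              resDim Q (fun i => Module.finrank k (V i)) (dimSub U)) *
            (glDim (Nat.card k) (dimSub W) * chainSum Q θ (Nat.card k) (dimSub W)) := by
          have hW : W < U := by simpa using hW
          rw [sum_isSub_posetMu θ hW.le, ih W hW]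
          field_simp
        rw [Finset.sum_congr rfl h2, sum_gradedSubmodule (fun W => W < U) (Finset.Iio (dimSub U))
          (fun W hW => Finset.mem_Iio.2 (lt_of_le_of_ne (dimSub_mono hW.le) fun h =>
            hW.ne (eq_of_le_of_dimSub_eq hW.le h))) (fun w => (Nat.card k : ℝ) ^
              (resDim Q (dimSub U) w + resDim Q (fun i => Module.finrank k (V i)) (dimSub U)) *
            (glDim (Nat.card k) w * chainSum Q θ (Nat.card k) w)), mul_neg, mul_neg, neg_inj,
          Finset.mul_sum, Finset.mul_sum]
        refine Finset.sum_congr rfl fun w hw => ?_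
        have hw : w < dimSub U := Finset.mem_Iio.1 hw
        have h3 : Nat.card {W : ∀ i, Submodule k (V i) // W < U ∧ dimSub W = w} =
            Nat.card {W : ∀ i, Submodule k (V i) // W ≤ U ∧ dimSub W = w} :=
          Nat.card_congr (Equiv.subtypeEquivRight fun W => and_congr_left fun hWw =>
            ⟨fun h => h.le, fun h => lt_of_le_of_ne h fun he => hw.ne (by rw [← hWw, he])⟩)
        have h4 := card_gradedSubmodule_mul U hw.le
        have h5 : (Nat.card k : ℝ) ^ resDim Q (dimSub U) w =
            (Nat.card k : ℝ) ^ (-Q.eulerForm (dimSub U - w) w) *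
            ((Nat.card k : ℝ) ^ (∑ i, w i * (dimSub U i - w i)) *
            (Nat.card k : ℝ) ^ (∑ a, (dimSub U - w) (Q.src a) * (dimSub U - w) (Q.tgt a))) := by
          rw [← pow_add, ← zpow_natCast, ← zpow_natCast, ← zpow_add₀ hq0]
          congr 1
          have h6 (i) : (dimSub U i : ℤ) = (dimSub U - w) i + w i := by
            rw [Pi.sub_apply, Nat.cast_sub (hw.le i)]
            ring
          have h7 (i) : dimSub U i - w i = (dimSub U - w) i := rfl
          simp only [resDim, InvQuiver.eulerForm, h7]
          push_cast
          simp only [h6, mul_add, Finset.sum_add_distrib, mul_comm (w _ : ℤ)]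
          ring
        rw [h3, ← h4, repWeight_eq Q hq, pow_add, h5]
        have h8 := glDim_ne_zero hq (dimSub U - w)
        field_simp
      · rw [chainSum_of_not_pos Q θ _ hd hp]
        rw [mul_zero, mul_zero]
        exact Finset.sum_eq_zero fun y _ => by
          rw [posetMu_of_not hU fun h : IsDestab θ y U => hp h.2, Int.cast_zero]

end ChainCount

/-! ### Self-dual structures with a fixed form -/

section SelfDual

variable {k : Type*} [Field k] {Q₀ Q₁ : Type*} [Fintype Q₀] [DecidableEq Q₀] [Fintype Q₁]
  [DecidableEq Q₁] {Q : InvQuiver Q₀ Q₁} (D : DualityStructure Q) (P : PositivePart Q)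
  (θ : (Q₀ → ℤ) →ₗ[ℤ] ℤ)
  {V : Q₀ → Type*} [∀ i, AddCommGroup (V i)] [∀ i, Module k (V i)]

theorem PositivePart.signedInvolution_nodes : SignedInvolution Q.σ₀ D.s P.nodes :=
  ⟨Q.σ₀_invol, D.s_σ, P.fixed_node, P.swap_node⟩

/-- The sign of the bilinear form `⟨m_a x, y⟩` attached to an arrow `a`. -/
def DualityStructure.arrowSign (a : Q₁) : ℤˣ := D.τ a * D.s (Q.src a)

theorem DualityStructure.arrowSign_σ (a : Q₁) : D.arrowSign (Q.σ₁ a) = D.arrowSign a := by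
  have h := D.τ_mul a
  rw [DualityStructure.arrowSign, DualityStructure.arrowSign, Q.src_σ, D.s_σ]
  generalize D.τ a = x at *
  generalize D.τ (Q.σ₁ a) = y at *
  generalize D.s (Q.src a) = z at *
  generalize D.s (Q.tgt a) = w at *
  revert x y z w
  decide

theorem PositivePart.signedInvolution_arrows :
    SignedInvolution Q.σ₁ D.arrowSign P.arrows :=
  ⟨Q.σ₁_invol, D.arrowSign_σ, P.fixed_arrow, P.swap_arrow⟩

/-- Compatibility of a form and the structure maps of a representation. -/
def Compat (b : ∀ i j, V i →ₗ[k] V j →ₗ[k] k) (m : QRep k Q V) : Prop :=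
  ∀ a (x : V (Q.src a)) (x' : V (Q.src (Q.σ₁ a))),
    b (Q.tgt a) (Q.src (Q.σ₁ a)) (m a x) x' =
      ((D.τ a : ℤ) : k) * b (Q.src a) (Q.tgt (Q.σ₁ a)) x (m (Q.σ₁ a) x')

/-- The bilinear forms `⟨m_a x, y⟩` on `V (src a) × V (src (σ a))`. -/
def arrowForm (b : ∀ i j, V i →ₗ[k] V j →ₗ[k] k) (m : QRep k Q V) :
    ∀ a c, V (Q.src a) →ₗ[k] V (Q.src c) →ₗ[k] k :=
  fun a c => if c = Q.σ₁ a then (b (Q.tgt a) (Q.src c)).comp (m a) else 0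

theorem arrowForm_apply (b : ∀ i j, V i →ₗ[k] V j →ₗ[k] k) (m : QRep k Q V) {a c : Q₁}
    (h : c = Q.σ₁ a) (x : V (Q.src a)) (y : V (Q.src c)) :
    arrowForm b m a c x y = b (Q.tgt a) (Q.src c) (m a x) y := by
  rw [arrowForm, if_pos h]
  rfl

theorem arrowForm_of_ne (b : ∀ i j, V i →ₗ[k] V j →ₗ[k] k) (m : QRep k Q V) {a c : Q₁}
    (h : c ≠ Q.σ₁ a) : arrowForm b m a c = 0 := by
  rw [arrowForm, if_neg h]

variable {D}

theorem compat_iff (b : gradedForms k V Q.σ₀ D.s) (m : QRep k Q V) :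
    Compat D b.1 m ↔ arrowForm b.1 m ∈
      gradedForms k (fun a => V (Q.src a)) Q.σ₁ D.arrowSign := by
  have key (a : Q₁) (x : V (Q.src a)) (x' : V (Q.src (Q.σ₁ a))) :
      ((D.arrowSign a : ℤ) : k) * arrowForm b.1 m (Q.σ₁ a) a x' x =
        ((D.τ a : ℤ) : k) * b.1 (Q.src a) (Q.tgt (Q.σ₁ a)) x (m (Q.σ₁ a) x') := by
    have hs : D.s (Q.tgt (Q.σ₁ a)) = D.s (Q.src a) := by rw [Q.tgt_σ, D.s_σ]
    rw [arrowForm_apply _ _ (Q.σ₁_invol a).symm, b.2.2, hs, DualityStructure.arrowSign,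
      Units.val_mul, Int.cast_mul, mul_assoc, signCast_mul_cancel]
  constructor
  · intro h
    refine ⟨fun a c hac => arrowForm_of_ne _ _ hac, fun a c x y => ?_⟩
    by_cases hac : c = Q.σ₁ a
    · subst hac
      rw [key, arrowForm_apply _ _ rfl]
      exact h a x y
    · rw [arrowForm_of_ne _ _ hac, arrowForm_of_ne _ _ fun e => hac (by rw [e, Q.σ₁_invol])]
      simp
  · intro h a x x'
    rw [← key, ← arrowForm_apply _ _ rfl]
    exact h.2 a (Q.σ₁ a) x x'

theorem GradedNondeg.arrow {b : ∀ i j, V i →ₗ[k] V j →ₗ[k] k} (hb : GradedNondeg Q.σ₀ b) (a : Q₁) :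
    (b (Q.tgt a) (Q.src (Q.σ₁ a))).Nondegenerate := by
  rw [Q.src_σ]
  exact hb _

variable [∀ i, FiniteDimensional k (V i)]

theorem bijective_of_nondegenerate {E F : Type*} [AddCommGroup E] [Module k E]
    [FiniteDimensional k E] [AddCommGroup F] [Module k F] [FiniteDimensional k F]
    {b : E →ₗ[k] F →ₗ[k] k} (hb : b.Nondegenerate) : Function.Bijective b := by
  have h1 : Function.Injective b := by
    rw [← LinearMap.ker_eq_bot, ← LinearMap.separatingLeft_iff_ker_eq_bot]
    exact hb.1
  have h2 : Function.Injective b.flip := by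
    rw [← LinearMap.ker_eq_bot, ← LinearMap.separatingRight_iff_flip_ker_eq_bot]
    exact hb.2
  have h3 := LinearMap.finrank_le_finrank_of_injective h1
  have h4 := LinearMap.finrank_le_finrank_of_injective h2
  have h5 : Module.finrank k (F →ₗ[k] k) = Module.finrank k F := Subspace.dual_finrank_eq
  have h6 : Module.finrank k (E →ₗ[k] k) = Module.finrank k E := Subspace.dual_finrank_eq
  exact ⟨h1, (LinearMap.injective_iff_surjective_of_finrank_eq_finrank (by omega)).1 h1⟩

/-- For a fixed non-degenerate form, compatible structure maps correspond to symmetric forms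
graded by the arrows. -/
noncomputable def compatEquiv (b : gradedForms k V Q.σ₀ D.s) (hb : GradedNondeg Q.σ₀ b.1) :
    {m : QRep k Q V // Compat D b.1 m} ≃
      gradedForms k (fun a => V (Q.src a)) Q.σ₁ D.arrowSign :=
  Equiv.ofBijective (fun m => ⟨arrowForm b.1 m.1, (compat_iff b m.1).1 m.2⟩) (by
    constructor
    · intro m m' h
      apply Subtype.ext
      funext a
      ext x
      apply (bijective_of_nondegenerate (hb.arrow a)).1
      ext y
      have h1 := congrFun (congrFun (congrArg Subtype.val h) a) (Q.σ₁ a)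
      have h2 := LinearMap.congr_fun (LinearMap.congr_fun h1 x) y
      rwa [arrowForm_apply _ _ rfl, arrowForm_apply _ _ rfl] at h2
    · intro β
      let e (a : Q₁) := LinearEquiv.ofBijective _ (bijective_of_nondegenerate (hb.arrow a))
      let m : QRep k Q V := fun a => (e a).symm.toLinearMap ∘ₗ β.1 a (Q.σ₁ a)
      have hm : arrowForm b.1 m = β.1 := by
        funext a c
        by_cases h : c = Q.σ₁ a
        · subst h
          refine LinearMap.ext₂ fun x y => ?_
          rw [arrowForm_apply _ _ rfl]
          exact LinearMap.congr_fun ((e a).apply_symm_apply (β.1 a (Q.σ₁ a) x)) y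
        · rw [arrowForm_of_ne _ _ h, β.2.1 a c h]
      exact ⟨⟨m, (compat_iff b m).2 (hm ▸ β.2)⟩, Subtype.ext hm⟩)

theorem compatEquiv_val (b : gradedForms k V Q.σ₀ D.s) (hb : GradedNondeg Q.σ₀ b.1)
    (m : {m : QRep k Q V // Compat D b.1 m}) : (compatEquiv b hb m).1 = arrowForm b.1 m.1 := rfl

variable [Finite k]

/-- Every representation on an isotropic graded subspace extends to a self-dual one. -/
theorem exists_compat_extension (b : gradedForms k V Q.σ₀ D.s) (hb : GradedNondeg Q.σ₀ b.1)
    {U : ∀ i, Submodule k (V i)} (hU : GradedIsotropic b.1 U) {g : QRep k Q V} (hg : IsSub g U) :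
    ∃ m : QRep k Q V, Compat D b.1 m ∧ resTo U m = resTo U g := by
  choose C hC using fun i => (U i).exists_isCompl
  let π (i) : V i →ₗ[k] V i := LinearMap.ofIsCompl (hC i) (U i).subtype 0
  have hπ (i) (x : V i) (hx : x ∈ U i) : π i x = x :=
    LinearMap.ofIsCompl_apply_left (hC i) ⟨x, hx⟩
  have hπU (i) (x : V i) : π i x ∈ U i := by
    obtain ⟨⟨u, c⟩, rfl⟩ := (Submodule.prodEquivOfIsCompl _ _ (hC i)).surjective x
    simp [π]
  let φ := arrowForm b.1 (fun a => g a ∘ₗ π (Q.src a) : QRep k Q V)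
  have hφ (a c) (hac : c ≠ Q.σ₁ a) : φ a c = 0 := arrowForm_of_ne _ _ hac
  -- the symmetrization of `φ` agrees with `φ` on `U` because `U` is isotropic
  let β : ∀ a c, V (Q.src a) →ₗ[k] V (Q.src c) →ₗ[k] k := fun a c =>
    φ a c + ((D.arrowSign a : ℤ) : k) • (φ c a).flip
  have hβ : β ∈ gradedForms k (fun a => V (Q.src a)) Q.σ₁ D.arrowSign := by
    refine ⟨fun a c hac => ?_, fun a c x y => ?_⟩
    · refine LinearMap.ext₂ fun x y => ?_
      simp [β, hφ a c hac, hφ c a fun e => hac (by rw [e, Q.σ₁_invol])]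
    · by_cases hac : c = Q.σ₁ a
      · have hs : D.arrowSign c = D.arrowSign a := by rw [hac, D.arrowSign_σ]
        simp only [β, LinearMap.add_apply, LinearMap.smul_apply, LinearMap.flip_apply, smul_eq_mul,
          mul_add, hs, signCast_mul_cancel]
        ring
      · simp [β, hφ a c hac, hφ c a fun e => hac (by rw [e, Q.σ₁_invol])]
  obtain ⟨m, hm⟩ := (compatEquiv b hb).surjective ⟨β, hβ⟩
  refine ⟨m.1, m.2, resTo_eq_iff.2 fun a x hx => ?_⟩
  apply (bijective_of_nondegenerate (hb.arrow a)).1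
  ext y
  have h1 := congrFun (congrFun (congrArg Subtype.val hm) a) (Q.σ₁ a)
  have h2 := LinearMap.congr_fun (LinearMap.congr_fun h1 x) y
  rw [compatEquiv_val, arrowForm_apply _ _ rfl] at h2
  rw [h2]
  have h3 : φ a (Q.σ₁ a) x y = b.1 (Q.tgt a) (Q.src (Q.σ₁ a)) (g a x) y := by
    simp only [φ]
    rw [arrowForm_apply _ _ rfl, LinearMap.comp_apply, hπ _ x hx]
  have h4 : φ (Q.σ₁ a) a y x = 0 := by
    simp only [φ]
    rw [arrowForm_apply _ _ (Q.σ₁_invol a).symm, LinearMap.comp_apply]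
    exact hU _ _ _ (hg _ _ (hπU _ y)) _ hx
  simp [β, h3, h4]

/-- The number of self-dual extensions of a representation on an isotropic graded subspace does not
depend on the representation. -/
theorem natCard_compat_resTo_eq (h2 : (2 : k) ≠ 0) (b : gradedForms k V Q.σ₀ D.s)
    (hb : GradedNondeg Q.σ₀ b.1) {U : ∀ i, Submodule k (V i)} (hU : GradedIsotropic b.1 U)
    {g : QRep k Q V} (hg : IsSub g U) :
    Nat.card {m : QRep k Q V // Compat D b.1 m ∧ resTo U m = resTo U g} =
      Nat.card k ^ gradedDim Q.σ₁ D.arrowSign P.arrows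
        (fun a => Module.finrank k (V (Q.src a)) - dimSub U (Q.src a)) := by
  obtain ⟨m₁, hm₁, hr⟩ := exists_compat_extension b hb hU hg
  rw [← hr]
  refine Eq.trans ?_ (natCard_gradedForms_vanishing h2 (P.signedInvolution_arrows D)
    (fun a => U (Q.src a)))
  let e := compatEquiv b hb
  refine Nat.card_congr ((Equiv.subtypeSubtypeEquivSubtypeInter (Compat D b.1)
    (fun m => resTo U m = resTo U m₁)).symm.trans
    (Equiv.subtypeEquiv (e.trans (gradedFormsShift (e ⟨m₁, hm₁⟩))) fun m => ?_))
  rw [resTo_eq_iff]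
  have h1 (a x y) : ((e.trans (gradedFormsShift (e ⟨m₁, hm₁⟩))) m).1 a (Q.σ₁ a) x y =
      b.1 (Q.tgt a) (Q.src (Q.σ₁ a)) (m.1 a x) y - b.1 (Q.tgt a) (Q.src (Q.σ₁ a)) (m₁ a x) y := by
    rw [← arrowForm_apply _ _ rfl, ← arrowForm_apply _ _ rfl]
    rfl
  simp only [h1, sub_eq_zero]
  refine forall_congr' fun a => forall_congr' fun x => forall_congr' fun hx =>
    ⟨fun h y => by rw [h], fun h => ?_⟩
  apply (bijective_of_nondegenerate (hb.arrow a)).1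
  ext y
  exact h y

open Classical in
/-- The signed count of flags with top `U`, summed over all structure maps compatible with a form for
which `U` is isotropic. -/
theorem sum_compat_posetMu (h2 : (2 : k) ≠ 0) (b : gradedForms k V Q.σ₀ D.s)
    (hb : GradedNondeg Q.σ₀ b.1) {U : ∀ i, Submodule k (V i)} (hU : GradedIsotropic b.1 U) :
    ∑ m : QRep k Q V with Compat D b.1 m, (posetMu (IsDestab θ m) U : ℝ) =
      (Nat.card k : ℝ) ^ gradedDim Q.σ₁ D.arrowSign P.arrows
        (fun a => Module.finrank k (V (Q.src a)) - dimSub U (Q.src a)) *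
      (glDim (Nat.card k) (dimSub U) * chainSum Q θ (Nat.card k) (dimSub U)) := by
  have hq := one_lt_natCard k
  have h1 := sum_eq_of_fibers (fun m : QRep k Q V => Compat D b.1 m) (resTo U)
    (fun y => (posetMu (IsDestab θ y) U : ℝ))
    (fun x y hxy => by rw [posetMu_isDestab_congr θ (resTo_eq_iff.1 hxy)])
    (N := (Nat.card k : ℝ) ^ resDim Q (fun i => Module.finrank k (V i)) (dimSub U)) (by positivity)
    (fun x => by
      rw [natCard_resTo_eq]
      push_cast
      rfl)
    (fun y hy => by
      rw [natCard_compat_resTo_eq P h2 b hb hU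
        (isSub_of_posetMu_ne_zero θ (by exact_mod_cast hy)), Nat.cast_pow])
  rw [h1, sum_posetMu_isDestab]
  field_simp

end SelfDual

/-! ### The indicator function of semistability -/

section Indicator

variable {k : Type*} [Field k] {Q₀ Q₁ : Type*} [Fintype Q₀] [DecidableEq Q₀] [Fintype Q₁]
  [DecidableEq Q₁] {Q : InvQuiver Q₀ Q₁} {D : DualityStructure Q}
  (θ : (Q₀ → ℤ) →ₗ[ℤ] ℤ)
  {V : Q₀ → Type*} [∀ i, AddCommGroup (V i)] [∀ i, Module k (V i)]

/-- The orthogonal of a graded subspace. -/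
def gradedPerp (b : ∀ i j, V i →ₗ[k] V j →ₗ[k] k) (U : ∀ i, Submodule k (V i)) (i : Q₀) :
    Submodule k (V i) where
  carrier := {x | ∀ j, ∀ y ∈ U j, b i j x y = 0}
  add_mem' hx hy j z hz := by rw [map_add, LinearMap.add_apply, hx j z hz, hy j z hz, add_zero]
  zero_mem' j z hz := by simp
  smul_mem' c x hx j z hz := by rw [map_smul, LinearMap.smul_apply, hx j z hz, smul_zero]

/-- Every non-zero isotropic subrepresentation has non-positive slope. -/
def NoDestab (b : ∀ i j, V i →ₗ[k] V j →ₗ[k] k) (m : QRep k Q V) : Prop :=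
  ∀ U, GradedIsotropic b U → ¬ IsDestab θ m U

theorem GradedIsotropic.le_perp {b : ∀ i j, V i →ₗ[k] V j →ₗ[k] k} {U : ∀ i, Submodule k (V i)}
    (hU : GradedIsotropic b U) : U ≤ gradedPerp b U := fun i x hx j y hy => hU i j x hx y hy

theorem GradedIsotropic.mono {b : ∀ i j, V i →ₗ[k] V j →ₗ[k] k} {U W : ∀ i, Submodule k (V i)}
    (hW : GradedIsotropic b W) (h : U ≤ W) : GradedIsotropic b U :=
  fun i j x hx y hy => hW i j x (h i hx) y (h j hy)

theorem gradedIsotropic_bot (b : ∀ i j, V i →ₗ[k] V j →ₗ[k] k) : GradedIsotropic b ⊥ := by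
  intro i j x hx y _
  have hx : x = 0 := by simpa using hx
  simp [hx]

theorem IsSub.inf {m : QRep k Q V} {U W : ∀ i, Submodule k (V i)} (hU : IsSub m U)
    (hW : IsSub m W) : IsSub m (U ⊓ W) := fun a x hx => ⟨hU a x hx.1, hW a x hx.2⟩

theorem IsSub.sup {m : QRep k Q V} {U W : ∀ i, Submodule k (V i)} (hU : IsSub m U)
    (hW : IsSub m W) : IsSub m (U ⊔ W) := by
  intro a x hx
  obtain ⟨u, hu, w, hw, rfl⟩ := Submodule.mem_sup.1 hx
  rw [map_add]
  exact Submodule.add_mem_sup (hU a u hu) (hW a w hw)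

theorem IsSub.perp {b : gradedForms k V Q.σ₀ D.s} {m : QRep k Q V} (hm : Compat D b.1 m)
    {W : ∀ i, Submodule k (V i)} (hW : IsSub m W) : IsSub m (gradedPerp b.1 W) := by
  intro a x hx j y hy
  by_cases hj : j = Q.src (Q.σ₁ a)
  · subst hj
    rw [hm a x y, hx _ _ (hW _ y hy), mul_zero]
  · rw [b.2.1 _ _ fun e => hj (by rw [e, Q.src_σ])]
    rfl

/-- The sum of `W` and an isotropic subspace of its orthogonal is isotropic. -/
theorem GradedIsotropic.sup {b : gradedForms k V Q.σ₀ D.s} {U W : ∀ i, Submodule k (V i)}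
    (hW : GradedIsotropic b.1 W) (hU : GradedIsotropic b.1 U) (h : U ≤ gradedPerp b.1 W) :
    GradedIsotropic b.1 (W ⊔ U) := by
  intro i j x hx y hy
  obtain ⟨w, hw, u, hu, rfl⟩ := Submodule.mem_sup.1 hx
  obtain ⟨w', hw', u', hu', rfl⟩ := Submodule.mem_sup.1 hy
  have h1 : b.1 i j w u' = 0 := by rw [b.2.2, h j hu' i w hw, mul_zero]
  simp [hW i j w hw w' hw', hU i j u hu u' hu', h1, h i hu j w' hw']

variable [∀ i, FiniteDimensional k (V i)] [Finite k]

/-- The pairing between `U` and `W` identifies `U / (U ∩ W^⊥)` with the dual of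
`W / (W ∩ U^⊥)`. -/
theorem finrank_inf_perp (b : gradedForms k V Q.σ₀ D.s) (U W : ∀ i, Submodule k (V i)) (i : Q₀) :
    dimSub (U ⊓ gradedPerp b.1 W) i + dimSub W (Q.σ₀ i) =
      dimSub (W ⊓ gradedPerp b.1 U) (Q.σ₀ i) + dimSub U i := by
  let β := (b.1 i (Q.σ₀ i)).domRestrict₁₂ (U i) (W (Q.σ₀ i))
  have h1 : (U ⊓ gradedPerp b.1 W) i = (LinearMap.ker β).map (U i).subtype := by
    ext x
    simp only [Pi.inf_apply, Submodule.mem_inf, Submodule.mem_map, LinearMap.mem_ker]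
    constructor
    · rintro ⟨hx, hp⟩
      refine ⟨⟨x, hx⟩, ?_, rfl⟩
      ext y
      exact hp (Q.σ₀ i) (y : V (Q.σ₀ i)) y.2
    · rintro ⟨x, hx, rfl⟩
      refine ⟨x.2, fun j y hy => ?_⟩
      by_cases hj : j = Q.σ₀ i
      · subst hj
        exact LinearMap.congr_fun hx ⟨y, hy⟩
      · rw [b.2.1 i j hj]
        rfl
  have h2 : (W ⊓ gradedPerp b.1 U) (Q.σ₀ i) = (LinearMap.ker β.flip).map (W (Q.σ₀ i)).subtype := by
    ext x
    simp only [Pi.inf_apply, Submodule.mem_inf, Submodule.mem_map, LinearMap.mem_ker]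
    constructor
    · rintro ⟨hx, hp⟩
      refine ⟨⟨x, hx⟩, ?_, rfl⟩
      ext y
      have := hp i (y : V i) y.2
      rw [b.2.2, mul_eq_zero] at this
      exact this.resolve_left (signCast_ne_zero _)
    · rintro ⟨x, hx, rfl⟩
      refine ⟨x.2, fun j y hy => ?_⟩
      by_cases hj : j = i
      · subst hj
        rw [b.2.2]
        have := LinearMap.congr_fun hx ⟨y, hy⟩
        exact mul_eq_zero_of_right _ this
      · rw [b.2.1 _ j fun e => hj (by rw [e, Q.σ₀_invol])]
        rfl
  simp only [dimSub]
  rw [h1, h2, Submodule.finrank_map_subtype_eq, Submodule.finrank_map_subtype_eq]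
  exact finrank_ker_add β

theorem theta_sup_add_inf (U W : ∀ i, Submodule k (V i)) :
    θ (toLattice (dimSub (W ⊔ U))) + θ (toLattice (dimSub (W ⊓ U))) =
      θ (toLattice (dimSub W)) + θ (toLattice (dimSub U)) := by
  rw [← map_add, ← map_add]
  congr 1
  funext i
  have := Submodule.finrank_sup_add_finrank_inf_eq (W i) (U i)
  simp only [Pi.add_apply, toLattice, dimSub]
  exact_mod_cast this

variable {θ}

/-- The values of `θ` on `U / (U ∩ W^⊥)` and `W / (W ∩ U^⊥)` are opposite, as these spaces are
dual to each other. -/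
theorem theta_inf_perp (hθ : Q.IsCompatible θ) (b : gradedForms k V Q.σ₀ D.s)
    (U W : ∀ i, Submodule k (V i)) :
    θ (toLattice (dimSub U)) + θ (toLattice (dimSub W)) =
      θ (toLattice (dimSub (U ⊓ gradedPerp b.1 W))) +
        θ (toLattice (dimSub (W ⊓ gradedPerp b.1 U))) := by
  have h : toLattice (dimSub U) - toLattice (dimSub (U ⊓ gradedPerp b.1 W)) =
      Q.σΛ (toLattice (dimSub W) - toLattice (dimSub (W ⊓ gradedPerp b.1 U))) := by
    funext i
    have := finrank_inf_perp b U W i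
    simp only [Pi.sub_apply, InvQuiver.σΛ, toLattice]
    omega
  have h1 := congrArg θ h
  rw [hθ, map_sub, map_sub] at h1
  linarith

open Classical in
/-- The signed count of flags of isotropic subrepresentations of positive slope is the indicator
function of semistability. -/
theorem sum_isotropic_posetMu (hθ : Q.IsCompatible θ) (b : gradedForms k V Q.σ₀ D.s)
    {m : QRep k Q V} (hm : Compat D b.1 m) :
    ∑ U with GradedIsotropic b.1 U, posetMu (IsDestab θ m) U =
      if NoDestab θ b.1 m then 1 else 0 := by
  split_ifs with hs
  · exact posetMu_sum_eq_one (gradedIsotropic_bot b.1) hs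
  · obtain ⟨U₀, hU₀, hd₀⟩ : ∃ U, GradedIsotropic b.1 U ∧ IsDestab θ m U := by
      by_contra hc
      push Not at hc
      exact hs hc
    -- an isotropic subrepresentation `W` on which `θ` is maximal
    obtain ⟨W, hW, hmax⟩ := Finset.exists_max_image
      (Finset.univ.filter fun U : ∀ i, Submodule k (V i) => GradedIsotropic b.1 U ∧ IsSub m U)
      (fun U => θ (toLattice (dimSub U))) ⟨U₀, by simp [hU₀, hd₀.1]⟩
    simp only [Finset.mem_filter, Finset.mem_univ, true_and, and_imp] at hW hmax
    -- `θ(U ⊓ W) ≥ θ(U)` because `W ⊔ (U ⊓ W^⊥)` and `W ⊓ U^⊥` are isotropic subrepresentations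
    refine posetMu_sum_eq_zero (W := W) (not_isDestab_bot θ m) (fun U V h hV => hV.mono h) hW.1
      ⟨hW.2, hd₀.2.trans_le (hmax U₀ hU₀ hd₀.1)⟩ fun U hU hd => ⟨hd.1.inf hW.2, hd.2.trans_le ?_⟩
    have hA : GradedIsotropic b.1 (U ⊓ gradedPerp b.1 W) := hU.mono inf_le_left
    have h1 := hmax _ (hW.1.mono (inf_le_left : W ⊓ gradedPerp b.1 U ≤ W))
      (hW.2.inf (hd.1.perp hm))
    have h2 := hmax _ (hW.1.sup hA inf_le_right) (hW.2.sup (hd.1.inf (hW.2.perp hm)))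
    have h3 := theta_sup_add_inf θ (U ⊓ gradedPerp b.1 W) W
    have h4 := theta_inf_perp hθ b U W
    have h5 : W ⊓ (U ⊓ gradedPerp b.1 W) = U ⊓ W := by
      refine le_antisymm (le_inf (inf_le_right.trans inf_le_left) inf_le_left) (le_inf inf_le_right
        (le_inf inf_le_left (inf_le_right.trans hW.1.le_perp)))
    rw [h5] at h3
    linarith

end Indicator

section PointCount

variable {k : Type*} [Field k] [Finite k] {Q₀ Q₁ : Type*} [Fintype Q₀] [DecidableEq Q₀] [Fintype Q₁]
  [DecidableEq Q₁] {Q : InvQuiver Q₀ Q₁} {D : DualityStructure Q} (P : PositivePart Q)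
  {θ : (Q₀ → ℤ) →ₗ[ℤ] ℤ}
  {V : Q₀ → Type*} [∀ i, AddCommGroup (V i)] [∀ i, Module k (V i)] [∀ i, FiniteDimensional k (V i)]

variable (Q D) in
/-- The number of non-degenerate forms on a graded space of dimension vector `d` for which a given
graded subspace of dimension vector `u` is isotropic. It vanishes unless `u + σ(u) ≤ d`. -/
noncomputable def isotropicCard (k : Type*) [Field k] (d u : Q₀ → ℕ) : ℝ :=
  open Classical in
  if Q.hyp u ≤ d then
    (∏ i ∈ P.nodes, injCard (Nat.card k) (u i) ((d - Q.hyp u) i + u i) *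
        (glCard (Nat.card k) ((d - Q.hyp u) i + u (Q.σ₀ i)) * (Nat.card k : ℝ) ^
          (((d - Q.hyp u) i + u (Q.σ₀ i)) * u i))) *
      ∏ i with Q.σ₀ i = i, injCard (Nat.card k) (u i) ((d - Q.hyp u) i + u i) *
        (ndCard k (D.s i) ((d - Q.hyp u) i) * (Nat.card k : ℝ) ^ ((d - Q.hyp u) i * u i +
          symDim (D.s i) (u i)))
  else 0

theorem natCard_isotropic_forms (h2 : (2 : k) ≠ 0)
    (hd : ∀ i, Module.finrank k (V (Q.σ₀ i)) = Module.finrank k (V i))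
    (U : ∀ i, Submodule k (V i)) :
    (Nat.card {β : gradedForms k V Q.σ₀ D.s // GradedNondeg Q.σ₀ β.1 ∧ GradedIsotropic β.1 U} : ℝ) =
      isotropicCard Q D P k (fun i => Module.finrank k (V i)) (dimSub U) := by
  rw [isotropicCard]
  split_ifs with h
  · have h' (i) := h i
    simp only [InvQuiver.hyp, InvQuiver.σΛ, Pi.add_apply, dimSub] at h'
    refine natCard_gradedForms_isotropic h2 (P.signedInvolution_nodes D) U
      ((fun i => Module.finrank k (V i)) - Q.hyp (dimSub U)) (fun i => ?_) (fun i => ?_)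
    · simp only [InvQuiver.hyp, InvQuiver.σΛ, Pi.add_apply, Pi.sub_apply, dimSub]
      have := h' i
      omega
    · have h1 : dimSub U (Q.σ₀ (Q.σ₀ i)) = dimSub U i := by rw [Q.σ₀_invol]
      simp only [InvQuiver.hyp, InvQuiver.σΛ, Pi.add_apply, Pi.sub_apply, hd, h1]
      rw [add_comm]
  · have : IsEmpty {β : gradedForms k V Q.σ₀ D.s // GradedNondeg Q.σ₀ β.1 ∧
        GradedIsotropic β.1 U} := by
      refine ⟨fun β => h fun i => ?_⟩
      have := GradedIsotropic.finrank_add_le β.2.2 β.2.1 i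
      rwa [hd] at this
    simp

variable (k Q D V) in
/-- Self-dual representations on a fixed graded space. -/
abbrev SDPoint : Type _ :=
  {p : gradedForms k V Q.σ₀ D.s × QRep k Q V // GradedNondeg Q.σ₀ p.1.1 ∧ Compat D p.1.1 p.2}

/-- The number of semistable self-dual representations on a fixed graded space. -/
theorem card_sdPoint_noDestab (h2 : (2 : k) ≠ 0) (hθ : Q.IsCompatible θ)
    (hd : ∀ i, Module.finrank k (V (Q.σ₀ i)) = Module.finrank k (V i)) :
    (Nat.card {p : SDPoint k Q D V // NoDestab θ p.1.1.1 p.1.2} : ℝ) =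
      ∑ u ∈ Finset.Iic (fun i => Module.finrank k (V i)),
        Nat.card {U : ∀ i, Submodule k (V i) // dimSub U = u} *
        (isotropicCard Q D P k (fun i => Module.finrank k (V i)) u *
        ((Nat.card k : ℝ) ^ gradedDim Q.σ₁ D.arrowSign P.arrows
          (fun a => Module.finrank k (V (Q.src a)) - u (Q.src a)) *
        (glDim (Nat.card k) u * chainSum Q θ (Nat.card k) u))) := by
  classical
  have := Fintype.ofFinite (gradedForms k V Q.σ₀ D.s)
  have h1 : (Nat.card {p : SDPoint k Q D V // NoDestab θ p.1.1.1 p.1.2} : ℝ) =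
      ∑ b : gradedForms k V Q.σ₀ D.s with GradedNondeg Q.σ₀ b.1,
        ∑ m : QRep k Q V with Compat D b.1 m, if NoDestab θ b.1 m then (1 : ℝ) else 0 := by
    rw [Nat.card_congr (Equiv.subtypeSubtypeEquivSubtypeInter
      (fun p : gradedForms k V Q.σ₀ D.s × QRep k Q V =>
        GradedNondeg Q.σ₀ p.1.1 ∧ Compat D p.1.1 p.2) (fun p => NoDestab θ p.1.1 p.2)),
      Nat.card_eq_fintype_card, Fintype.card_subtype, Finset.card_eq_sum_ones, Nat.cast_sum,
      Finset.sum_filter, Fintype.sum_prod_type, Finset.sum_filter]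
    refine Finset.sum_congr rfl fun b _ => ?_
    rw [Finset.sum_filter]
    by_cases hb : GradedNondeg Q.σ₀ b.1
    · simp only [hb, true_and, if_true]
      refine Finset.sum_congr rfl fun m _ => ?_
      by_cases hm : Compat D b.1 m <;> simp [hm]
    · simp [hb]
  have h3 (b : gradedForms k V Q.σ₀ D.s) (hb : GradedNondeg Q.σ₀ b.1) :
      (∑ m : QRep k Q V with Compat D b.1 m, if NoDestab θ b.1 m then (1 : ℝ) else 0) =
      ∑ U, if GradedIsotropic b.1 U then
        (Nat.card k : ℝ) ^ gradedDim Q.σ₁ D.arrowSign P.arrows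
        (fun a => Module.finrank k (V (Q.src a)) - dimSub U (Q.src a)) *
        (glDim (Nat.card k) (dimSub U) * chainSum Q θ (Nat.card k) (dimSub U)) else 0 := by
    refine Eq.trans ?_ (Finset.sum_filter _ _)
    refine Eq.trans ?_ (Finset.sum_congr rfl fun U hU =>
      sum_compat_posetMu P θ h2 b hb (Finset.mem_filter.1 hU).2)
    rw [Finset.sum_comm]
    refine Finset.sum_congr rfl fun m hm => ?_
    have := sum_isotropic_posetMu hθ b (Finset.mem_filter.1 hm).2
    rw [← Int.cast_sum, this]
    split_ifs <;> simp
  rw [h1, Finset.sum_congr rfl fun b hb => h3 b (Finset.mem_filter.1 hb).2, Finset.sum_comm]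
  have h4 (U : ∀ i, Submodule k (V i)) (c : ℝ) :
      (∑ b : gradedForms k V Q.σ₀ D.s with GradedNondeg Q.σ₀ b.1,
        if GradedIsotropic b.1 U then c else 0) =
      isotropicCard Q D P k (fun i => Module.finrank k (V i)) (dimSub U) * c := by
    rw [← natCard_isotropic_forms P h2 hd, ← Finset.sum_filter, Finset.sum_const, nsmul_eq_mul,
      Nat.card_eq_fintype_card, Fintype.card_subtype, Finset.filter_filter]
  simp only [h4]
  have h5 := sum_gradedSubmodule (fun _ : ∀ i, Submodule k (V i) => True)
    (Finset.Iic (fun i => Module.finrank k (V i)))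
    (fun W _ => Finset.mem_Iic.2 fun i => Submodule.finrank_le (W i))
    (fun u => isotropicCard Q D P k (fun i => Module.finrank k (V i)) u *
        ((Nat.card k : ℝ) ^ gradedDim Q.σ₁ D.arrowSign P.arrows
          (fun a => Module.finrank k (V (Q.src a)) - u (Q.src a)) *
        (glDim (Nat.card k) u * chainSum Q θ (Nat.card k) u)))
  simpa using h5

end PointCount

/-! ### The groupoid of self-dual representations -/

section Groupoid

variable {k : Type u} [Field k] {Q₀ Q₁ : Type*} [Fintype Q₀] [DecidableEq Q₀]
  {Q : InvQuiver Q₀ Q₁} {D : DualityStructure Q} {θ : (Q₀ → ℤ) →ₗ[ℤ] ℤ}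
  {V : Q₀ → Type u} [∀ i, AddCommGroup (V i)] [∀ i, Module k (V i)]

/-- The bilinear form on the total space with given components. -/
def totalForm (b : ∀ i j, V i →ₗ[k] V j →ₗ[k] k) : LinearMap.BilinForm k (∀ i, V i) :=
  ∑ i, ∑ j, (b i j).compl₁₂ (LinearMap.proj i) (LinearMap.proj j)

theorem totalForm_apply (b : ∀ i j, V i →ₗ[k] V j →ₗ[k] k) (x y : ∀ i, V i) :
    totalForm b x y = ∑ i, ∑ j, b i j (x i) (y j) := by
  simp [totalForm, LinearMap.sum_apply]

theorem totalForm_single_right (b : ∀ i j, V i →ₗ[k] V j →ₗ[k] k) (x : ∀ i, V i) (j : Q₀)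
    (y : V j) : totalForm b x (Pi.single j y) = ∑ i, b i j (x i) y := by
  rw [totalForm_apply]
  refine Finset.sum_congr rfl fun i _ => ?_
  rw [Finset.sum_eq_single j, Pi.single_eq_same]
  · intro j' _ h
    rw [Pi.single_eq_of_ne h, map_zero]
  · simp

theorem totalForm_single (b : ∀ i j, V i →ₗ[k] V j →ₗ[k] k) (i j : Q₀) (x : V i) (y : V j) :
    totalForm b (Pi.single i x) (Pi.single j y) = b i j x y := by
  rw [totalForm_single_right, Finset.sum_eq_single i, Pi.single_eq_same]
  · intro i' _ h
    rw [Pi.single_eq_of_ne h, map_zero, LinearMap.zero_apply]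
  · simp

theorem totalForm_symm (b : gradedForms k V Q.σ₀ D.s) (i : Q₀) {x : ∀ i, V i}
    (hx : ∀ j, j ≠ i → j ≠ Q.σ₀ i → x j = 0) (y : ∀ i, V i) :
    totalForm b.1 x y = ((D.s i : ℤ) : k) * totalForm b.1 y x := by
  rw [totalForm_apply, totalForm_apply, Finset.mul_sum, Finset.sum_comm]
  refine Finset.sum_congr rfl fun j' _ => ?_
  rw [Finset.mul_sum]
  refine Finset.sum_congr rfl fun j _ => ?_
  have hs : x j = 0 ∨ D.s j = D.s i := by
    by_cases h1 : j = i
    · exact Or.inr (by rw [h1])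
    by_cases h2 : j = Q.σ₀ i
    · exact Or.inr (by rw [h2, D.s_σ])
    exact Or.inl (hx j h1 h2)
  rcases hs with hs | hs
  · simp [hs]
  · rw [b.2.2, hs]

theorem totalForm_nondegenerate (b : gradedForms k V Q.σ₀ D.s) (hb : GradedNondeg Q.σ₀ b.1) :
    (totalForm b.1).Nondegenerate := by
  have key (x : ∀ i, V i) (j : Q₀) (y : V (Q.σ₀ j)) :
      totalForm b.1 x (Pi.single (Q.σ₀ j) y) = b.1 j (Q.σ₀ j) (x j) y := by
    rw [totalForm_single_right, Finset.sum_eq_single j]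
    · intro i _ hi
      rw [b.2.1 _ _ fun e => hi (by rw [← Q.σ₀_invol i, ← e, Q.σ₀_invol])]
      rfl
    · simp
  have h1 (x : ∀ i, V i) (h : ∀ y, totalForm b.1 x y = 0) : x = 0 := by
    funext j
    refine (hb j).1 _ fun y => ?_
    rw [← key, h]
  refine ⟨h1, fun y h => h1 y fun x => ?_⟩
  rw [totalForm_apply, Finset.sum_comm]
  have h2 (j : Q₀) (z : V j) : ∑ i, b.1 i j (y i) z = 0 := by
    rw [← totalForm_single_right]
    have := totalForm_symm b j (x := Pi.single j z) (fun j' h _ => Pi.single_eq_of_ne h z) y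
    rw [h, eq_comm, mul_eq_zero] at this
    exact this.resolve_left (signCast_ne_zero _)
  exact Finset.sum_eq_zero fun j _ => h2 j (x j)

variable [∀ i, FiniteDimensional k (V i)]

/-- The self-dual representation given by a point of the representation space. -/
def SDPoint.toRep (p : SDPoint k Q D V) : SelfDualRep k Q D where
  V := V
  map := p.1.2
  form := totalForm p.1.1.1
  nondegenerate := totalForm_nondegenerate p.1.1 p.2.1
  orthogonal i j h x y := by
    rw [totalForm_single, p.1.1.2.1 i j fun e => h (by rw [e, Q.σ₀_invol])]
    rfl
  symm i x hx y _ := by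
    refine totalForm_symm p.1.1 i (fun j h1 h2 => ?_) y
    obtain ⟨_, ⟨u, rfl⟩, _, ⟨v, rfl⟩, rfl⟩ := Submodule.mem_sup.1 hx
    simp [Pi.single_eq_of_ne h1, Pi.single_eq_of_ne h2]
  structure_symm a x x' := by
    rw [totalForm_single, totalForm_single]
    exact p.2.2 a x x'

/-- The components of the form of a self-dual representation, on another graded space. -/
def SelfDualRep.component (M : SelfDualRep k Q D) (e : ∀ i, M.V i ≃ₗ[k] V i) (i j : Q₀) :
    V i →ₗ[k] V j →ₗ[k] k :=
  M.form.compl₁₂ (LinearMap.single k M.V i ∘ₗ (e i).symm.toLinearMap)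
    (LinearMap.single k M.V j ∘ₗ (e j).symm.toLinearMap)

theorem SelfDualRep.component_apply (M : SelfDualRep k Q D) (e : ∀ i, M.V i ≃ₗ[k] V i) (i j : Q₀)
    (x : V i) (y : V j) : M.component e i j x y =
      M.form (Pi.single i ((e i).symm x)) (Pi.single j ((e j).symm y)) := rfl

theorem SelfDualRep.component_mem (M : SelfDualRep k Q D) (e : ∀ i, M.V i ≃ₗ[k] V i) :
    M.component e ∈ gradedForms k V Q.σ₀ D.s := by
  refine ⟨fun i j h => LinearMap.ext₂ fun x y => M.orthogonal i j
    (fun e => h (by rw [e, Q.σ₀_invol])) _ _, fun i j x y => ?_⟩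
  rw [M.component_apply, M.component_apply]
  by_cases h : j = Q.σ₀ i
  · subst h
    exact M.symm i _ (Submodule.mem_sup_left ⟨_, rfl⟩) _ (Submodule.mem_sup_right ⟨_, rfl⟩)
  · rw [M.orthogonal i j (fun e => h (by rw [e, Q.σ₀_invol])), M.orthogonal j i h, mul_zero]

theorem SelfDualRep.component_nondeg (M : SelfDualRep k Q D) (e : ∀ i, M.V i ≃ₗ[k] V i) :
    GradedNondeg Q.σ₀ (M.component e) := by
  refine fun i => ⟨fun x h => ?_, fun y h => ?_⟩
  · have h1 : (Pi.single i ((e i).symm x) : ∀ i, M.V i) = 0 := M.nondegenerate.1 _ fun y => by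
      rw [← Finset.univ_sum_single y, map_sum]
      refine Finset.sum_eq_zero fun j _ => ?_
      by_cases hj : j = Q.σ₀ i
      · subst hj
        have := h (e _ (y (Q.σ₀ i)))
        rwa [M.component_apply, LinearEquiv.symm_apply_apply] at this
      · exact M.orthogonal _ _ (fun e => hj (by rw [e, Q.σ₀_invol])) _ _
    simpa using h1
  · have h1 : (Pi.single (Q.σ₀ i) ((e _).symm y) : ∀ i, M.V i) = 0 := M.nondegenerate.2 _ fun x => by
      rw [← Finset.univ_sum_single x, map_sum, LinearMap.sum_apply]
      refine Finset.sum_eq_zero fun j _ => ?_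
      by_cases hj : j = i
      · subst hj
        have := h (e _ (x j))
        rwa [M.component_apply, LinearEquiv.symm_apply_apply] at this
      · exact M.orthogonal _ _ (by rwa [Q.σ₀_invol]) _ _
    simpa using h1

/-- Transport of a self-dual representation to another graded space. -/
def SelfDualRep.toPoint (M : SelfDualRep k Q D) (e : ∀ i, M.V i ≃ₗ[k] V i) : SDPoint k Q D V :=
  ⟨(⟨M.component e, M.component_mem e⟩,
    fun a => (e _).toLinearMap ∘ₗ M.map a ∘ₗ (e _).symm.toLinearMap), M.component_nondeg e, by
    intro a x x'
    simpa [M.component_apply] using M.structure_symm a ((e _).symm x) ((e _).symm x')⟩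

theorem SelfDualRep.form_eq_totalForm (M : SelfDualRep k Q D) (e : ∀ i, M.V i ≃ₗ[k] V i)
    (x y : ∀ i, M.V i) :
    totalForm (M.component e) (fun i => e i (x i)) (fun i => e i (y i)) = M.form x y := by
  conv_rhs => rw [← Finset.univ_sum_single x, ← Finset.univ_sum_single y]
  simp only [totalForm_apply, M.component_apply, map_sum, LinearMap.sum_apply,
    LinearEquiv.symm_apply_apply]
  exact Finset.sum_comm

theorem map_pi_single {W : Q₀ → Type*} [∀ i, AddCommGroup (W i)] [∀ i, Module k (W i)]
    (e : ∀ i, W i ≃ₗ[k] V i) (i : Q₀) (x : W i) :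
    (fun j => e j ((Pi.single i x : ∀ i, W i) j)) = Pi.single i (e i x) :=
  funext fun j => Pi.apply_single (fun i => e i) (fun i => map_zero (e i)) i x j

theorem SelfDualRep.toPoint_eq (M : SelfDualRep k Q D) (p : SDPoint k Q D V)
    (e : ∀ i, M.V i ≃ₗ[k] V i) (hm : ∀ a x, e _ (M.map a x) = p.1.2 a (e _ x))
    (hb : ∀ x y : ∀ i, M.V i,
      totalForm p.1.1.1 (fun i => e i (x i)) (fun i => e i (y i)) = M.form x y) :
    M.toPoint e = p := by
  refine Subtype.ext (Prod.ext (Subtype.ext ?_) ?_)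
  · funext i j
    refine LinearMap.ext₂ fun x y => ?_
    have h1 := hb (Pi.single i ((e i).symm x)) (Pi.single j ((e j).symm y))
    rw [map_pi_single, map_pi_single, totalForm_single, LinearEquiv.apply_symm_apply,
      LinearEquiv.apply_symm_apply] at h1
    exact h1.symm
  · funext a
    ext x
    have := hm a ((e _).symm x)
    rw [LinearEquiv.apply_symm_apply] at this
    exact this

/-- An isomorphism of graded spaces is an isometry for exactly one self-dual structure on the
target. -/
noncomputable def SelfDualRep.isometryEquiv (M : SelfDualRep k Q D) :
    (Σ p : SDPoint k Q D V, M.Isometry p.toRep) ≃ ∀ i, M.V i ≃ₗ[k] V i :=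
  Equiv.ofBijective (fun f => f.2.toEquiv) (by
    constructor
    · rintro ⟨p, f⟩ ⟨p', f'⟩ (h : f.toEquiv = f'.toEquiv)
      have hp := M.toPoint_eq p f.toEquiv f.comm f.form_eq
      have hp' := M.toPoint_eq p' f'.toEquiv f'.comm f'.form_eq
      obtain rfl : p = p' := by
        rw [← hp, ← hp']
        exact congrArg M.toPoint h
      rw [SelfDualRep.Isometry.ext h]
    · intro e
      refine ⟨⟨M.toPoint e, e, fun a x => ?_, M.form_eq_totalForm e⟩, rfl⟩
      change _ = (e _) (M.map a ((e _).symm (e _ x)))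
      rw [LinearEquiv.symm_apply_apply]
      rfl)

variable [Fintype Q₁] [DecidableEq Q₁] [Finite k]

theorem toRep_isSemistable_iff (hθ : Q.IsCompatible θ) (p : SDPoint k Q D V)
    (hd : ∀ i, Module.finrank k (V (Q.σ₀ i)) = Module.finrank k (V i)) :
    p.toRep.IsSemistable θ ↔ NoDestab θ p.1.1.1 p.1.2 := by
  have h0 : slopeDim θ p.toRep.dimVec = 0 := by
    have h1 : Q.σΛ (toLattice p.toRep.dimVec) = toLattice p.toRep.dimVec :=
      funext fun i => congrArg Nat.cast (hd i)
    have h2 := hθ (toLattice p.toRep.dimVec)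
    rw [h1] at h2
    have h3 : θ (toLattice p.toRep.dimVec) = 0 := by omega
    simp [slopeDim, h3]
  have h1 (U : ∀ i, Submodule k (V i)) :
      p.toRep.IsIsotropic U ↔ GradedIsotropic p.1.1.1 U := by
    refine forall_congr' fun i => forall_congr' fun j => forall_congr' fun x => forall_congr'
      fun _ => forall_congr' fun y => forall_congr' fun _ => ?_
    rw [← totalForm_single p.1.1.1 i j x y]
    rfl
  have h2 (U : ∀ i, Submodule k (V i)) :
      slopeDim θ (fun i => Module.finrank k (U i)) ≤ 0 ↔ ¬ 0 < θ (toLattice (dimSub U)) := by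
    rw [← slopeDim_pos_iff, not_lt]
    rfl
  constructor
  · intro h U hU hd
    have hne : ∃ i, U i ≠ ⊥ := by
      by_contra hc
      push Not at hc
      exact not_isDestab_bot θ p.1.2 ((show U = ⊥ from funext hc) ▸ hd)
    exact (h2 U).1 (h0 ▸ h U hd.1 ((h1 U).2 hU) hne) hd.2
  · intro h U hU hI _
    rw [h0]
    exact (h2 U).2 fun hp => h U ((h1 U).1 hI) ⟨hU, hp⟩

theorem SelfDualRep.IsSemistable.of_isometry {M N : SelfDualRep k Q D} (f : N.Isometry M)
    (h : M.IsSemistable θ) : N.IsSemistable θ := by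
  intro U hU hI ⟨i, hi⟩
  have hf (i j) (x : N.V i) (y : N.V j) : M.form (Pi.single i (f.toEquiv i x))
      (Pi.single j (f.toEquiv j y)) = N.form (Pi.single i x) (Pi.single j y) := by
    rw [← f.form_eq]
    rw [map_pi_single, map_pi_single]
  have h1 := h (fun i => (U i).map (f.toEquiv i).toLinearMap) (fun a x hx => by
      obtain ⟨x, hx, rfl⟩ := hx
      exact ⟨_, hU a x hx, f.comm a x⟩) (fun i j x hx y hy => by
      obtain ⟨x, hx, rfl⟩ := hx
      obtain ⟨y, hy, rfl⟩ := hy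
      exact (hf i j x y).trans (hI i j x hx y hy)) ⟨i, fun hc => hi (by simpa using hc)⟩
  have h2 : N.dimVec = M.dimVec := funext fun i => (f.toEquiv i).finrank_eq
  have h3 (i) : Module.finrank k ((U i).map (f.toEquiv i).toLinearMap) = Module.finrank k (U i) :=
    LinearEquiv.finrank_map_eq _ _
  rw [h2]
  simpa only [h3] using h1

instance finite_isometry (M N : SelfDualRep k Q D) : Finite (M.Isometry N) :=
  Finite.of_injective (fun f => f.toEquiv) fun _ _ h => SelfDualRep.Isometry.ext h

/-- Composition with an isometry identifies isometries with self-isometries. -/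
def SelfDualRep.Isometry.torsor {M N : SelfDualRep k Q D} (g : M.Isometry N) :
    M.Isometry N ≃ M.Isometry M where
  toFun f := f.trans g.symm
  invFun f := f.trans g
  left_inv f := by
    ext i x
    simp [SelfDualRep.Isometry.trans, SelfDualRep.Isometry.symm]
  right_inv f := by
    ext i x
    simp [SelfDualRep.Isometry.trans, SelfDualRep.Isometry.symm]

variable (k) in
/-- The standard graded space of a given dimension vector. -/
abbrev coordSpace (d : Q₀ → ℕ) (i : Q₀) : Type u := Fin (d i) → k

variable (k Q D θ) in
/-- The semistable points of the representation space of a given dimension vector. -/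
abbrev SSPoint (d : Q₀ → ℕ) : Type _ :=
  {p : SDPoint k Q D (coordSpace k d) // NoDestab θ p.1.1.1 p.1.2}

variable {d : Q₀ → ℕ}

theorem finrank_coordSpace_σ (hd : Q.σΛ d = d) (i : Q₀) :
    Module.finrank k (coordSpace k d (Q.σ₀ i)) = Module.finrank k (coordSpace k d i) := by
  rw [Module.finrank_fin_fun, Module.finrank_fin_fun]
  exact congrFun hd i

/-- The isometry class of a semistable point. -/
def SSPoint.toClass (hθ : Q.IsCompatible θ) (hd : Q.σΛ d = d) (p : SSPoint k Q D θ d) :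
    SemistableClass k D θ d :=
  Quotient.mk _ ⟨p.1.toRep, funext fun _ => Module.finrank_fin_fun k,
    (toRep_isSemistable_iff hθ p.1 (finrank_coordSpace_σ hd)).2 p.2⟩

theorem SSPoint.toClass_eq_iff (hθ : Q.IsCompatible θ) (hd : Q.σΛ d = d) (p : SSPoint k Q D θ d)
    (M : SemistableRep k D θ d) :
    p.toClass hθ hd = Quotient.mk _ M ↔ Nonempty (M.1.Isometry p.1.toRep) :=
  ⟨fun h => (Quotient.exact h).elim fun f => ⟨f.symm⟩, fun ⟨f⟩ => Quotient.sound ⟨f.symm⟩⟩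

/-- The orbit-stabilizer formula for the action of `∏ GL(d_i)` on the representation space. -/
theorem card_fiber_toClass (hθ : Q.IsCompatible θ) (hd : Q.σΛ d = d) (M : SemistableRep k D θ d) :
    (Nat.card {p : SSPoint k Q D θ d // p.toClass hθ hd = Quotient.mk _ M} : ℝ) * M.1.cardAut =
      glDim (Nat.card k) d := by
  have hdim (i : Q₀) : Module.finrank k (M.1.V i) = d i := congrFun M.2.1 i
  have hss (p : SDPoint k Q D (coordSpace k d)) (f : M.1.Isometry p.toRep) :
      NoDestab θ p.1.1.1 p.1.2 :=
    (toRep_isSemistable_iff hθ p (finrank_coordSpace_σ hd)).1 (M.2.2.of_isometry f.symm)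
  let E : (Σ p : {p : SSPoint k Q D θ d // p.toClass hθ hd = Quotient.mk _ M},
      M.1.Isometry p.1.1.toRep) ≃ Σ p : SDPoint k Q D (coordSpace k d), M.1.Isometry p.toRep :=
    { toFun := fun f => ⟨f.1.1.1, f.2⟩
      invFun := fun f => ⟨⟨⟨f.1, hss f.1 f.2⟩, (SSPoint.toClass_eq_iff hθ hd _ M).2 ⟨f.2⟩⟩, f.2⟩
      left_inv := fun f => rfl
      right_inv := fun f => rfl }
  have := Fintype.ofFinite {p : SSPoint k Q D θ d // p.toClass hθ hd = Quotient.mk _ M}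
  have h1 := Nat.card_congr (E.trans M.1.isometryEquiv)
  have h2 : (Nat.card (∀ i, M.1.V i ≃ₗ[k] coordSpace k d i) : ℝ) = glDim (Nat.card k) d := by
    rw [Nat.card_pi, Nat.cast_prod, glDim]
    refine Finset.prod_congr rfl fun i _ => ?_
    rw [card_linearEquiv_of_finrank_eq (by rw [hdim, Module.finrank_fin_fun]), hdim]
  rw [← h2, ← h1, Nat.card_sigma, Finset.sum_congr rfl fun p _ => Nat.card_congr
    ((SSPoint.toClass_eq_iff hθ hd _ M).1 p.2).some.torsor]
  simp [SelfDualRep.cardAut]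

theorem SSPoint.toClass_surjective (hθ : Q.IsCompatible θ) (hd : Q.σΛ d = d) :
    Function.Surjective (SSPoint.toClass (k := k) (D := D) hθ hd) := by
  intro c
  induction c using Quotient.inductionOn with
  | _ M =>
    have h := card_fiber_toClass hθ hd M
    have h1 : Nat.card {p : SSPoint k Q D θ d // p.toClass hθ hd = Quotient.mk _ M} ≠ 0 := by
      intro h0
      rw [h0, Nat.cast_zero, zero_mul] at h
      exact glDim_ne_zero (one_lt_natCard k) d h.symm
    obtain ⟨p⟩ := (Nat.card_ne_zero.1 h1).1
    exact ⟨p.1, p.2⟩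

theorem finite_semistableClass (hθ : Q.IsCompatible θ) (hd : Q.σΛ d = d) :
    Finite (SemistableClass k D θ d) :=
  Finite.of_surjective _ (SSPoint.toClass_surjective hθ hd)

/-- The stacky count of semistable self-dual representations is the number of semistable points
divided by the order of the group. -/
theorem stackCount_eq (hθ : Q.IsCompatible θ) (hd : Q.σΛ d = d) :
    stackCount k D θ d = Nat.card (SSPoint k Q D θ d) / glDim (Nat.card k) d := by
  have := finite_semistableClass (k := k) (D := D) hθ hd
  have := Fintype.ofFinite (SemistableClass k D θ d)
  have h0 := glDim_ne_zero (one_lt_natCard k) d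
  rw [stackCount, finsum_eq_sum_of_fintype,
    ← Nat.card_congr (Equiv.sigmaFiberEquiv (SSPoint.toClass (k := k) (D := D) hθ hd)),
    Nat.card_sigma, Nat.cast_sum, Finset.sum_div]
  refine Finset.sum_congr rfl fun c _ => ?_
  induction c using Quotient.inductionOn with
  | _ M =>
    have h := card_fiber_toClass hθ hd M
    have h1 : (M.1.cardAut : ℝ) ≠ 0 := fun h1 => h0 (by rw [← h, h1, mul_zero])
    change 1 / (M.1.cardAut : ℝ) = _
    rw [div_eq_div_iff h1 h0, one_mul, ← h]

end Groupoid

/-! ### Evaluation of the count -/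

section Evaluation

/-- A product over all indices, split according to the orbits of an involution. -/
@[to_additive /-- A sum over all indices, split according to the orbits of an involution. -/]
theorem SignedInvolution.prod_eq {I M : Type*} [Fintype I] [DecidableEq I] [CommMonoid M]
    {σ : I → I} {ε : I → ℤˣ} {P : Finset I} (h : SignedInvolution σ ε P) (g : I → M) :
    ∏ i, g i = (∏ i ∈ P, g i * g (σ i)) * ∏ i with σ i = i, g i := by
  rw [← Finset.prod_filter_mul_prod_filter_not Finset.univ (fun i => σ i = i) g, mul_comm,
    ← Finset.prod_filter_mul_prod_filter_not (Finset.univ.filter fun i => ¬ σ i = i) (fun i => i ∈ P) g,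
    Finset.prod_mul_distrib]
  congr 2
  · refine Finset.prod_congr (Finset.ext fun i => ?_) fun _ _ => rfl
    simp only [Finset.mem_filter, Finset.mem_univ, true_and, and_iff_right_iff_imp]
    exact fun hi hf => h.fixed i hf hi
  · refine Finset.prod_nbij' σ σ (fun i hi => ?_) (fun i hi => ?_) (fun i _ => h.invol i)
      (fun i _ => h.invol i) (fun i _ => by rw [h.invol])
    · simp only [Finset.mem_filter, Finset.mem_univ, true_and] at hi
      exact h.swap_mem hi.2 hi.1
    · have h1 : σ i ≠ i := fun hf => h.fixed i hf hi
      simp only [Finset.mem_filter, Finset.mem_univ, true_and]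
      exact ⟨fun hf => h1 (by rwa [h.invol, eq_comm] at hf), (h.swap i h1).1 hi⟩

theorem symDim_add_neg (ε : ℤˣ) (n : ℕ) : symDim ε n + symDim (-ε) n = n * n := by
  have h : 2 * n.choose 2 + n = n * n := by
    induction n with
    | zero => rfl
    | succ n ih =>
      rw [Nat.choose_succ_succ' n 1, Nat.choose_one_right]
      linarith
  have h1 : (-1 : ℤˣ) ≠ 1 := by decide
  rcases Int.units_eq_one_or ε with rfl | rfl <;> simp [symDim, h1] <;> linarith

variable {Q₀ Q₁ : Type*} [Fintype Q₀] [DecidableEq Q₀] [Fintype Q₁]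
  [DecidableEq Q₁] {Q : InvQuiver Q₀ Q₁} {D : DualityStructure Q} (P : PositivePart Q)

/-- The number of non-degenerate forms for which a graded subspace of dimension vector `u` is isotropic,
relative to the order of `∏ GL(d_i - u_i)`. -/
theorem isotropicCard_mul {k : Type*} [Field k] [Finite k] (h2 : (2 : k) ≠ 0) {e u : Q₀ → ℕ}
    (he : Q.σΛ e = e) (hpar : ∀ i, Q.σ₀ i = i → D.s i = -1 → Even (e i)) :
    isotropicCard Q D P k (e + Q.hyp u) u * ((Nat.card k : ℝ) ^ ((∑ i ∈ P.nodes, e i * e i) +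
      ∑ i with Q.σ₀ i = i, symDim (-D.s i) (e i)) * Q.qPochSd P (Nat.card k : ℝ)⁻¹ e) =
    (Nat.card k : ℝ) ^ ((∑ i ∈ P.nodes, u (Q.σ₀ i) * u i) +
      ∑ i with Q.σ₀ i = i, symDim (D.s i) (u i)) * glDim (Nat.card k) (e + Q.σΛ u) := by
  have hq := one_lt_natCard k
  have hq0 : (Nat.card k : ℝ) ≠ 0 := by positivity
  have hi : (Nat.card k : ℝ)⁻¹ ^ 2 < 1 :=
    pow_lt_one₀ (by positivity) (inv_lt_one_of_one_lt₀ hq) two_ne_zero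
  have he' (i) : e (Q.σ₀ i) = e i := congrFun he i
  rw [isotropicCard, if_pos le_add_self, add_tsub_cancel_right, InvQuiver.qPochSd, glDim,
    (P.signedInvolution_nodes D).prod_eq, pow_add, pow_add, ← Finset.prod_pow_eq_pow_sum,
    ← Finset.prod_pow_eq_pow_sum, ← Finset.prod_pow_eq_pow_sum, ← Finset.prod_pow_eq_pow_sum]
  have hP (i : Q₀) (_ : i ∈ P.nodes) :
      injCard (Nat.card k) (u i) (e i + u i) * (glCard (Nat.card k) (e i + u (Q.σ₀ i)) *
        (Nat.card k : ℝ) ^ ((e i + u (Q.σ₀ i)) * u i)) *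
        ((Nat.card k : ℝ) ^ (e i * e i) * qPoch (Nat.card k : ℝ)⁻¹ (e i)) =
      (Nat.card k : ℝ) ^ (u (Q.σ₀ i) * u i) * (glCard (Nat.card k) ((e + Q.σΛ u) i) *
        glCard (Nat.card k) ((e + Q.σΛ u) (Q.σ₀ i))) := by
    simp only [Pi.add_apply, InvQuiver.σΛ, Q.σ₀_invol, he']
    rw [← glCard_eq_qPoch hq0, add_comm (e i) (u i), glCard_add _ (u i) (e i)]
    ring
  have hF (i : Q₀) (hf : i ∈ Finset.univ.filter fun i => Q.σ₀ i = i) :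
      injCard (Nat.card k) (u i) (e i + u i) * (ndCard k (D.s i) (e i) *
        (Nat.card k : ℝ) ^ (e i * u i + symDim (D.s i) (u i))) *
        ((Nat.card k : ℝ) ^ symDim (-D.s i) (e i) * qPoch ((Nat.card k : ℝ)⁻¹ ^ 2) (e i / 2)) =
      (Nat.card k : ℝ) ^ symDim (D.s i) (u i) * glCard (Nat.card k) ((e + Q.σΛ u) i) := by
    have hf : Q.σ₀ i = i := by simpa using hf
    have hp : qPoch ((Nat.card k : ℝ)⁻¹ ^ 2) (e i / 2) ≠ 0 := qPoch_ne_zero (by positivity) hi _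
    simp only [Pi.add_apply, InvQuiver.σΛ, hf]
    rw [ndCard_eq_ndValue h2 (hpar i hf), ndValue, add_comm (e i) (u i), glCard_add _ (u i) (e i)]
    generalize qPoch ((Nat.card k : ℝ)⁻¹ ^ 2) (e i / 2) = R at hp ⊢
    field_simp
    ring
  have h1 := congrArg₂ (· * ·) (Finset.prod_congr rfl hP) (Finset.prod_congr rfl hF)
  simp only [Finset.prod_mul_distrib] at h1 ⊢
  linear_combination h1

/-- The contribution of the arrows to `-𝓔(d)`. For `σ`-invariant `d` it is the dimension of the space
of structure maps compatible with a non-degenerate form. -/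
def arrowDim (Q : InvQuiver Q₀ Q₁) (D : DualityStructure Q) (P : PositivePart Q)
    (d : Q₀ → ℕ) : ℕ :=
  (∑ a with Q.σ₁ a = a, symDim (D.arrowSign a) (d (Q.tgt a))) +
    ∑ a ∈ P.arrows, d (Q.σ₀ (Q.src a)) * d (Q.tgt a)

theorem sdEuler_eq (d : Q₀ → ℕ) : Q.sdEuler D P d =
    ((∑ i with Q.σ₀ i = i, symDim (-D.s i) (d i) : ℕ) : ℤ) +
      ((∑ i ∈ P.nodes, d (Q.σ₀ i) * d i : ℕ) : ℤ) - (arrowDim Q D P d : ℤ) := by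
  have h (a : Q₁) (ha : a ∈ Finset.univ.filter fun a => Q.σ₁ a = a) :
      (d (Q.tgt a) : ℤ) * (d (Q.tgt a) + (D.τ a : ℤ) * (D.s (Q.tgt a) : ℤ)) / 2 =
      symDim (D.arrowSign a) (d (Q.tgt a)) := by
    have ha : Q.σ₁ a = a := by simpa using ha
    have hs : D.s (Q.tgt a) = D.s (Q.src a) := by
      have := Q.src_σ a
      rw [ha] at this
      rw [this, D.s_σ]
    rw [← symDim_cast, DualityStructure.arrowSign, Units.val_mul, hs]
  rw [InvQuiver.sdEuler, arrowDim, Finset.sum_congr rfl h]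
  simp only [symDim_cast_neg]
  push_cast
  ring

/-- The number of parameters of the self-dual extensions of a representation on an isotropic
subspace. -/
theorem gradedDim_arrows {e u : Q₀ → ℕ} (he : Q.σΛ e = e) :
    gradedDim Q.σ₁ D.arrowSign P.arrows (fun a => (e + Q.σΛ u) (Q.src a)) =
      arrowDim Q D P e + arrowDim Q D P u + ∑ a, e (Q.src a) * u (Q.tgt a) := by
  have he' (i) : e (Q.σ₀ i) = e i := congrFun he i
  have h (a : Q₁) (ha : a ∈ Finset.univ.filter fun a => Q.σ₁ a = a) :
      symDim (D.arrowSign a) ((e + Q.σΛ u) (Q.src a)) = symDim (D.arrowSign a) (e (Q.tgt a)) +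
        e (Q.src a) * u (Q.tgt a) + symDim (D.arrowSign a) (u (Q.tgt a)) := by
    have ha : Q.σ₁ a = a := by simpa using ha
    have hs : Q.src a = Q.σ₀ (Q.tgt a) := by rw [← Q.src_σ a, ha]
    rw [hs]
    simp only [Pi.add_apply, InvQuiver.σΛ, Q.σ₀_invol, he', symDim_add]
  rw [gradedDim, Finset.sum_congr rfl h, arrowDim, arrowDim,
    (P.signedInvolution_arrows D).sum_eq fun a => e (Q.src a) * u (Q.tgt a)]
  simp only [Pi.add_apply, InvQuiver.σΛ, Q.src_σ, Q.tgt_σ, Q.σ₀_invol, he', Finset.sum_add_distrib,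
    add_mul, mul_add]
  simp only [mul_comm (e (Q.tgt _)) (u _)]
  ring

theorem sum_mul_σ (u : Q₀ → ℕ) :
    ∑ i, u i * u (Q.σ₀ i) = 2 * (∑ i ∈ P.nodes, u (Q.σ₀ i) * u i) +
      ((∑ i with Q.σ₀ i = i, symDim (D.s i) (u i)) +
        ∑ i with Q.σ₀ i = i, symDim (-D.s i) (u i)) := by
  rw [(P.signedInvolution_nodes D).sum_eq, ← Finset.sum_add_distrib, Finset.mul_sum]
  congr 1
  · refine Finset.sum_congr rfl fun i _ => ?_
    rw [Q.σ₀_invol]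
    ring
  · refine Finset.sum_congr rfl fun i hi => ?_
    have hi : Q.σ₀ i = i := by simpa using hi
    rw [symDim_add_neg, hi]

/-- The exponent of `q` in the contribution of an isotropic subspace of dimension vector `u` with
reduction of dimension vector `e`. -/
theorem exponent_eq {e u : Q₀ → ℕ} (he : Q.σΛ e = e) :
    (((∑ i ∈ P.nodes, u (Q.σ₀ i) * u i) + ∑ i with Q.σ₀ i = i, symDim (D.s i) (u i) : ℕ) : ℤ) +
      (gradedDim Q.σ₁ D.arrowSign P.arrows (fun a => (e + Q.σΛ u) (Q.src a)) : ℤ) =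
    (-Q.eulerForm e u - Q.sdEuler D P u - Q.sdEuler D P e) +
      (((∑ i ∈ P.nodes, e i * e i) + ∑ i with Q.σ₀ i = i, symDim (-D.s i) (e i) : ℕ) : ℤ) +
      ((∑ i, u i * (e + Q.σΛ u) i : ℕ) : ℤ) := by
  have he' (i) : e (Q.σ₀ i) = e i := congrFun he i
  have h1 : ∑ i, u i * (e + Q.σΛ u) i = (∑ i, e i * u i) + ∑ i, u i * u (Q.σ₀ i) := by
    rw [← Finset.sum_add_distrib]
    refine Finset.sum_congr rfl fun i _ => ?_
    simp only [Pi.add_apply, InvQuiver.σΛ]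
    ring
  rw [h1, sum_mul_σ (D := D) P u, gradedDim_arrows P he, sdEuler_eq, sdEuler_eq,
    InvQuiver.eulerForm]
  simp only [he']
  push_cast
  ring

variable {θ : (Q₀ → ℤ) →ₗ[ℤ] ℤ}

theorem qPochSd_ne_zero {y : ℝ} (h0 : 0 ≤ y) (h1 : y < 1) (e : Q₀ → ℕ) : Q.qPochSd P y e ≠ 0 :=
  mul_ne_zero (Finset.prod_ne_zero_iff.2 fun _ _ =>
    qPoch_ne_zero (by positivity) (pow_lt_one₀ h0 h1 two_ne_zero) _)
    (Finset.prod_ne_zero_iff.2 fun _ _ => qPoch_ne_zero h0 h1 _)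

/-- The total contribution of isotropic subspaces of dimension vector `u`. -/
theorem isotropic_term_eq {k : Type*} [Field k] [Finite k] (h2 : (2 : k) ≠ 0) {e u : Q₀ → ℕ}
    (he : Q.σΛ e = e) (hpar : ∀ i, Q.σ₀ i = i → D.s i = -1 → Even (e i)) {N C : ℝ}
    (hN : N * glDim (Nat.card k) u * ((Nat.card k : ℝ) ^ (∑ i, u i * (e + Q.σΛ u) i) *
      glDim (Nat.card k) (e + Q.σΛ u)) = glDim (Nat.card k) (e + Q.hyp u)) :
    N * (isotropicCard Q D P k (e + Q.hyp u) u * ((Nat.card k : ℝ) ^ gradedDim Q.σ₁ D.arrowSign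
      P.arrows (fun a => (e + Q.σΛ u) (Q.src a)) * (glDim (Nat.card k) u * C))) /
        glDim (Nat.card k) (e + Q.hyp u) =
      (Nat.card k : ℝ) ^ (-Q.eulerForm e u - Q.sdEuler D P u) * C *
        ((Nat.card k : ℝ) ^ (-Q.sdEuler D P e) / Q.qPochSd P (Nat.card k : ℝ)⁻¹ e) := by
  have hq := one_lt_natCard k
  have hq0 : (Nat.card k : ℝ) ≠ 0 := by positivity
  have h0 := glDim_ne_zero hq (e + Q.hyp u)
  have hp : Q.qPochSd P (Nat.card k : ℝ)⁻¹ e ≠ 0 :=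
    qPochSd_ne_zero P (by positivity) (inv_lt_one_of_one_lt₀ hq) e
  have h1 := isotropicCard_mul (D := D) P h2 (u := u) he hpar
  have h3 := congrArg ((Nat.card k : ℝ) ^ ·) (exponent_eq (D := D) P (u := u) he)
  simp only [zpow_add₀ hq0, sub_eq_add_neg, zpow_natCast] at h3
  rw [← mul_div_assoc, div_eq_div_iff h0 hp, ← hN]
  simp only [zpow_add₀ hq0, sub_eq_add_neg]
  have hA : (Nat.card k : ℝ) ^ ((∑ i ∈ P.nodes, e i * e i) +
      ∑ i with Q.σ₀ i = i, symDim (-D.s i) (e i)) ≠ 0 := by positivity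
  generalize (Nat.card k : ℝ) ^ ((∑ i ∈ P.nodes, e i * e i) +
      ∑ i with Q.σ₀ i = i, symDim (-D.s i) (e i)) = A at h1 h3 hA ⊢
  generalize (Nat.card k : ℝ) ^ ((∑ i ∈ P.nodes, u (Q.σ₀ i) * u i) +
      ∑ i with Q.σ₀ i = i, symDim (D.s i) (u i)) = B at h1 h3
  apply mul_left_cancel₀ hA
  linear_combination N * C * glDim (Nat.card k) u * (Nat.card k : ℝ) ^ gradedDim Q.σ₁ D.arrowSign
      P.arrows (fun a => (e + Q.σΛ u) (Q.src a)) * h1 +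
    N * C * glDim (Nat.card k) u * glDim (Nat.card k) (e + Q.σΛ u) * h3

theorem hyp_sum (l : List (Q₀ → ℕ)) : (l.map Q.hyp).sum = Q.hyp l.sum := by
  induction l with
  | nil => rfl
  | cons d l ih =>
    rw [List.map_cons, List.sum_cons, List.sum_cons, ih]
    funext i
    simp only [InvQuiver.hyp, InvQuiver.σΛ, Pi.add_apply]
    ring

theorem σΛ_hyp (u : Q₀ → ℕ) : Q.σΛ (Q.hyp u) = Q.hyp u := by
  funext i
  simp only [InvQuiver.hyp, InvQuiver.σΛ, Pi.add_apply, Q.σ₀_invol]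
  ring

theorem σΛ_sub_hyp {d : Q₀ → ℕ} (hd : Q.σΛ d = d) (u : Q₀ → ℕ) :
    Q.σΛ (d - Q.hyp u) = d - Q.hyp u := by
  funext i
  exact congrArg₂ (· - ·) (congrFun hd i) (congrFun (σΛ_hyp u) i)

open Classical in
/-- The range of summation in terms of the sum `u` of the sequence. -/
theorem sumRange_eq {d : Q₀ → ℕ} (hd : Q.σΛ d = d) : Q.sumRange θ d =
    ⋃ u ∈ (({u ∈ Finset.Iic d | Q.hyp u ≤ d} : Finset (Q₀ → ℕ)) : Set (Q₀ → ℕ)),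
      (fun l => (l, d - Q.hyp u)) '' chainLists θ u := by
  ext ⟨l, e⟩
  simp only [Set.mem_iUnion, Set.mem_image, Finset.mem_coe, Finset.mem_filter, Finset.mem_Iic, exists_prop,
    Prod.mk.injEq, InvQuiver.sumRange, Set.mem_ofPred_eq, chainLists]
  constructor
  · rintro ⟨h1, -, h3, h4⟩
    rw [hyp_sum] at h3
    have h5 : Q.hyp l.sum ≤ d := h3 ▸ le_self_add
    refine ⟨l.sum, ⟨?_, h5⟩, l, ⟨h1, rfl, h4⟩, rfl, ?_⟩
    · exact le_trans le_self_add h5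
    · rw [← h3, add_tsub_cancel_left]
  · rintro ⟨u, ⟨-, hu⟩, l', ⟨h1, rfl, h4⟩, rfl, rfl⟩
    exact ⟨h1, σΛ_sub_hyp hd _, by rw [hyp_sum, add_tsub_cancel_of_le hu], h4⟩

theorem sumRange_finite {d : Q₀ → ℕ} (hd : Q.σΛ d = d) : (Q.sumRange θ d).Finite := by
  classical
  rw [sumRange_eq hd]
  exact Set.Finite.biUnion (Finset.finite_toSet _) fun u _ => (chainLists_finite θ u).image _

open Classical in
theorem finsum_summand (q : ℝ) (hq : q ≠ 0) {d : Q₀ → ℕ} (hd : Q.σΛ d = d) :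
    ∑ᶠ x ∈ Q.sumRange θ d, Q.summand D P q x = ∑ u ∈ Finset.Iic d with Q.hyp u ≤ d,
      q ^ (-Q.eulerForm (d - Q.hyp u) u - Q.sdEuler D P u) * chainSum Q θ q u *
        (q ^ (-Q.sdEuler D P (d - Q.hyp u)) / Q.qPochSd P q⁻¹ (d - Q.hyp u)) := by
  rw [sumRange_eq hd, finsum_mem_biUnion, finsum_mem_coe_finset]
  · refine Finset.sum_congr rfl fun u _ => ?_
    rw [finsum_mem_image (fun l _ l' _ hl => congrArg Prod.fst hl), chainSum,
      finsum_mem_eq_finite_toFinset_sum _ (chainLists_finite θ u),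
      finsum_mem_eq_finite_toFinset_sum _ (chainLists_finite θ u), Finset.mul_sum, Finset.sum_mul]
    refine Finset.sum_congr rfl fun l hl => ?_
    have hl : l.sum = u := ((Set.Finite.mem_toFinset _).1 hl).2.1
    simp only [InvQuiver.summand, chainTerm, sum_map_eulerForm, hl, sub_eq_add_neg, zpow_add₀ hq]
    change _ * (l.map (repWeight Q q)).prod * _ = _
    ring
  · intro u _ v _ huv
    refine Set.disjoint_left.2 ?_
    rintro _ ⟨l, hl, rfl⟩ ⟨l', hl', h⟩
    obtain rfl : l' = l := congrArg Prod.fst h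
    exact huv (hl.2.1.symm.trans hl'.2.1)
  · exact Finset.finite_toSet _
  · exact fun u _ => (chainLists_finite θ u).image _

end Evaluation

section StackCount

variable {k : Type u} [Field k] [Finite k] {Q₀ Q₁ : Type*} [Fintype Q₀] [DecidableEq Q₀]
  [Fintype Q₁] [DecidableEq Q₁] {Q : InvQuiver Q₀ Q₁} {D : DualityStructure Q} (P : PositivePart Q)
  {θ : (Q₀ → ℤ) →ₗ[ℤ] ℤ} {d : Q₀ → ℕ}

theorem stackCount_eq_sum (h2 : (2 : k) ≠ 0) (hθ : Q.IsCompatible θ) (hd : Q.σΛ d = d) :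
    stackCount k D θ d = (∑ u ∈ Finset.Iic d,
      Nat.card {U : ∀ i, Submodule k (coordSpace k d i) // dimSub U = u} *
        (isotropicCard Q D P k d u * ((Nat.card k : ℝ) ^ gradedDim Q.σ₁ D.arrowSign P.arrows
          (fun a => d (Q.src a) - u (Q.src a)) *
        (glDim (Nat.card k) u * chainSum Q θ (Nat.card k) u)))) / glDim (Nat.card k) d := by
  rw [stackCount_eq hθ hd, card_sdPoint_noDestab P h2 hθ (finrank_coordSpace_σ hd)]
  simp only [Module.finrank_fin_fun]

open Classical in
theorem stackCount_eq_finsum (h2 : (2 : k) ≠ 0) (hθ : Q.IsCompatible θ) (hd : Q.σΛ d = d)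
    (hpar : ∀ i, Q.σ₀ i = i → D.s i = -1 → Even (d i)) :
    stackCount k D θ d = ∑ᶠ x ∈ Q.sumRange θ d, Q.summand D P (Nat.card k) x := by
  have hq := one_lt_natCard k
  rw [stackCount_eq_sum P h2 hθ hd, finsum_summand P _ (by positivity) hd, Finset.sum_div,
    Finset.sum_filter]
  refine Finset.sum_congr rfl fun u hu => ?_
  split_ifs with h
  · have he := σΛ_sub_hyp hd u
    have hde : d - Q.hyp u + Q.hyp u = d := tsub_add_cancel_of_le h
    have hf : d - u = d - Q.hyp u + Q.σΛ u := by
      funext i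
      have := congrFun hde i
      simp only [InvQuiver.hyp, Pi.add_apply, Pi.sub_apply] at this ⊢
      omega
    have hN := card_gradedSubmodule_mul (⊤ : ∀ i, Submodule k (coordSpace k d i)) (w := u) (by
      intro i
      simpa [dimSub] using Finset.mem_Iic.1 hu i)
    have hT : dimSub (⊤ : ∀ i, Submodule k (coordSpace k d i)) = d := by
      funext i
      simp [dimSub]
    simp only [hT, le_top, true_and] at hN
    have h1 := isotropic_term_eq (D := D) P h2 (u := u) (N := Nat.card
      {U : ∀ i, Submodule k (coordSpace k d i) // dimSub U = u})
      (C := chainSum Q θ (Nat.card k) u) he (fun i hi hs => ?_) (by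
        rw [hde, ← hf]
        exact hN)
    · rw [hde, ← hf] at h1
      exact h1
    · have h3 := hpar i hi hs
      have h4 : Q.hyp u i = 2 * u i := by
        simp only [InvQuiver.hyp, InvQuiver.σΛ, Pi.add_apply, hi]
        ring
      rw [Pi.sub_apply, h4]
      exact h3.tsub (even_two_mul _)
  · rw [isotropicCard, if_neg h]
    ring

/-- There are no non-degenerate alternating forms in odd dimension, hence no self-dual
representations if the parity condition fails. -/
theorem stackCount_eq_zero (P : PositivePart Q) (h2 : (2 : k) ≠ 0) (hθ : Q.IsCompatible θ) (hd : Q.σΛ d = d)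
    {i : Q₀} (hi : Q.σ₀ i = i) (hs : D.s i = -1) (hodd : ¬ Even (d i)) :
    stackCount k D θ d = 0 := by
  rw [stackCount_eq_sum P h2 hθ hd, Finset.sum_eq_zero, zero_div]
  intro u _
  have h : isotropicCard Q D P k d u = 0 := by
    rw [isotropicCard]
    split_ifs with h
    · refine mul_eq_zero_of_right _ (Finset.prod_eq_zero (i := i) (by simpa using hi) ?_)
      have h1 : ¬ Even ((d - Q.hyp u) i) := by
        have h2 := h i
        have h4 : Q.hyp u i = 2 * u i := by
          simp only [InvQuiver.hyp, InvQuiver.σΛ, Pi.add_apply, hi]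
          ring
        rw [h4] at h2
        rw [Pi.sub_apply, h4, Nat.even_sub h2]
        simpa using hodd
      rw [hs, ndCard_eq_zero h2 h1]
      simp
    · rfl
  rw [h]
  ring

end StackCount

/-! ### Rationality -/

section Rationality

/-- `F` agrees on `(1, ∞)` with a rational function with integer coefficients without poles
there. -/
def IsRationalFn (F : ℝ → ℝ) : Prop :=
  ∃ a b : ℤ[X], ∀ t : ℝ, 1 < t → aeval t b ≠ 0 ∧ F t = aeval t a / aeval t b

namespace IsRationalFn

variable {F G : ℝ → ℝ}

theorem const (n : ℤ) : IsRationalFn fun _ => (n : ℝ) :=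
  ⟨C n, 1, fun t _ => by simp⟩

theorem id : IsRationalFn fun t => t := ⟨X, 1, fun t _ => by simp⟩

theorem add (hF : IsRationalFn F) (hG : IsRationalFn G) : IsRationalFn fun t => F t + G t := by
  obtain ⟨a, b, h⟩ := hF
  obtain ⟨a', b', h'⟩ := hG
  refine ⟨a * b' + b * a', b * b', fun t ht => ?_⟩
  obtain ⟨h1, h2⟩ := h t ht
  obtain ⟨h3, h4⟩ := h' t ht
  simp only [map_mul, map_add]
  exact ⟨mul_ne_zero h1 h3, by rw [h2, h4, div_add_div _ _ h1 h3]⟩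

theorem mul (hF : IsRationalFn F) (hG : IsRationalFn G) : IsRationalFn fun t => F t * G t := by
  obtain ⟨a, b, h⟩ := hF
  obtain ⟨a', b', h'⟩ := hG
  refine ⟨a * a', b * b', fun t ht => ?_⟩
  obtain ⟨h1, h2⟩ := h t ht
  obtain ⟨h3, h4⟩ := h' t ht
  simp only [map_mul]
  exact ⟨mul_ne_zero h1 h3, by rw [h2, h4, div_mul_div_comm]⟩

theorem inv (hF : IsRationalFn F) (h0 : ∀ t, 1 < t → F t ≠ 0) : IsRationalFn fun t => (F t)⁻¹ := by
  obtain ⟨a, b, h⟩ := hF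
  refine ⟨b, a, fun t ht => ?_⟩
  obtain ⟨h1, h2⟩ := h t ht
  refine ⟨fun ha => h0 t ht (by rw [h2, ha, zero_div]), ?_⟩
  simp only [h2, inv_div]

theorem div (hF : IsRationalFn F) (hG : IsRationalFn G) (h0 : ∀ t, 1 < t → G t ≠ 0) :
    IsRationalFn fun t => F t / G t := by
  simpa only [div_eq_mul_inv] using hF.mul (hG.inv h0)

theorem one_sub (hF : IsRationalFn F) : IsRationalFn fun t => 1 - F t := by
  have := (const 1).add ((const (-1)).mul hF)
  simpa [sub_eq_add_neg] using this

theorem pow (hF : IsRationalFn F) (n : ℕ) : IsRationalFn fun t => F t ^ n := by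
  induction n with
  | zero => simpa using const 1
  | succ n ih => simpa only [pow_succ] using ih.mul hF

theorem zpow (hF : IsRationalFn F) (h0 : ∀ t, 1 < t → F t ≠ 0) (n : ℤ) :
    IsRationalFn fun t => F t ^ n := by
  cases n with
  | ofNat n => simpa using hF.pow n
  | negSucc n =>
    simpa only [zpow_negSucc] using (hF.pow (n + 1)).inv fun t ht => pow_ne_zero _ (h0 t ht)

theorem sum {ι : Type*} (s : Finset ι) {F : ι → ℝ → ℝ} (h : ∀ i ∈ s, IsRationalFn (F i)) :
    IsRationalFn fun t => ∑ i ∈ s, F i t := by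
  classical
  induction s using Finset.induction_on with
  | empty => simpa using const 0
  | insert i s hi ih =>
    simp only [Finset.sum_insert hi]
    exact (h i (by simp)).add (ih fun j hj => h j (by simp [hj]))

theorem prod {ι : Type*} (s : Finset ι) {F : ι → ℝ → ℝ} (h : ∀ i ∈ s, IsRationalFn (F i)) :
    IsRationalFn fun t => ∏ i ∈ s, F i t := by
  classical
  induction s using Finset.induction_on with
  | empty => simpa using const 1
  | insert i s hi ih =>
    simp only [Finset.prod_insert hi]
    exact (h i (by simp)).mul (ih fun j hj => h j (by simp [hj]))

theorem list_prod {ι : Type*} (l : List ι) {F : ι → ℝ → ℝ} (h : ∀ i, IsRationalFn (F i)) :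
    IsRationalFn fun t => (l.map fun i => F i t).prod := by
  induction l with
  | nil => simpa using const 1
  | cons i l ih => simpa only [List.map_cons, List.prod_cons] using (h i).mul ih

theorem qPoch (hF : IsRationalFn F) (n : ℕ) : IsRationalFn fun t => qPoch (F t) n :=
  prod _ fun i _ => (hF.pow i).one_sub

end IsRationalFn

variable {Q₀ Q₁ : Type*} [Fintype Q₀] [DecidableEq Q₀] [Fintype Q₁] [DecidableEq Q₁]
  (Q : InvQuiver Q₀ Q₁) (D : DualityStructure Q) (P : PositivePart Q)

theorem isRationalFn_summand (x : List (Q₀ → ℕ) × (Q₀ → ℕ)) :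
    IsRationalFn fun t => Q.summand D P (t ^ 2) x := by
  have hq : IsRationalFn fun t => t ^ 2 := IsRationalFn.id.pow 2
  have h0 (t : ℝ) (ht : 1 < t) : t ^ 2 ≠ 0 := by positivity
  have h1 (t : ℝ) (ht : 1 < t) : 0 ≤ (t ^ 2)⁻¹ := by positivity
  have h2 (t : ℝ) (ht : 1 < t) : (t ^ 2)⁻¹ < 1 :=
    inv_lt_one_of_one_lt₀ (one_lt_pow₀ ht two_ne_zero)
  have hi := hq.inv h0
  refine IsRationalFn.mul (IsRationalFn.mul (IsRationalFn.mul ?_ (hq.zpow h0 _)) ?_) ?_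
  · simpa using (IsRationalFn.const (-1)).pow x.1.length
  · exact IsRationalFn.list_prod x.1 fun e => (hq.zpow h0 _).div
      (IsRationalFn.prod _ fun i _ => hi.qPoch (e i))
      fun t ht => Finset.prod_ne_zero_iff.2 fun i _ => qPoch_ne_zero (h1 t ht) (h2 t ht) _
  · exact (hq.zpow h0 _).div ((IsRationalFn.prod _ fun i _ => (hi.pow 2).qPoch _).mul
      (IsRationalFn.prod _ fun i _ => hi.qPoch _)) fun t ht => qPochSd_ne_zero P (h1 t ht) (h2 t ht) _

end Rationality

theorem mainTheorem2 {Q₀ Q₁ : Type*} [Fintype Q₀] [DecidableEq Q₀] [Fintype Q₁] [DecidableEq Q₁]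
    (Q : InvQuiver Q₀ Q₁) (D : DualityStructure Q) (P : PositivePart Q)
    (θ : (Q₀ → ℤ) →ₗ[ℤ] ℤ) (hθ : Q.IsCompatible θ)
    (d : Q₀ → ℕ) (hd : Q.σΛ d = d) :
    (∀ (k : Type u) [Field k] [Fintype k], ringChar k ≠ 2 →
      Finite (SemistableClass k D θ d) ∧
      (∀ M : SemistableRep k D θ d, Finite (SelfDualRep.Isometry M.1 M.1)) ∧
      ((∀ i, Q.σ₀ i = i → D.s i = -1 → Even (d i)) →
        (Q.sumRange θ d).Finite ∧
        stackGenCoeff k D P θ d =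
          √(Fintype.card k : ℝ) ^ Q.sdEuler D P d *
            ∑ᶠ x ∈ Q.sumRange θ d, Q.summand D P (Fintype.card k : ℝ) x)) ∧
    (∃ a b : ℤ[X], ∀ (k : Type u) [Field k] [Fintype k], ringChar k ≠ 2 →
      aeval √(Fintype.card k : ℝ) b ≠ 0 ∧
      stackGenCoeff k D P θ d =
        aeval √(Fintype.card k : ℝ) a / aeval √(Fintype.card k : ℝ) b) := by
  have hfin : (Q.sumRange θ d).Finite := sumRange_finite hd
  have key (k : Type u) [Field k] [Fintype k] (hk : ringChar k ≠ 2)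
      (hpar : ∀ i, Q.σ₀ i = i → D.s i = -1 → Even (d i)) : stackGenCoeff k D P θ d =
        √(Fintype.card k : ℝ) ^ Q.sdEuler D P d *
          ∑ᶠ x ∈ Q.sumRange θ d, Q.summand D P (Fintype.card k : ℝ) x := by
    rw [stackGenCoeff, stackCount_eq_finsum P (Ring.two_ne_zero hk) hθ hd hpar,
      Nat.card_eq_fintype_card]
  refine ⟨fun k _ _ hk => ⟨finite_semistableClass hθ hd, fun M => inferInstance,
    fun hpar => ⟨hfin, key k hk hpar⟩⟩, ?_⟩
  by_cases hpar : ∀ i, Q.σ₀ i = i → D.s i = -1 → Even (d i)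
  · have hrat : IsRationalFn fun t => t ^ Q.sdEuler D P d *
        ∑ x ∈ hfin.toFinset, Q.summand D P (t ^ 2) x :=
      (IsRationalFn.id.zpow (fun t ht => by positivity) _).mul
        (IsRationalFn.sum _ fun x _ => isRationalFn_summand Q D P x)
    obtain ⟨a, b, h⟩ := hrat
    refine ⟨a, b, fun k _ _ hk => ?_⟩
    have h1 : (1 : ℝ) < √(Fintype.card k : ℝ) := by
      rw [Real.lt_sqrt zero_le_one, one_pow]
      exact_mod_cast Fintype.one_lt_card
    obtain ⟨h2, h3⟩ := h _ h1
    refine ⟨h2, ?_⟩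
    rw [← h3, key k hk hpar, finsum_mem_eq_finite_toFinset_sum _ hfin]
    simp only [Real.sq_sqrt (Nat.cast_nonneg (Fintype.card k) : (0 : ℝ) ≤ _)]
  · push Not at hpar
    obtain ⟨i, hi, hs, hodd⟩ := hpar
    refine ⟨0, 1, fun k _ _ hk => ⟨by simp, ?_⟩⟩
    rw [stackGenCoeff, stackCount_eq_zero P (Ring.two_ne_zero hk) hθ hd hi hs hodd]
    simp
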